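/- All graphs are finite and loopless, but may have parallel edges. A signed graph is a graph $G=(V,E)$ with a signature $\sigma:E\to\{1,-1\}$; the sign of a cycle $C$ is $\prod_{e\in E(C)}\sigma(e)$ (two parallel edges form a cycle of length two), and a signed graph is balanced if all its cycles have sign $1$. Two edges are tied in $G$ if $G$ does not contain both a cycle of sign $1$ through the two edges and a cycle of sign $-1$ through the two edges; that is, if all cycles containing both edges have the same sign. A graph is $3$-connected if it has more than three vertices and remains connected whenever fewer than three vertices are deleted. A parallel class is the set of all edges with the same two ends as some given edge, and an edge-cut is the set of all edges with exactly one end in $X$, for some $X\subseteq V$. Theorem. Let $G$ be a $3$-connected signed graph and let $e_1,e_2\in E(G)$ be distinct edges, neither of which is parallel to any other edge of $G$. Then $e_1$ and $e_2$ are tied in $G$ if and only if at least one of the following holds: (i) there exists a parallel class $F$ containing edges of both signs such that $F^+=F\cup\{e_1,e_2\}$ is an edge-cut of $G$ and $G-F^+$ is balanced; (ii) $e_1$ and $e_2$ are incident with a common vertex $v$ and $G-v$ is balanced; (iii) $G-\{e_1,e_2\}$ is balanced. -/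

import Mathlib

open scoped Graph

namespace Graph

variable {α β : Type*}

/-- `G.IsWalk u w v`: the list `w = [(f₁, x₁), …, (fₖ, xₖ)]` describes a walk
`u, f₁, x₁, f₂, x₂, …, fₖ, xₖ = v` of `G` from `u` to `v`. -/
def IsWalk (G : Graph α β) : α → List (β × α) → α → Prop
  | u, [], v => u ∈ V(G) ∧ u = v
  | u, p :: w, v => G.IsLink p.1 u p.2 ∧ G.IsWalk p.2 w v

/-- A graph is connected if it has a vertex and any two vertices are joined by a walk. -/
def IsConnected (G : Graph α β) : Prop :=
  V(G).Nonempty ∧ ∀ u ∈ V(G), ∀ v ∈ V(G), ∃ w, G.IsWalk u w v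

/-- `k`-connectedness (of a possibly non-simple graph): there are more than `k` vertices, and
deleting fewer than `k` vertices always leaves a connected graph. -/
def IsKConnected (G : Graph α β) (k : ℕ) : Prop :=
  (k : ℕ∞) < V(G).encard ∧
    ∀ X ⊆ V(G), X.encard < (k : ℕ∞) → (G.deleteVerts X).IsConnected

/-- A cycle `u, f₁, x₁, …, fₖ, xₖ = u`, given by a starting vertex `u` and a nonempty closed walk
without repeated vertices `x₁, …, xₖ` and without repeated edges `f₁, …, fₖ`. Two distinct
parallel edges form a cycle of length two. -/
structure IsCycle (G : Graph α β) (u : α) (w : List (β × α)) : Prop where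
  isWalk : G.IsWalk u w u
  ne_nil : w ≠ []
  nodup_vertices : (w.map Prod.snd).Nodup
  nodup_edges : (w.map Prod.fst).Nodup

/-- The sign of a cycle (or walk): the product of the signs of its edges. -/
def walkSign (σ : β → ℤˣ) (w : List (β × α)) : ℤˣ :=
  (w.map fun p => σ p.1).prod

/-- A signed graph is balanced if all its cycles are positive. -/
def IsBalanced (G : Graph α β) (σ : β → ℤˣ) : Prop :=
  ∀ u w, G.IsCycle u w → walkSign σ w = 1

/-- Some cycle of `G` that contains both `e₁` and `e₂` has sign `s`. -/
def HasCycleThrough (G : Graph α β) (σ : β → ℤˣ) (e₁ e₂ : β) (s : ℤˣ) : Prop :=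
  ∃ u w, G.IsCycle u w ∧ e₁ ∈ w.map Prod.fst ∧ e₂ ∈ w.map Prod.fst ∧ walkSign σ w = s

/-- `e₁` and `e₂` are untied if cycles of both signs contain them. -/
def Untied (G : Graph α β) (σ : β → ℤˣ) (e₁ e₂ : β) : Prop :=
  G.HasCycleThrough σ e₁ e₂ 1 ∧ G.HasCycleThrough σ e₁ e₂ (-1)

/-- `e₁` and `e₂` are tied if they are not untied. -/
def Tied (G : Graph α β) (σ : β → ℤˣ) (e₁ e₂ : β) : Prop :=
  ¬ G.Untied σ e₁ e₂

/-- Two edges of `G` are parallel if they have the same ends. -/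
def Parallel (G : Graph α β) (e f : β) : Prop :=
  ∃ x y, G.IsLink e x y ∧ G.IsLink f x y

/-- A parallel class of `G`: all the edges that are parallel to some given edge. -/
def IsParallelClass (G : Graph α β) (F : Set β) : Prop :=
  ∃ e ∈ E(G), F = {f | G.Parallel e f}

/-- An edge-cut of `G`: all the edges with exactly one end in some vertex set `X`. -/
def IsEdgeCut (G : Graph α β) (S : Set β) : Prop :=
  ∃ X ⊆ V(G), S = {e | ∃ x y, G.IsLink e x y ∧ x ∈ X ∧ y ∉ X}

end Graph

/-! Sufficiency rests on switching. A balanced graph has a potential, so the balanced subgraph in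
each case can be made all positive without changing the sign of any cycle. Once every further edge
of a cycle through `e₁` and `e₂` is positive, all such cycles have the sign of `e₁` times that of
`e₂`. This is immediate in (iii). In (ii) such a cycle spends both its edges at `v` on `e₁` and
`e₂`. In (i) it would contain at most one edge of `F`, but three edges of a cut are impossible by
parity, so it contains none (`tied_of_isEdgeCut`).

For necessity, the basic tool is a path through both edges that meets a negative cycle exactly in
its two ends: the two arcs complete it to cycles of opposite signs. The second tool is a pair of
crossing chords of a negative cycle, each through one of the edges. Suitable paths come from
Menger's theorem. If the edges share an end `v`, two disjoint paths to a negative cycle of `G - v`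
suffice.

If the edges share no end, the heart is `IsEdgePair.untied_of_isGood`: a negative cycle with at
least three vertices that avoids both edges forces them to be untied. Two facts carry it.

First, `CycleOn.untied_of_isComponent`: the edges are untied if they have ends in one component of
`G - C` for a long negative cycle `C`.

Secondly, take a maximal connected set `K` that contains an end of `e₁` and avoids some long
negative cycle missing both edges; if all these cycles contain all four ends, take `K` empty. If `K`
meets `e₂`, the first fact applies. Otherwise maximality puts every attachment of `K` on every such
cycle `C`, while `e₂` lies on a chord `T` of `C` that avoids `K`. If attachments lie strictly inside
both arcs determined by `T`, then `e₁` can be led through `K` to give a chord crossing `T`, or else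
a vertex separating it allows rerouting to the first fact. If one arc contains all attachments,
3-connectivity gives a path `W` from the stretch between the extreme attachments to the rest of the
cycle and chord. An end of `W` on the cycle produces a long negative cycle that misses an
attachment, a contradiction; an end on `T` produces a new cycle and chord to which the crossing
argument applies.

Hence, for tied edges with no common end, all negative cycles avoiding both edges are pairs of
parallel edges of opposite signs. If such a pair joins `u` to `v`, no `u`–`v` path remains after
deletion of its parallel class, `e₁` and `e₂`, since it would close up to a long negative cycle.
This gives an edge-cut, and 3-connectivity puts both `e₁` and `e₂` in it. A second such class would
give a second cut; the symmetric difference of the two vertex sets would have a boundary inside two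
parallel classes, which 3-connectivity forbids. So the rest is balanced and (i) holds. -/

/-! ### Menger's theorem for finite relations -/

section Menger

variable {V : Type*} {r r' : V → V → Prop} {A B : Set V} {u v x : V} {l l₁ l₂ : List V}

/-- `RelWalk r u l v`: the list `u :: l` is an `r`-walk from `u` to `v`. -/
def RelWalk (r : V → V → Prop) : V → List V → V → Prop
  | u, [], v => u = v
  | u, x :: l, v => r u x ∧ RelWalk r x l v

theorem RelWalk.append {w : V} (h₁ : RelWalk r u l₁ v) (h₂ : RelWalk r v l₂ w) :
    RelWalk r u (l₁ ++ l₂) w := by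
  induction l₁ generalizing u with
  | nil => cases h₁; exact h₂
  | cons x l ih => exact ⟨h₁.1, ih h₁.2⟩

theorem RelWalk.mono (hr : ∀ x y, r x y → r' x y) (h : RelWalk r u l v) : RelWalk r' u l v := by
  induction l generalizing u with
  | nil => exact h
  | cons x l ih => exact ⟨hr _ _ h.1, ih h.2⟩

theorem RelWalk.end_mem (h : RelWalk r u l v) : v ∈ u :: l := by
  induction l generalizing u with
  | nil => cases h; simp
  | cons x l ih => exact List.mem_cons_of_mem _ (ih h.2)

theorem RelWalk.exists_split (h : RelWalk r u l v) (hx : x ∈ u :: l) :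
    ∃ l₁ l₂, l = l₁ ++ l₂ ∧ RelWalk r u l₁ x ∧ RelWalk r x l₂ v ∧ (x :: l₂).Sublist (u :: l) := by
  induction l generalizing u with
  | nil =>
    cases h
    simp only [List.mem_cons, List.not_mem_nil, or_false] at hx
    subst hx
    exact ⟨[], [], rfl, rfl, rfl, List.Sublist.refl _⟩
  | cons y l ih =>
    rcases List.mem_cons.1 hx with rfl | hx
    · exact ⟨[], y :: l, rfl, rfl, h, List.Sublist.refl _⟩
    · obtain ⟨l₁, l₂, rfl, h₁, h₂, h₃⟩ := ih h.2 hx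
      exact ⟨y :: l₁, l₂, rfl, ⟨h.1, h₁⟩, h₂, h₃.cons _⟩

/-- The end of a walk that starts in a set closed under the steps of the walk is in the set. -/
theorem RelWalk.mem_of_closed {S : Set V} (h : RelWalk r u l v) (hu : u ∈ S)
    (hS : ∀ s ∈ S, ∀ t ∈ l, r s t → t ∈ S) : v ∈ S := by
  induction l generalizing u with
  | nil => cases h; exact hu
  | cons y l ih =>
    exact ih h.2 (hS _ hu _ (by simp) h.1) fun s hs t ht => hS s hs t (List.mem_cons_of_mem _ ht)

theorem RelWalk.exists_nodup (h : RelWalk r u l v) :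
    ∃ l', RelWalk r u l' v ∧ (u :: l').Nodup ∧ u :: l' ⊆ u :: l := by
  induction l generalizing u with
  | nil => exact ⟨[], h, by simp, by simp⟩
  | cons y l ih =>
    obtain ⟨l', h₁, h₂, h₃⟩ := ih h.2
    by_cases hu : u ∈ y :: l'
    · obtain ⟨m₁, m₂, -, -, hw, hs⟩ := h₁.exists_split hu
      exact ⟨m₂, hw, hs.nodup h₂, fun z hz => List.mem_cons_of_mem _ (h₃ (hs.subset hz))⟩
    · exact ⟨y :: l', ⟨h.1, h₁⟩, List.nodup_cons.2 ⟨hu, h₂⟩, List.cons_subset_cons _ h₃⟩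

/-- Cut a walk at its first vertex in `B`. -/
theorem RelWalk.exists_first (h : RelWalk r u l v) (hl : (u :: l).Nodup) (hB : v ∈ B) :
    ∃ l' v', RelWalk r u l' v' ∧ v' ∈ B ∧ (u :: l').Sublist (u :: l) ∧
      ∀ z ∈ u :: l', z ∈ B → z = v' := by
  induction l generalizing u with
  | nil => cases h; exact ⟨[], v, rfl, hB, List.Sublist.refl _, by simp⟩
  | cons y l ih =>
    by_cases hu : u ∈ B
    · exact ⟨[], u, rfl, hu, by simp, by simp⟩
    · obtain ⟨l', v', h₁, h₂, h₃, h₄⟩ := ih h.2 (List.nodup_cons.1 hl).2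
      refine ⟨y :: l', v', ⟨h.1, h₁⟩, h₂, h₃.cons_cons u, fun z hz hzB => ?_⟩
      rcases List.mem_cons.1 hz with rfl | hz
      · exact absurd hzB hu
      · exact h₄ z hz hzB

/-- Cut a walk at its last vertex in `A`. -/
theorem RelWalk.exists_last (h : RelWalk r u l v) (hA : ∃ z ∈ u :: l, z ∈ A) :
    ∃ u' l', RelWalk r u' l' v ∧ u' ∈ A ∧ (u' :: l').Sublist (u :: l) ∧ ∀ z ∈ l', z ∉ A := by
  induction l generalizing u with
  | nil =>
    cases h
    simp only [List.mem_cons, List.not_mem_nil, or_false, exists_eq_left] at hA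
    exact ⟨v, [], rfl, hA, List.Sublist.refl _, by simp⟩
  | cons y l ih =>
    by_cases hu : ∃ z ∈ y :: l, z ∈ A
    · obtain ⟨u', l', h₁, h₂, h₃, h₄⟩ := ih h.2 hu
      exact ⟨u', l', h₁, h₂, h₃.cons _, h₄⟩
    · push Not at hu
      obtain ⟨z, hz, hzA⟩ := hA
      rcases List.mem_cons.1 hz with rfl | hz
      · exact ⟨z, y :: l, h, hzA, List.Sublist.refl _, hu⟩
      · exact absurd hzA (hu z hz)

/-- A path from `A` to `B` with only its first vertex in `A` and only its last vertex in `B`. -/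
structure RelPath (r : V → V → Prop) (A B : Set V) (u : V) (l : List V) (v : V) : Prop where
  walk : RelWalk r u l v
  nodup : (u :: l).Nodup
  start_mem : u ∈ A
  end_mem : v ∈ B
  eq_start : ∀ z ∈ u :: l, z ∈ A → z = u
  eq_end : ∀ z ∈ u :: l, z ∈ B → z = v

theorem RelWalk.exists_relPath (h : RelWalk r u l v) (hA : u ∈ A) (hB : v ∈ B) :
    ∃ u' l' v', RelPath r A B u' l' v' ∧ u' :: l' ⊆ u :: l := by
  obtain ⟨l₁, h₁, hn₁, hs₁⟩ := h.exists_nodup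
  obtain ⟨l₂, v', h₂, hv', hs₂, hB₂⟩ := h₁.exists_first hn₁ hB
  obtain ⟨u', l₃, h₃, hu', hs₃, hA₃⟩ := h₂.exists_last (A := A) ⟨u, by simp, hA⟩
  refine ⟨u', l₃, v', ⟨h₃, hs₃.nodup (hs₂.nodup hn₁), hu', hv', fun z hz hzA => ?_,
    fun z hz => hB₂ z (hs₃.subset hz)⟩, fun z hz => hs₁ (hs₂.subset (hs₃.subset hz))⟩
  rcases List.mem_cons.1 hz with rfl | hz
  · rfl
  · exact absurd hzA (hA₃ z hz)

/-- `X` does not separate `A` from `B`. -/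
def RelConn (r : V → V → Prop) (X A B : Set V) : Prop :=
  ∀ S : Set V, (∀ a ∈ A, a ∉ X → a ∈ S) → (∀ s ∈ S, s ∉ X → ∀ t, t ∉ X → r s t → t ∈ S) →
    ∃ b ∈ B, b ∉ X ∧ b ∈ S

/-- Since only the last vertex can be in `X`, all steps before it avoid `X` and cannot leave `S`.
This keeps paths that end at a separator on its near side. -/
theorem RelWalk.mem_of_closed_of_first {X S : Set V} (h : RelWalk r u l v) (hl : (u :: l).Nodup)
    (hX : ∀ z ∈ u :: l, z ∈ X → z = v) (hu : u ∉ X → u ∈ S)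
    (hS : ∀ s ∈ S, s ∉ X → ∀ t, t ∉ X → r s t → t ∈ S) : ∀ z ∈ u :: l, z ∉ X → z ∈ S := by
  induction l generalizing u with
  | nil =>
    intro z hz hzX
    simp only [List.mem_cons, List.not_mem_nil, or_false] at hz
    subst hz
    exact hu hzX
  | cons y l ih =>
    have huX : u ∉ X := fun huX => (List.nodup_cons.1 hl).1 (by
      rw [hX u (by simp) huX]; exact h.2.end_mem)
    intro z hz hzX
    rcases List.mem_cons.1 hz with rfl | hz
    · exact hu hzX
    · exact ih h.2 (List.nodup_cons.1 hl).2 (fun w hw => hX w (List.mem_cons_of_mem _ hw))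
        (fun hyX => hS u (hu huX) huX y hyX h.1) z hz hzX

/-- Paths from `A` to `X ∪ {x}` and from `X ∪ {y}` to `B` are glued along `X` and along the step
from `x` to `y`. -/
theorem glue_relPaths [DecidableEq V] {X : Finset V} {S : Set V} {x y : V} {k : ℕ}
    (hr : ∀ a b, r a b → r' a b) (hxy : r' x y)
    (hAS : ∀ a ∈ A, a ∉ X → a ∈ S) (hS : ∀ s ∈ S, s ∉ X → ∀ t, t ∉ X → r s t → t ∈ S)
    (hBS : ∀ b ∈ B, b ∉ X → b ∉ S) (hy : y ∉ X) (hk : (insert y X).card = k)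
    {s₁ t₁ s₂ t₂ : Fin k → V} {l₁ l₂ : Fin k → List V}
    (hP : ∀ i, RelPath r A (insert x X : Finset V) (s₁ i) (l₁ i) (t₁ i))
    (hQ : ∀ i, RelPath r (insert y X : Finset V) B (s₂ i) (l₂ i) (t₂ i))
    (hPd : ∀ i j z, z ∈ s₁ i :: l₁ i → z ∈ s₁ j :: l₁ j → i = j)
    (hQd : ∀ i j z, z ∈ s₂ i :: l₂ i → z ∈ s₂ j :: l₂ j → i = j) :
    ∃ (s t : Fin k → V) (l : Fin k → List V),
      (∀ i, s i ∈ A ∧ t i ∈ B ∧ RelWalk r' (s i) (l i) (t i)) ∧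
      ∀ i j z, z ∈ s i :: l i → z ∈ s j :: l j → i = j := by
  -- Off `X` the first paths stay in `S`. A second path never returns to `X` after its start, so
  -- having met `S` outside `X` it would remain there and bring an element of `B` into `S`.
  have hmeet : ∀ i j z, z ∈ s₁ i :: l₁ i → z ∈ s₂ j :: l₂ j → z ∈ X := by
    intro i j z hi hj
    by_contra hzX
    have hzS : z ∈ S := (hP i).walk.mem_of_closed_of_first (X := X) (hP i).nodup
      (fun w hw hwX => (hP i).eq_end w hw (Finset.mem_insert_of_mem hwX))
      (hAS _ (hP i).start_mem) hS z hi hzX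
    obtain ⟨m₁, m₂, hm, -, hw, -⟩ := (hQ j).walk.exists_split hj
    have hnot : ∀ w ∈ m₂, w ∉ X := by
      intro w hw hwX
      have hwl : w ∈ l₂ j := by rw [hm]; exact List.mem_append_right _ hw
      have := (hQ j).eq_start w (List.mem_cons_of_mem _ hwl) (Finset.mem_insert_of_mem hwX)
      exact (List.nodup_cons.1 (hQ j).nodup).1 (this ▸ hwl)
    have hend : t₂ j ∈ S \ X := hw.mem_of_closed ⟨hzS, hzX⟩ fun a ha b hb hab =>
      ⟨hS a ha.1 ha.2 b (hnot b hb) hab, hnot b hb⟩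
    exact hBS _ (hQ j).end_mem hend.2 hend.1
  -- The `k` disjoint paths have distinct starts in a set of size `k`, so they use all of it.
  have hsurj : ∀ z ∈ insert y X, ∃ j, s₂ j = z := by
    have hinj : Function.Injective s₂ := fun i j hij => hQd i j (s₂ i) (by simp) (by simp [hij])
    have himg : Finset.univ.image s₂ = insert y X := Finset.eq_of_subset_of_card_le
      (fun z hz => by
        obtain ⟨j, -, rfl⟩ := Finset.mem_image.1 hz
        exact (hQ j).start_mem)
      (by rw [Finset.card_image_of_injective _ hinj, hk]; simp)
    intro z hz
    rw [← himg] at hz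
    obtain ⟨j, -, rfl⟩ := Finset.mem_image.1 hz
    exact ⟨j, rfl⟩
  have ht₁ : ∀ i, t₁ i ≠ x → t₁ i ∈ X := fun i hi =>
    (Finset.mem_insert.1 (hP i).end_mem).resolve_left hi
  have hg : ∀ i, ∃ j, s₂ j = if t₁ i = x then y else t₁ i := fun i => hsurj _ (by
    split_ifs with h
    · simp
    · exact Finset.mem_insert_of_mem (ht₁ i h))
  choose g hg using hg
  have hgi : ∀ i i', g i = g i' → i = i' := by
    intro i i' h
    have h' : (if t₁ i = x then y else t₁ i) = if t₁ i' = x then y else t₁ i' := by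
      rw [← hg, ← hg, h]
    have : t₁ i = t₁ i' := by
      split_ifs at h' with h₁ h₂ h₂
      · rw [h₁, h₂]
      · exact absurd (h' ▸ ht₁ i' h₂) hy
      · exact absurd (h' ▸ ht₁ i h₁) hy
      · exact h'
    exact hPd i i' (t₁ i) (hP i).walk.end_mem (this ▸ (hP i').walk.end_mem)
  -- Only the path that ends in `x` needs the extra step to `y`; the others continue at the vertex
  -- of `X` where they end.
  refine ⟨s₁, fun i => t₂ (g i),
    fun i => if t₁ i = x then l₁ i ++ y :: l₂ (g i) else l₁ i ++ l₂ (g i), fun i => ?_, ?_⟩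
  · refine ⟨(hP i).start_mem, (hQ _).end_mem, ?_⟩
    have hw₁ := (hP i).walk.mono hr
    have hw₂ := (hQ (g i)).walk.mono hr
    have hgi := hg i
    beta_reduce
    split_ifs at hgi ⊢ with h
    · rw [h] at hw₁
      rw [hgi] at hw₂
      exact hw₁.append (show RelWalk r' x (y :: l₂ (g i)) _ from ⟨hxy, hw₂⟩)
    · rw [hgi] at hw₂
      exact hw₁.append hw₂
  · have hsub : ∀ i z, z ∈ s₁ i :: (if t₁ i = x then l₁ i ++ y :: l₂ (g i) else
        l₁ i ++ l₂ (g i)) → z ∈ s₁ i :: l₁ i ∨ z ∈ s₂ (g i) :: l₂ (g i) := by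
      intro i z hz
      have hgi := hg i
      split_ifs at hz hgi <;> simp only [List.mem_cons, List.mem_append] at hz ⊢ <;>
        rw [hgi] <;> tauto
    have hcross : ∀ i j z, z ∈ s₁ i :: l₁ i → z ∈ s₂ (g j) :: l₂ (g j) → i = j := by
      intro i j z hi hj
      have hzX := hmeet i (g j) z hi hj
      have h₁ := (hP i).eq_end z hi (Finset.mem_insert_of_mem hzX)
      have h₂ := (hQ (g j)).eq_start z hj (Finset.mem_insert_of_mem hzX)
      have hgj := hg j
      split_ifs at hgj with h
      · exact absurd (by rw [← hgj, ← h₂]; exact hzX) hy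
      · exact hPd i j (t₁ i) (hP i).walk.end_mem (by
          rw [← h₁, h₂, hgj]; exact (hP j).walk.end_mem)
    intro i j z hi hj
    rcases hsub i z hi with hi | hi <;> rcases hsub j z hj with hj | hj
    · exact hPd i j z hi hj
    · exact hcross i j z hi hj
    · exact (hcross j i z hj hi).symm
    · exact hgi i j (hQd _ _ z hi hj)

/-- Induction on the set of steps. If deleting the step from `x` to `y` creates a separator `X` with
fewer than `k` vertices, then `X ∪ {x}` and `X ∪ {y}` have exactly `k` vertices. The induction
hypothesis links `A` to the former and the latter to `B`, and the two families are glued. -/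
theorem exists_disjoint_relWalks {E : Set (V × V)} (hE : E.Finite) : ∀ (A B : Set V) (k : ℕ),
    (∀ X : Finset V, X.card < k → RelConn (fun x y => (x, y) ∈ E) X A B) →
    ∃ (s t : Fin k → V) (l : Fin k → List V),
      (∀ i, s i ∈ A ∧ t i ∈ B ∧ RelWalk (fun x y => (x, y) ∈ E) (s i) (l i) (t i)) ∧
      ∀ i j x, x ∈ s i :: l i → x ∈ s j :: l j → i = j := by
  classical
  induction E, hE using Set.Finite.induction_on with
  | empty =>
    intro A B k h
    -- Without steps the set `A` is closed, so fewer than `k` common elements would themselves form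
    -- a forbidden separator. The paths can therefore be trivial.
    have hk : (k : ℕ∞) ≤ (A ∩ B).encard := by
      by_contra! hlt
      have hfin : (A ∩ B).Finite := Set.finite_of_encard_le_coe hlt.le
      obtain ⟨b, hb, hbX, hbS⟩ := h hfin.toFinset
        (by rw [hfin.encard_eq_coe_toFinset_card] at hlt; exact_mod_cast hlt) A
        (fun a ha _ => ha) (fun s _ _ t _ hst => absurd hst (by simp))
      exact hbX (by simp [hb, hbS])
    obtain ⟨T, hT, hTk⟩ := Set.exists_subset_encard_eq hk
    have hTfin : T.Finite := Set.finite_of_encard_eq_coe hTk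
    have hcard : hTfin.toFinset.card = k := by
      rw [hTfin.encard_eq_coe_toFinset_card] at hTk; exact_mod_cast hTk
    let φ := (hTfin.toFinset.equivFinOfCardEq hcard).symm
    have hφ : ∀ i, (φ i : V) ∈ A ∩ B := fun i => hT (hTfin.mem_toFinset.1 (φ i).2)
    refine ⟨fun i => φ i, fun i => φ i, fun _ => [], fun i => ⟨(hφ i).1, (hφ i).2, rfl⟩, ?_⟩
    intro i j x hi hj
    simp only [List.mem_cons, List.not_mem_nil, or_false] at hi hj
    exact φ.injective (Subtype.ext (hi.symm.trans hj))
  | @insert p E hp hE ih =>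
    obtain ⟨x, y⟩ := p
    intro A B k h
    by_cases hX : ∀ X : Finset V, X.card < k → RelConn (fun x y => (x, y) ∈ E) X A B
    · obtain ⟨s, t, l, h₁, h₂⟩ := ih A B k hX
      exact ⟨s, t, l, fun i => ⟨(h₁ i).1, (h₁ i).2.1,
        (h₁ i).2.2.mono fun _ _ h => Set.mem_insert_of_mem _ h⟩, h₂⟩
    push Not at hX
    obtain ⟨X, hXk, hX⟩ := hX
    unfold RelConn at hX
    push Not at hX
    obtain ⟨S₀, hA₀, hS₀, hB₀⟩ := hX
    -- Adding either end of the deleted step to `X` blocks that step too, and so separates `A` from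
    -- `B` in the full relation.
    have hcard : ∀ z, (z = x ∨ z = y) → k ≤ (insert z X).card := by
      intro z hz
      by_contra! hlt
      have hX : ∀ a, a ∉ ((insert z X : Finset V) : Set V) → a ∉ X := fun a ha haX =>
        ha (Finset.mem_insert_of_mem haX)
      obtain ⟨b, hb, hbX, hbS⟩ := h _ hlt S₀ (fun a ha haX => hA₀ a ha (hX a haX))
        (by
          intro s hs hsX t htX hst
          rcases hst with hst | hst
          · rw [Prod.mk.injEq] at hst
            rcases hz with rfl | rfl
            · exact absurd (by rw [hst.1]; simp) hsX
            · exact absurd (by rw [hst.2]; simp) htX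
          · exact hS₀ s hs (hX s hsX) t (hX t htX) hst)
      exact hB₀ b hb (hX b hbX) hbS
    have hyX : (insert y X).card = k :=
      le_antisymm ((Finset.card_insert_le _ _).trans hXk) (hcard y (Or.inr rfl))
    have hy : y ∉ X := fun hy => by rw [Finset.insert_eq_of_mem hy] at hyX; omega
    obtain ⟨s, t, l, hP, hPd⟩ := ih A (insert x X : Finset V) k (by
      intro Y hY S hAS hS
      by_contra! hno
      have hnoX : ∀ z, z ∉ Y → z ∈ S → z ∉ X := fun z hzY hzS hzX =>
        hno z (Finset.mem_insert_of_mem hzX) hzY hzS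
      -- If `Y` separated `A` from `X ∪ {x}`, then everything reached from `A` would avoid `X` and
      -- `x`, and would stay in `S₀`. Thus `Y` would separate `A` from `B`.
      obtain ⟨b, hb, hbY, hbS, hbS₀⟩ := h Y hY (S ∩ S₀)
        (fun a ha haY => ⟨hAS a ha haY, hA₀ a ha (hnoX a haY (hAS a ha haY))⟩)
        (by
          rintro s ⟨hsS, hsS₀⟩ hsY t htY hst
          rcases hst with hst | hst
          · rw [Prod.mk.injEq] at hst
            exact absurd hsS (hno s (by rw [hst.1]; simp) hsY)
          · have htS := hS s hsS hsY t htY hst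
            exact ⟨htS, hS₀ s hsS₀ (hnoX s hsY hsS) t (hnoX t htY htS) hst⟩)
      exact hB₀ b hb (hnoX b hbY hbS) hbS₀)
    obtain ⟨s', t', l', hQ, hQd⟩ := ih (insert y X : Finset V) B k (by
      intro Y hY S hAS hS
      by_contra! hno
      -- Dually, `S` is reached from `X ∪ {y}`. Adding the near side of `X` gives a set that
      -- contains `A` off `Y` and is closed under all steps.
      obtain ⟨b, hb, hbY, hbS⟩ := h Y hY (S ∪ (S₀ \ X))
        (fun a ha haY => by
          by_cases haX : a ∈ X
          · exact Or.inl (hAS a (Finset.mem_insert_of_mem haX) haY)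
          · exact Or.inr ⟨hA₀ a ha haX, haX⟩)
        (by
          rintro s hs hsY t htY hst
          rcases hst with hst | hst
          · rw [Prod.mk.injEq] at hst
            exact Or.inl (hAS t (by rw [hst.2]; simp) htY)
          · rcases hs with hs | ⟨hs, hsX⟩
            · exact Or.inl (hS s hs hsY t htY hst)
            · by_cases htX : t ∈ X
              · exact Or.inl (hAS t (Finset.mem_insert_of_mem htX) htY)
              · exact Or.inr ⟨hS₀ s hs hsX t htX hst, htX⟩)
      rcases hbS with hbS | ⟨hbS, hbX⟩
      · exact hno b hb hbY hbS
      · exact hB₀ b hb hbX hbS)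
    have hP' := fun i => (hP i).2.2.exists_relPath (hP i).1 (hP i).2.1
    choose s₁ l₁ t₁ hP₁ hPs using hP'
    have hQ' := fun i => (hQ i).2.2.exists_relPath (hQ i).1 (hQ i).2.1
    choose s₂ l₂ t₂ hQ₁ hQs using hQ'
    exact glue_relPaths (fun a b hab => Set.mem_insert_of_mem _ hab) (Set.mem_insert _ _) hA₀ hS₀
      hB₀ hy hyX hP₁ hQ₁ (fun i j z hi hj => hPd i j z (hPs i hi) (hPs j hj))
      (fun i j z hi hj => hQd i j z (hQs i hi) (hQs j hj))

/-- **Menger's theorem**: if no set of fewer than `k` vertices separates `A` from `B`, there are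
`k` disjoint paths from `A` to `B`. -/
theorem exists_disjoint_relPaths (hr : {p : V × V | r p.1 p.2}.Finite) (k : ℕ)
    (h : ∀ X : Finset V, X.card < k → RelConn r X A B) :
    ∃ (s t : Fin k → V) (l : Fin k → List V), (∀ i, RelPath r A B (s i) (l i) (t i)) ∧
      ∀ i j x, x ∈ s i :: l i → x ∈ s j :: l j → i = j := by
  obtain ⟨s, t, l, h₁, h₂⟩ := exists_disjoint_relWalks hr A B k h
  have h' := fun i => (h₁ i).2.2.exists_relPath (h₁ i).1 (h₁ i).2.1
  choose s' l' t' h₃ h₄ using h'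
  exact ⟨s', t', l', h₃, fun i j x hi hj => h₂ i j x (h₄ i hi) (h₄ j hj)⟩

end Menger

/-! ### Paths and cycles with their vertex set, edge set and sign -/

namespace Graph

variable {α β : Type*} {G : Graph α β} {σ : β → ℤˣ} {u v x y z : α} {w w₁ w₂ : List (β × α)}
  {S S' C : Set α} {F F' : Set β} {s s' : ℤˣ} {e f : β}

theorem IsWalk.start_mem (h : G.IsWalk u w v) : u ∈ V(G) := by
  cases w with
  | nil => exact h.1
  | cons p w => exact h.1.left_mem

theorem IsWalk.append (h₁ : G.IsWalk u w₁ v) (h₂ : G.IsWalk v w₂ x) : G.IsWalk u (w₁ ++ w₂) x := by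
  induction w₁ generalizing u with
  | nil => obtain ⟨-, rfl⟩ := h₁; exact h₂
  | cons p w ih => exact ⟨h₁.1, ih h₁.2⟩

theorem IsWalk.end_mem (h : G.IsWalk u w v) : v ∈ u :: w.map Prod.snd := by
  induction w generalizing u with
  | nil => obtain ⟨-, rfl⟩ := h; simp
  | cons p w ih => exact List.mem_cons_of_mem _ (ih h.2)

theorem IsWalk.vertices_subset (h : G.IsWalk u w v) : ∀ z ∈ u :: w.map Prod.snd, z ∈ V(G) := by
  induction w generalizing u with
  | nil => simpa using h.1
  | cons p w ih =>
    intro z hz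
    rcases List.mem_cons.1 hz with rfl | hz
    · exact h.start_mem
    · exact ih h.2 z hz

theorem IsWalk.exists_split (h : G.IsWalk u w v) (hx : x ∈ u :: w.map Prod.snd) :
    ∃ w₁ w₂, w = w₁ ++ w₂ ∧ G.IsWalk u w₁ x ∧ G.IsWalk x w₂ v := by
  induction w generalizing u with
  | nil =>
    have hx : x = u := by simpa using hx
    subst hx
    exact ⟨[], [], rfl, ⟨h.1, rfl⟩, h⟩
  | cons p w ih =>
    rcases List.mem_cons.1 hx with rfl | hx
    · exact ⟨[], p :: w, rfl, ⟨h.start_mem, rfl⟩, h⟩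
    · obtain ⟨w₁, w₂, rfl, h₁, h₂⟩ := ih h.2 hx
      exact ⟨p :: w₁, w₂, rfl, ⟨h.1, h₁⟩, h₂⟩

theorem IsWalk.exists_isLink (h : G.IsWalk u w v) (hw : (u :: w.map Prod.snd).Nodup)
    (hf : f ∈ w.map Prod.fst) : ∃ a b, G.IsLink f a b ∧ a ≠ b ∧ a ∈ u :: w.map Prod.snd ∧
      b ∈ w.map Prod.snd := by
  induction w generalizing u with
  | nil => simp at hf
  | cons p w ih =>
    simp only [List.map_cons] at hf hw ⊢
    rcases List.mem_cons.1 hf with rfl | hf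
    · exact ⟨u, p.2, h.1, by rintro rfl; simp at hw, by simp, by simp⟩
    · obtain ⟨a, b, h₁, h₂, h₃, h₄⟩ := ih h.2 (List.nodup_cons.1 hw).2 hf
      exact ⟨a, b, h₁, h₂, List.mem_cons_of_mem _ h₃, List.mem_cons_of_mem _ h₄⟩

theorem IsWalk.nodup_edges (h : G.IsWalk u w v) (hw : (u :: w.map Prod.snd).Nodup) :
    (w.map Prod.fst).Nodup := by
  induction w generalizing u with
  | nil => simp
  | cons p w ih =>
    simp only [List.map_cons] at hw ⊢
    obtain ⟨hu, hw'⟩ := List.nodup_cons.1 hw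
    refine List.nodup_cons.2 ⟨fun hp => ?_, ih h.2 hw'⟩
    obtain ⟨a, b, h₁, -, h₃, h₄⟩ := h.2.exists_isLink hw' hp
    rcases h.1.left_eq_or_eq h₁ with rfl | rfl
    · exact hu h₃
    · exact hu (List.mem_cons_of_mem _ h₄)

theorem IsWalk.exists_reverse (h : G.IsWalk u w v) : ∃ w', G.IsWalk v w' u ∧
    v :: w'.map Prod.snd = (u :: w.map Prod.snd).reverse ∧
    w'.map Prod.fst = (w.map Prod.fst).reverse := by
  induction w generalizing u with
  | nil => obtain ⟨hu, rfl⟩ := h; exact ⟨[], ⟨hu, rfl⟩, by simp, by simp⟩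
  | cons p w ih =>
    obtain ⟨w', h₁, h₂, h₃⟩ := ih h.2
    refine ⟨w' ++ [(p.1, u)], h₁.append ⟨h.1.symm, h.start_mem, rfl⟩, ?_, ?_⟩
    · rw [List.map_cons, List.reverse_cons, ← h₂]; simp
    · rw [List.map_cons, List.reverse_cons, ← h₃]; simp

theorem walkSign_eq (w : List (β × α)) : walkSign σ w = ((w.map Prod.fst).map σ).prod := by
  simp [walkSign, Function.comp_def]

theorem walkSign_append : walkSign σ (w₁ ++ w₂) = walkSign σ w₁ * walkSign σ w₂ := by
  simp [walkSign]

/-- There is a path of `G` from `u` to `v` with vertex set `S`, edge set `F` and sign `s`. -/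
def PathOn (G : Graph α β) (σ : β → ℤˣ) (u v : α) (S : Set α) (F : Set β) (s : ℤˣ) : Prop :=
  ∃ w, G.IsWalk u w v ∧ (u :: w.map Prod.snd).Nodup ∧ S = {x | x ∈ u :: w.map Prod.snd} ∧
    F = {f | f ∈ w.map Prod.fst} ∧ walkSign σ w = s

/-- There is a cycle of `G` with vertex set `C`, edge set `F` and sign `s`. -/
def CycleOn (G : Graph α β) (σ : β → ℤˣ) (C : Set α) (F : Set β) (s : ℤˣ) : Prop :=
  ∃ u w, G.IsCycle u w ∧ C = {x | x ∈ w.map Prod.snd} ∧ F = {f | f ∈ w.map Prod.fst} ∧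
    walkSign σ w = s

theorem PathOn.left_mem (h : G.PathOn σ u v S F s) : u ∈ S := by
  obtain ⟨w, -, -, rfl, -⟩ := h; simp

theorem PathOn.right_mem (h : G.PathOn σ u v S F s) : v ∈ S := by
  obtain ⟨w, h, -, rfl, -⟩ := h; exact h.end_mem

theorem PathOn.subset (h : G.PathOn σ u v S F s) : S ⊆ V(G) := by
  obtain ⟨w, h, -, rfl, -⟩ := h; exact h.vertices_subset

theorem PathOn.refl (hu : u ∈ V(G)) : G.PathOn σ u u {u} ∅ 1 :=
  ⟨[], ⟨hu, rfl⟩, by simp, by ext; simp, by simp, rfl⟩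

theorem IsLink.pathOn (h : G.IsLink e u v) (hne : u ≠ v) : G.PathOn σ u v {u, v} {e} (σ e) :=
  ⟨[(e, v)], ⟨h, h.right_mem, rfl⟩, by simpa using hne, by ext; simp, by ext; simp,
    by simp [walkSign]⟩

theorem PathOn.exists_isLink (h : G.PathOn σ u v S F s) (hf : f ∈ F) :
    ∃ a b, G.IsLink f a b ∧ a ≠ b ∧ a ∈ S ∧ b ∈ S := by
  obtain ⟨w, h, hw, rfl, rfl, -⟩ := h
  obtain ⟨a, b, h₁, h₂, h₃, h₄⟩ := h.exists_isLink hw hf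
  exact ⟨a, b, h₁, h₂, h₃, List.mem_cons_of_mem _ h₄⟩

theorem PathOn.mem_of_isLink (h : G.PathOn σ u v S F s) (hf : f ∈ F) (hl : G.IsLink f x y) :
    x ∈ S ∧ y ∈ S := by
  obtain ⟨a, b, h₁, -, h₃, h₄⟩ := h.exists_isLink hf
  rcases hl.eq_and_eq_or_eq_and_eq h₁ with ⟨rfl, rfl⟩ | ⟨rfl, rfl⟩ <;> exact ⟨‹_›, ‹_›⟩

theorem PathOn.trans {s₁ s₂ : ℤˣ} {S₁ S₂ : Set α} {F₁ F₂ : Set β} (h₁ : G.PathOn σ u v S₁ F₁ s₁)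
    (h₂ : G.PathOn σ v x S₂ F₂ s₂) (hS : ∀ z ∈ S₁, z ∈ S₂ → z = v) :
    G.PathOn σ u x (S₁ ∪ S₂) (F₁ ∪ F₂) (s₁ * s₂) := by
  obtain ⟨w₁, h₁, hw₁, rfl, rfl, rfl⟩ := h₁
  obtain ⟨w₂, h₂, hw₂, rfl, rfl, rfl⟩ := h₂
  refine ⟨w₁ ++ w₂, h₁.append h₂, ?_, ?_, ?_, walkSign_append⟩
  · rw [List.map_append, ← List.cons_append, List.nodup_append]
    refine ⟨hw₁, (List.nodup_cons.1 hw₂).2, fun a ha b hb hab => ?_⟩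
    subst hab
    have := hS a ha (List.mem_cons_of_mem _ hb)
    exact (List.nodup_cons.1 hw₂).1 (this ▸ hb)
  · ext z
    have : z = v → z = u ∨ z ∈ w₁.map Prod.snd := fun hz => by
      subst hz; simpa using h₁.end_mem
    simp only [Set.mem_union, Set.mem_ofPred_eq, List.mem_cons, List.map_append, List.mem_append]
    tauto
  · ext z
    simp

theorem PathOn.symm (h : G.PathOn σ u v S F s) : G.PathOn σ v u S F s := by
  obtain ⟨w, h, hw, rfl, rfl, rfl⟩ := h
  obtain ⟨w', h₁, h₂, h₃⟩ := h.exists_reverse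
  refine ⟨w', h₁, by rw [h₂]; exact List.nodup_reverse.2 hw, by rw [h₂]; ext; simp [or_comm],
    by rw [h₃]; ext; simp, ?_⟩
  rw [walkSign_eq, walkSign_eq, h₃]
  exact ((List.reverse_perm _).map σ).prod_eq

theorem PathOn.exists_split (h : G.PathOn σ u v S F s) (hx : x ∈ S) :
    ∃ S₁ S₂ F₁ F₂ s₁ s₂, G.PathOn σ u x S₁ F₁ s₁ ∧ G.PathOn σ x v S₂ F₂ s₂ ∧ S = S₁ ∪ S₂ ∧
      F = F₁ ∪ F₂ ∧ s = s₁ * s₂ ∧ ∀ z ∈ S₁, z ∈ S₂ → z = x := by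
  obtain ⟨w, h, hw, rfl, rfl, rfl⟩ := h
  obtain ⟨w₁, w₂, rfl, h₁, h₂⟩ := h.exists_split hx
  rw [List.map_append, ← List.cons_append, List.nodup_append] at hw
  obtain ⟨hw₁, hw₂, hd⟩ := hw
  refine ⟨_, _, _, _, _, _, ⟨w₁, h₁, hw₁, rfl, rfl, rfl⟩, ⟨w₂, h₂, List.nodup_cons.2
    ⟨fun hx' => hd x h₁.end_mem x hx' rfl, hw₂⟩, rfl, rfl, rfl⟩, ?_, ?_, walkSign_append, ?_⟩
  · ext z
    have : z = x → z = u ∨ z ∈ w₁.map Prod.snd := fun hz => by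
      subst hz; simpa using h₁.end_mem
    simp only [Set.mem_union, Set.mem_ofPred_eq, List.mem_cons, List.map_append, List.mem_append]
    tauto
  · ext z
    simp
  · intro z hz₁ hz₂
    rcases List.mem_cons.1 hz₂ with rfl | hz₂
    · rfl
    · exact absurd rfl (hd z hz₁ z hz₂)

/-- The first vertex of a path is not repeated, so an edge at it is the first edge; if that edge
also reaches the last vertex, the path stops there. -/
theorem PathOn.eq_singleton (h : G.PathOn σ u v S F s) (hf : f ∈ F) (hl : G.IsLink f u v) :
    F = {f} ∧ S = {u, v} := by
  obtain ⟨w, h, hw, rfl, rfl, rfl⟩ := h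
  rcases w with _ | ⟨p, w⟩
  · simp at hf
  simp only [List.map_cons] at hw hf
  rcases List.mem_cons.1 hf with rfl | hf
  · obtain rfl : v = p.2 := hl.right_unique h.1
    rcases w with _ | ⟨q, w⟩
    · constructor <;> ext <;> simp
    · have := h.2.2.end_mem
      simp only [List.map_cons, List.nodup_cons] at hw
      exact absurd this hw.2.1
  · obtain ⟨a, b, h₁, -, h₃, h₄⟩ := h.2.exists_isLink (List.nodup_cons.1 hw).2 hf
    exfalso
    rcases hl.left_eq_or_eq h₁ with rfl | rfl
    · exact (List.nodup_cons.1 hw).1 h₃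
    · exact (List.nodup_cons.1 hw).1 (List.mem_cons_of_mem _ h₄)

theorem PathOn.edge_mem (h : G.PathOn σ u v S F s) (hne : u ≠ v) : F.Nonempty := by
  obtain ⟨w, h, hw, rfl, rfl, rfl⟩ := h
  rcases w with _ | ⟨p, w⟩
  · exact absurd h.2 hne
  · exact ⟨p.1, by simp⟩

theorem PathOn.exists_isLink_of_subset (h : G.PathOn σ u v S F s) (hne : u ≠ v)
    (hS : S ⊆ {u, v}) : ∃ f, F = {f} ∧ G.IsLink f u v := by
  obtain ⟨f, hf⟩ := h.edge_mem hne
  obtain ⟨a, b, hl, hab, ha, hb⟩ := h.exists_isLink hf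
  have hl' : G.IsLink f u v := by
    rcases hS ha with rfl | rfl <;> rcases hS hb with rfl | rfl
    exacts [absurd rfl hab, hl, hl.symm, absurd rfl hab]
  exact ⟨f, (h.eq_singleton hf hl').1, hl'⟩

/-- Two paths that meet only in their ends can share an edge only if both consist of that edge. The
last hypothesis excludes just this case, and cycles made of two parallel edges remain allowed. -/
theorem CycleOn.of_paths {S₁ S₂ : Set α} {F₁ F₂ : Set β} {s₁ s₂ : ℤˣ}
    (h₁ : G.PathOn σ u v S₁ F₁ s₁) (h₂ : G.PathOn σ v u S₂ F₂ s₂) (hne : u ≠ v)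
    (hS : ∀ z ∈ S₁, z ∈ S₂ → z = u ∨ z = v) (hF : ¬ ∃ f, F₁ = {f} ∧ F₂ = {f}) :
    G.CycleOn σ (S₁ ∪ S₂) (F₁ ∪ F₂) (s₁ * s₂) := by
  have hF' : ∀ f ∈ F₁, f ∉ F₂ := by
    intro f hf₁ hf₂
    obtain ⟨a, b, hl, hab, ha, hb⟩ := h₁.exists_isLink hf₁
    obtain ⟨ha', hb'⟩ := h₂.mem_of_isLink hf₂ hl
    have hl' : G.IsLink f u v := by
      rcases hS a ha ha' with rfl | rfl <;> rcases hS b hb hb' with rfl | rfl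
      exacts [absurd rfl hab, hl, hl.symm, absurd rfl hab]
    exact hF ⟨f, (h₁.eq_singleton hf₁ hl').1, (h₂.eq_singleton hf₂ hl'.symm).1⟩
  obtain ⟨w₁, h₁, hw₁, rfl, rfl, rfl⟩ := h₁
  obtain ⟨w₂, h₂, hw₂, rfl, rfl, rfl⟩ := h₂
  refine ⟨u, w₁ ++ w₂, ⟨h₁.append h₂, ?_, ?_, ?_⟩, ?_, ?_, walkSign_append⟩
  · intro h
    obtain ⟨rfl, rfl⟩ := List.append_eq_nil_iff.1 h
    exact hne h₁.2
  · rw [List.map_append, List.nodup_append]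
    refine ⟨(List.nodup_cons.1 hw₁).2, (List.nodup_cons.1 hw₂).2, fun a ha b hb hab => ?_⟩
    subst hab
    rcases hS a (List.mem_cons_of_mem _ ha) (List.mem_cons_of_mem _ hb) with rfl | rfl
    · exact (List.nodup_cons.1 hw₁).1 ha
    · exact (List.nodup_cons.1 hw₂).1 hb
  · rw [List.map_append, List.nodup_append]
    refine ⟨h₁.nodup_edges hw₁, h₂.nodup_edges hw₂, fun a ha b hb hab => ?_⟩
    subst hab
    exact hF' a ha hb
  · have hv : v ∈ w₁.map Prod.snd := (List.mem_cons.1 h₁.end_mem).resolve_left hne.symm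
    have hu : u ∈ w₂.map Prod.snd := (List.mem_cons.1 h₂.end_mem).resolve_left hne
    ext z
    have h3 : z = v → z ∈ w₁.map Prod.snd := fun hz => hz ▸ hv
    have h4 : z = u → z ∈ w₂.map Prod.snd := fun hz => hz ▸ hu
    simp only [Set.mem_union, Set.mem_ofPred_eq, List.mem_cons, List.map_append, List.mem_append]
    tauto
  · ext z
    simp

theorem IsCycle.exists_rotate (h : G.IsCycle u w) (hx : x ∈ w.map Prod.snd) :
    ∃ w', G.IsCycle x w' ∧ w.Perm w' := by
  obtain ⟨w₁, w₂, rfl, h₁, h₂⟩ := h.isWalk.exists_split (List.mem_cons_of_mem _ hx)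
  have hp : (w₁ ++ w₂).Perm (w₂ ++ w₁) := List.perm_append_comm
  exact ⟨w₂ ++ w₁, ⟨h₂.append h₁, fun h0 => h.ne_nil (by simp_all),
    (hp.map _).nodup_iff.1 h.nodup_vertices, (hp.map _).nodup_iff.1 h.nodup_edges⟩, hp⟩

theorem CycleOn.exists_paths (h : G.CycleOn σ C F s) (hx : x ∈ C) (hy : y ∈ C) (hxy : x ≠ y) :
    ∃ S₁ S₂ F₁ F₂ s₁ s₂, G.PathOn σ x y S₁ F₁ s₁ ∧ G.PathOn σ y x S₂ F₂ s₂ ∧ C = S₁ ∪ S₂ ∧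
      F = F₁ ∪ F₂ ∧ s = s₁ * s₂ ∧ (∀ z ∈ S₁, z ∈ S₂ → z = x ∨ z = y) ∧ ∀ f ∈ F₁, f ∉ F₂ := by
  obtain ⟨u, w, h, rfl, rfl, rfl⟩ := h
  obtain ⟨w', h', hp⟩ := h.exists_rotate hx
  have hy' : y ∈ w'.map Prod.snd := (hp.map _).mem_iff.1 hy
  obtain ⟨w₁, w₂, rfl, h₁, h₂⟩ := h'.isWalk.exists_split (List.mem_cons_of_mem _ hy')
  have hv := h'.nodup_vertices
  have he := h'.nodup_edges
  rw [List.map_append, List.nodup_append] at hv he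
  obtain ⟨hv₁, hv₂, hv⟩ := hv
  have hyw : y ∈ w₁.map Prod.snd := (List.mem_cons.1 h₁.end_mem).resolve_left hxy.symm
  have hxw : x ∈ w₂.map Prod.snd := (List.mem_cons.1 h₂.end_mem).resolve_left hxy
  refine ⟨_, _, _, _, _, _, ⟨w₁, h₁, List.nodup_cons.2 ⟨fun h => hv x h x hxw rfl, hv₁⟩, rfl, rfl,
    rfl⟩, ⟨w₂, h₂, List.nodup_cons.2 ⟨fun h => hv y hyw y h rfl, hv₂⟩, rfl, rfl, rfl⟩,
    ?_, ?_, ?_, ?_, fun f hf₁ hf₂ => he.2.2 f hf₁ f hf₂ rfl⟩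
  · ext z
    have h3 : z = y → z ∈ w₁.map Prod.snd := fun hz => hz ▸ hyw
    have h4 : z = x → z ∈ w₂.map Prod.snd := fun hz => hz ▸ hxw
    have h5 := (hp.map Prod.snd).mem_iff (a := z)
    rw [List.map_append, List.mem_append] at h5
    simp only [Set.mem_union, Set.mem_ofPred_eq, List.mem_cons]
    tauto
  · ext z
    have h5 := (hp.map Prod.fst).mem_iff (a := z)
    rw [List.map_append, List.mem_append] at h5
    exact h5
  · rw [← walkSign_append, walkSign_eq, walkSign_eq]
    exact ((hp.map _).map σ).prod_eq
  · intro z hz₁ hz₂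
    rcases List.mem_cons.1 hz₁ with rfl | hz₁
    · exact Or.inl rfl
    rcases List.mem_cons.1 hz₂ with rfl | hz₂
    · exact Or.inr rfl
    exact absurd rfl (hv z hz₁ z hz₂)

theorem CycleOn.subset (h : G.CycleOn σ C F s) : C ⊆ V(G) := by
  obtain ⟨u, w, h, rfl, -⟩ := h
  exact fun z hz => h.isWalk.vertices_subset z (List.mem_cons_of_mem _ hz)

theorem CycleOn.nonempty (h : G.CycleOn σ C F s) : C.Nonempty := by
  obtain ⟨u, w, h, rfl, -⟩ := h
  rcases w with _ | ⟨p, w⟩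
  · exact absurd rfl h.ne_nil
  · exact ⟨p.2, by simp⟩

theorem CycleOn.hasCycleThrough {e₁ e₂ : β} (h : G.CycleOn σ C F s) (h₁ : e₁ ∈ F) (h₂ : e₂ ∈ F) :
    G.HasCycleThrough σ e₁ e₂ s := by
  obtain ⟨u, w, h, rfl, rfl, rfl⟩ := h
  exact ⟨u, w, h, h₁, h₂, rfl⟩

/-- A walk of a relation that is contained in adjacency becomes a path of the graph. -/
theorem exists_pathOn_of_relWalk {r : α → α → Prop} {P : β → Prop} {l : List α}
    (hr : ∀ x y, r x y → ∃ f, G.IsLink f x y ∧ P f) (hu : u ∈ V(G)) (h : RelWalk r u l v)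
    (hl : (u :: l).Nodup) :
    ∃ F s, G.PathOn σ u v {x | x ∈ u :: l} F s ∧ ∀ f ∈ F, P f := by
  have : ∃ w : List (β × α), G.IsWalk u w v ∧ w.map Prod.snd = l ∧ ∀ f ∈ w.map Prod.fst, P f := by
    clear hl
    induction l generalizing u with
    | nil => cases h; exact ⟨[], ⟨hu, rfl⟩, rfl, by simp⟩
    | cons y l ih =>
      obtain ⟨f, hf, hP⟩ := hr _ _ h.1
      obtain ⟨w, h₁, h₂, h₃⟩ := ih hf.right_mem h.2
      refine ⟨(f, y) :: w, ⟨hf, h₁⟩, by simp [h₂], fun g hg => ?_⟩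
      rcases List.mem_cons.1 hg with rfl | hg
      · exact hP
      · exact h₃ g hg
  obtain ⟨w, h₁, rfl, h₃⟩ := this
  exact ⟨_, _, ⟨w, h₁, hl, rfl, rfl, rfl⟩, h₃⟩

end Graph

namespace Graph

variable {α β : Type*} {G : Graph α β} {σ : β → ℤˣ} {u v x y z : α}
  {S S' C : Set α} {F F' : Set β} {s s' : ℤˣ} {e f e₁ e₂ : β}

/-! ### Connectivity -/

/-- No set `S` of vertices is separated from the rest of the graph by two vertices. -/
def IsTriSep (G : Graph α β) : Prop :=
  ∀ S ⊆ V(G), ∀ a b, S.Nonempty → a ∉ S → b ∉ S → (∃ y ∈ V(G), y ∉ S ∧ y ≠ a ∧ y ≠ b) →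
    ∃ x ∈ S, ∃ y, y ∉ S ∧ y ≠ a ∧ y ≠ b ∧ G.Adj x y

theorem IsWalk.exists_adj_of_mem_of_notMem {w : List (β × α)} (h : G.IsWalk u w v) (hu : u ∈ S)
    (hv : v ∉ S) : ∃ x ∈ S, ∃ y, y ∉ S ∧ G.Adj x y := by
  induction w generalizing u with
  | nil => exact absurd (h.2 ▸ hu) hv
  | cons p w ih =>
    by_cases hp : p.2 ∈ S
    · exact ih h.2 hp
    · exact ⟨u, hu, p.2, hp, _, h.1⟩

/-- A walk avoiding `a` and `b` from `S` to a vertex outside must leave `S`. The deleted set is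
intersected with `V(G)` because `a` and `b` need not be vertices; they may also coincide. -/
theorem IsKConnected.isTriSep (h : G.IsKConnected 3) : G.IsTriSep := by
  rintro S hSV a b ⟨x, hx⟩ ha hb ⟨y, hyV, hyS, hya, hyb⟩
  have hcard : (({a, b} : Set α) ∩ V(G)).encard < (3 : ℕ) := by
    refine (Set.encard_le_encard Set.inter_subset_left).trans_lt ?_
    refine (Set.encard_insert_le _ _).trans_lt ?_
    rw [Set.encard_singleton]
    norm_num
  obtain ⟨-, hw⟩ := h.2 _ Set.inter_subset_right hcard
  have hxab : x ≠ a ∧ x ≠ b := ⟨fun h => ha (h ▸ hx), fun h => hb (h ▸ hx)⟩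
  obtain ⟨w, hw⟩ := hw x (by simp [hSV hx, hxab]) y (by simp [hyV, hya, hyb])
  obtain ⟨x', hx', y', hy', f, hf⟩ := hw.exists_adj_of_mem_of_notMem hx hyS
  have hy'' := hf.right_mem
  simp only [vertexSet_deleteVerts, Set.mem_sdiff, Set.mem_inter_iff, Set.mem_insert_iff,
    Set.mem_singleton_iff, not_and_or, not_or] at hy''
  have hy3 : y' ≠ a ∧ y' ≠ b := by tauto
  exact ⟨x', hx', y', hy', hy3.1, hy3.2, f, (deleteVerts_le).isLink_mono hf⟩

/-- The relation of adjacency inside a set `M` of vertices. -/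
theorem finite_adj_rel (hV : V(G).Finite) (M : Set α) :
    {p : α × α | G.Adj p.1 p.2 ∧ p.1 ∈ M ∧ p.2 ∈ M}.Finite :=
  (hV.prod hV).subset fun _ hp => ⟨hp.1.left_mem, hp.1.right_mem⟩

theorem exists_pathOn_of_relPath {M A B : Set α} {l : List α} (hM : M ⊆ V(G)) (hA : A ⊆ M)
    (h : RelPath (fun x y => G.Adj x y ∧ x ∈ M ∧ y ∈ M) A B u l v) :
    ∃ F s, G.PathOn σ u v {x | x ∈ u :: l} F s ∧ {x | x ∈ u :: l} ⊆ M := by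
  obtain ⟨F, s, hP, -⟩ := exists_pathOn_of_relWalk (G := G) (σ := σ) (P := fun _ => True)
    (fun x y hxy => ⟨_, hxy.1.choose_spec, trivial⟩) (hM (hA h.start_mem)) h.walk h.nodup
  refine ⟨F, s, hP, fun x hx => ?_⟩
  obtain ⟨l₁, l₂, -, hw, -⟩ := h.walk.exists_split hx
  exact hw.mem_of_closed (hA h.start_mem) fun _ _ _ _ hst => hst.2.2

/-- Menger's theorem inside a set `M` of vertices. -/
theorem exists_disjoint_pathsOn (hV : V(G).Finite) {M A B : Set α} (hM : M ⊆ V(G)) (hA : A ⊆ M)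
    (k : ℕ) (h : ∀ X : Finset α, X.card < k → ∀ U ⊆ M, (∀ x ∈ U, x ∉ X) →
      (∀ a ∈ A, a ∉ X → a ∈ U) → (∀ x ∈ U, ∀ y ∈ M, y ∉ X → G.Adj x y → y ∈ U) →
      ∃ b ∈ B, b ∈ U) :
    ∃ (a b : Fin k → α) (P : Fin k → Set α) (F : Fin k → Set β) (s : Fin k → ℤˣ),
      (∀ i, G.PathOn σ (a i) (b i) (P i) (F i) (s i)) ∧ (∀ i, a i ∈ A) ∧ (∀ i, b i ∈ B) ∧
      (∀ i, P i ⊆ M) ∧ (∀ i, ∀ x ∈ P i, x ∈ A → x = a i) ∧ (∀ i, ∀ x ∈ P i, x ∈ B → x = b i) ∧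
      ∀ i j x, x ∈ P i → x ∈ P j → i = j := by
  obtain ⟨a, b, l, h₁, h₂⟩ := exists_disjoint_relPaths (A := A) (B := B)
    (r := fun x y => G.Adj x y ∧ x ∈ M ∧ y ∈ M) (finite_adj_rel hV M) k (by
    intro X hX U hAU hU
    obtain ⟨c, hc, ⟨⟨hcU, hcX⟩, -⟩⟩ := h X hX ((U \ X) ∩ M) (fun _ hx => hx.2)
      (fun x hx => hx.1.2) (fun a ha haX => ⟨⟨hAU a ha haX, haX⟩, hA ha⟩)
      (fun x hx y hy hyX hxy => ⟨⟨hU x hx.1.1 hx.1.2 y hyX ⟨hxy, hx.2, hy⟩, hyX⟩, hy⟩)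
    exact ⟨c, hc, hcX, hcU⟩)
  have := fun i => exists_pathOn_of_relPath (σ := σ) hM hA (h₁ i)
  choose F s h₃ h₄ using this
  exact ⟨a, b, _, F, s, h₃, fun i => (h₁ i).start_mem, fun i => (h₁ i).end_mem, h₄,
    fun i => (h₁ i).eq_start, fun i => (h₁ i).eq_end, h₂⟩

theorem exists_pathOn (hV : V(G).Finite) {M A B : Set α} (hM : M ⊆ V(G)) (hA : A ⊆ M)
    (h : ∀ U ⊆ M, A ⊆ U → (∀ x ∈ U, ∀ y ∈ M, G.Adj x y → y ∈ U) → ∃ b ∈ B, b ∈ U) :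
    ∃ a ∈ A, ∃ b ∈ B, ∃ P F s, G.PathOn σ a b P F s ∧ P ⊆ M ∧ (∀ x ∈ P, x ∈ A → x = a) ∧
      ∀ x ∈ P, x ∈ B → x = b := by
  obtain ⟨a, b, P, F, s, h₁, h₂, h₃, h₄, h₅, h₆, -⟩ := exists_disjoint_pathsOn (σ := σ) hV hM hA
    (B := B) 1 (by
      rintro X hX U hUM - hAU hU
      obtain rfl : X = ∅ := by simpa using hX
      exact h U hUM (fun a ha => hAU a ha (by simp)) fun x hx y hy => hU x hx y hy (by simp))
  exact ⟨a 0, h₂ 0, b 0, h₃ 0, _, _, _, h₁ 0, h₄ 0, h₅ 0, h₆ 0⟩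

/-! ### Untied edges -/

/-- Cycles are constructed in pairs: shared paths cancel in the product of their signs, and what
remains is the sign of a negative cycle. -/
theorem untied_of_signs {t₁ t₂ : ℤˣ} (h₁ : G.HasCycleThrough σ e₁ e₂ t₁)
    (h₂ : G.HasCycleThrough σ e₁ e₂ t₂) (h : t₁ * t₂ = -1) : G.Untied σ e₁ e₂ := by
  rcases Int.units_eq_one_or t₁ with rfl | rfl <;> rcases Int.units_eq_one_or t₂ with rfl | rfl
  · exact absurd h (by decide)
  · exact ⟨h₁, h₂⟩
  · exact ⟨h₂, h₁⟩
  · exact absurd h (by decide)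

theorem Untied.symm (h : G.Untied σ e₁ e₂) : G.Untied σ e₂ e₁ := by
  obtain ⟨⟨u, w, h₁, h₂, h₃, h₄⟩, ⟨u', w', h₁', h₂', h₃', h₄'⟩⟩ := h
  exact ⟨⟨u, w, h₁, h₃, h₂, h₄⟩, ⟨u', w', h₁', h₃', h₂', h₄'⟩⟩

theorem not_singleton_of_mem (hne : e₁ ≠ e₂) (h₁ : e₁ ∈ F) (h₂ : e₂ ∈ F) :
    ¬ ∃ f, F = {f} ∧ F' = {f} := by
  rintro ⟨f, rfl, -⟩
  exact hne (h₁.trans h₂.symm)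

/-- A path through both edges that joins two vertices of a negative cycle. -/
theorem CycleOn.untied_of_pathOn {c₁ c₂ : α} {FC : Set β} (hC : G.CycleOn σ C FC (-1))
    (hP : G.PathOn σ c₁ c₂ S F s) (h₁ : c₁ ∈ C) (h₂ : c₂ ∈ C) (hne : c₁ ≠ c₂)
    (hS : ∀ z ∈ S, z ∈ C → z = c₁ ∨ z = c₂) (he : e₁ ≠ e₂) (he₁ : e₁ ∈ F) (he₂ : e₂ ∈ F) :
    G.Untied σ e₁ e₂ := by
  obtain ⟨S₁, S₂, F₁, F₂, s₁, s₂, hA, hB, rfl, rfl, hs, -⟩ := hC.exists_paths h₁ h₂ hne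
  have hA' := CycleOn.of_paths hP hA.symm hne (fun z hz hz' => hS z hz (Or.inl hz'))
    (not_singleton_of_mem he he₁ he₂)
  have hB' := CycleOn.of_paths hP hB hne (fun z hz hz' => hS z hz (Or.inr hz'))
    (not_singleton_of_mem he he₁ he₂)
  refine untied_of_signs (hA'.hasCycleThrough (Or.inl he₁) (Or.inl he₂))
    (hB'.hasCycleThrough (Or.inl he₁) (Or.inl he₂)) ?_
  rw [mul_mul_mul_comm, ← hs, Int.units_mul_self, one_mul]

/-- Two crossing chords of a negative cycle, one through each of the two edges. -/
theorem untied_of_crossing {p q n₁ n₂ : α} {S₁ S₂ T₁ T₂ : Set α} {F₁ F₂ E₁ E₂ : Set β}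
    {s₁ s₂ r₁ r₂ : ℤˣ} (hA₁ : G.PathOn σ p q S₁ F₁ s₁) (hA₂ : G.PathOn σ q p S₂ F₂ s₂)
    (hs : s₁ * s₂ = -1) (hS : ∀ z ∈ S₁, z ∈ S₂ → z = p ∨ z = q)
    (hR₂ : G.PathOn σ p q T₂ E₂ r₂) (hT₂ : ∀ z ∈ T₂, z ∈ S₁ ∨ z ∈ S₂ → z = p ∨ z = q)
    (hn₁ : n₁ ∈ S₁) (hn₁' : n₁ ≠ p ∧ n₁ ≠ q) (hn₂ : n₂ ∈ S₂) (hn₂' : n₂ ≠ p ∧ n₂ ≠ q)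
    (hR₁ : G.PathOn σ n₁ n₂ T₁ E₁ r₁) (hT₁ : ∀ z ∈ T₁, z ∈ S₁ ∨ z ∈ S₂ → z = n₁ ∨ z = n₂)
    (hT : ∀ z ∈ T₁, z ∉ T₂) (he : e₁ ≠ e₂) (he₁ : e₁ ∈ E₁) (he₂ : e₂ ∈ E₂) :
    G.Untied σ e₁ e₂ := by
  obtain ⟨A, B, FA, FB, a, b, hA, hB, rfl, rfl, rfl, hAB⟩ := hA₁.exists_split hn₁
  obtain ⟨A', B', FA', FB', a', b', hA', hB', rfl, rfl, rfl, hAB'⟩ := hA₂.exists_split hn₂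
  have h1 := hA.left_mem
  have h2 := hA.right_mem
  have h3 := hB.left_mem
  have h4 := hB.right_mem
  have h5 := hA'.left_mem
  have h6 := hA'.right_mem
  have h7 := hB'.left_mem
  have h8 := hB'.right_mem
  simp only [Set.mem_union] at *
  -- The first cycle is `R₁`, `B'`, `R₂`, `B`; the second is `R₁`, `A'`, `R₂`, `A`, with the pieces
  -- suitably oriented. Both chords occur twice, and each quarter of the negative cycle occurs once.
  have X₁ := hR₁.trans hB' (by grind)
  have X₂ := X₁.trans hR₂ (by grind)
  have X := CycleOn.of_paths X₂ hB.symm (by grind) (by grind)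
    (not_singleton_of_mem he (by simp [he₁]) (by simp [he₂]))
  have Y₁ := hR₁.trans hA'.symm (by grind)
  have Y₂ := Y₁.trans hR₂.symm (by grind)
  have Y := CycleOn.of_paths Y₂ hA (by grind) (by grind)
    (not_singleton_of_mem he (by simp [he₁]) (by simp [he₂]))
  refine untied_of_signs (X.hasCycleThrough (by simp [he₁]) (by simp [he₂]))
    (Y.hasCycleThrough (by simp [he₁]) (by simp [he₂])) ?_
  have e1 := Int.units_mul_self r₁
  have e2 := Int.units_mul_self r₂
  calc r₁ * b' * r₂ * b * (r₁ * a' * r₂ * a) = (r₁ * r₁) * (r₂ * r₂) * (a * b * (a' * b')) := by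
        ac_rfl
    _ = -1 := by rw [e1, e2, hs]; rfl

end Graph

namespace Graph

variable {α β : Type*} {G : Graph α β} {σ : β → ℤˣ} {u v x y z : α}
  {S S' C : Set α} {F F' : Set β} {s s' : ℤˣ} {e f e₁ e₂ : β}

/-! ### Paths through an edge -/

/-- Lift a walk in the graph in which `Z` is contracted to `z₀`. -/
theorem exists_pathOn_of_contraction {r : α → α → Prop} {Z : Set α} {z₀ : α} {l : List α}
    (hr : ∀ x y, r x y → x ∈ S ∧ (y ∈ S ∧ G.Adj x y ∨ (y = z₀ ∧ ∃ z ∈ Z, G.Adj x z) ∨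
      y ∉ S ∧ y ≠ z₀)) (hSZ : ∀ x ∈ S, x ∉ Z) (hz₀ : z₀ ∈ Z) (h : RelWalk r u l z₀)
    (hl : (u :: l).Nodup) (hu : u ∈ S) :
    ∃ z ∈ Z, ∃ P F s, G.PathOn σ u z P F s ∧ ∀ x ∈ P, x ≠ z → x ∈ S ∧ x ∈ u :: l := by
  induction l generalizing u with
  | nil => cases h; exact absurd hz₀ (hSZ _ hu)
  | cons y l ih =>
    rcases (hr _ _ h.1).2 with ⟨hy, e, he⟩ | ⟨rfl, z, hz, e, he⟩ | ⟨hy, hyz⟩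
    · obtain ⟨z, hz, P, F, s, hP, hPS⟩ := ih h.2 (List.nodup_cons.1 hl).2 hy
      have huy : u ≠ y := by rintro rfl; simp at hl
      have huP : u ∉ P := fun huP => (List.nodup_cons.1 hl).1
        (hPS u huP fun h => hSZ u hu (h ▸ hz)).2
      refine ⟨z, hz, _, _, _, (he.pathOn huy).trans hP ?_, ?_⟩
      · rintro x (rfl | rfl) hx
        · exact absurd hx huP
        · rfl
      · rintro x ((rfl | rfl) | hx) hxz
        · exact ⟨hu, by simp⟩
        · exact ⟨hy, by simp⟩
        · exact ⟨(hPS x hx hxz).1, List.mem_cons_of_mem _ (hPS x hx hxz).2⟩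
    · have huz : u ≠ z := fun h => hSZ u hu (h ▸ hz)
      refine ⟨z, hz, _, _, _, he.pathOn huz, ?_⟩
      rintro x (rfl | rfl) hxz
      · exact ⟨hu, by simp⟩
      · exact absurd rfl hxz
    · rcases l with _ | ⟨y', l⟩
      · exact absurd h.2 hyz
      · exact absurd (hr _ _ h.2.1).1 hy

/-- A path from `Z` to `T` through the edge `e = ab` whose other vertices are in `S`, if no vertex
of `S`, nor `Z`, nor `T`, separates the ends of `e` from `Z ∪ T`. -/
theorem exists_pathOn_through (hV : V(G).Finite) {Z T : Set α} {a b : α} (he : G.IsLink e a b)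
    (hab : a ≠ b) (ha : a ∈ S ∨ a ∈ Z ∨ a ∈ T) (hb : b ∈ S ∨ b ∈ Z ∨ b ∈ T)
    (hSZ : ∀ x ∈ S, x ∉ Z) (hST : ∀ x ∈ S, x ∉ T) (hZT : ∀ x ∈ Z, x ∉ T)
    (h₁ : a ∈ S → b ∈ S → ∀ w ∈ S, ∀ U ⊆ S, w ∉ U → (a ≠ w → a ∈ U) → (b ≠ w → b ∈ U) →
      (∀ x ∈ U, ∀ y ∈ S, y ≠ w → G.Adj x y → y ∈ U) → ∃ x ∈ U, ∃ y, (y ∈ Z ∨ y ∈ T) ∧ G.Adj x y)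
    (h₂ : ∀ U ⊆ S, (a ∈ S → a ∈ U) → (b ∈ S → b ∈ U) → a ∉ T → b ∉ T →
      (∀ x ∈ U, ∀ y ∈ S, G.Adj x y → y ∈ U) → ∃ x ∈ U, ∃ y ∈ T, G.Adj x y)
    (h₃ : ∀ U ⊆ S, (a ∈ S → a ∈ U) → (b ∈ S → b ∈ U) → a ∉ Z → b ∉ Z →
      (∀ x ∈ U, ∀ y ∈ S, G.Adj x y → y ∈ U) → ∃ x ∈ U, ∃ y ∈ Z, G.Adj x y) :
    ∃ z ∈ Z, ∃ t ∈ T, ∃ P F s, G.PathOn σ z t P F s ∧ e ∈ F ∧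
      ∀ x ∈ P, x ≠ z → x ≠ t → x ∈ S := by
  classical
  obtain ⟨z₀, hz₀⟩ : Z.Nonempty := by
    by_cases h : a ∈ Z ∨ b ∈ Z
    · rcases h with h | h <;> exact ⟨_, h⟩
    · push Not at h
      obtain ⟨x, -, y, hy, -⟩ := h₃ S subset_rfl id id h.1 h.2 fun _ _ y hy _ => hy
      exact ⟨y, hy⟩
  obtain ⟨t₀, ht₀⟩ : T.Nonempty := by
    by_cases h : a ∈ T ∨ b ∈ T
    · rcases h with h | h <;> exact ⟨_, h⟩
    · push Not at h
      obtain ⟨x, -, y, hy, -⟩ := h₂ S subset_rfl id id h.1 h.2 fun _ _ y hy _ => hy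
      exact ⟨y, hy⟩
  have hzt : z₀ ≠ t₀ := fun h => hZT z₀ hz₀ (h ▸ ht₀)
  -- `Z` and `T` are contracted to `z₀` and `t₀`. Steps start only in `S`, so these two vertices are
  -- sinks.
  let r : α → α → Prop := fun x y => x ∈ S ∧ (y ∈ S ∧ G.Adj x y ∨ (y = z₀ ∧ ∃ z ∈ Z, G.Adj x z) ∨
    (y = t₀ ∧ ∃ t ∈ T, G.Adj x t))
  have hrfin : {p : α × α | r p.1 p.2}.Finite := by
    refine (hV.prod ((hV.insert z₀).insert t₀)).subset ?_
    rintro ⟨x, y⟩ ⟨-, ⟨-, h⟩ | ⟨hy, z, -, h⟩ | ⟨hy, z, -, h⟩⟩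
    · exact ⟨h.left_mem, Or.inr (Or.inr h.right_mem)⟩
    · exact ⟨h.left_mem, Or.inr (Or.inl hy)⟩
    · exact ⟨h.left_mem, Or.inl hy⟩
  let φ : α → α := fun x => if x ∈ Z then z₀ else if x ∈ T then t₀ else x
  have hφZ : ∀ x ∈ Z, φ x = z₀ := fun x hx => by simp [φ, hx]
  have hφT : ∀ x ∈ T, φ x = t₀ := fun x hx => by
    simp [φ, hx, show x ∉ Z from fun h => hZT x h hx]
  have hφS : ∀ x ∈ S, φ x = x := fun x hx => by simp [φ, hSZ x hx, hST x hx]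
  have hz₀S : z₀ ∉ S := fun h => hSZ _ h hz₀
  have ht₀S : t₀ ∉ S := fun h => hST _ h ht₀
  -- Two disjoint paths are sought from the images of the ends of `e` to `z₀` and `t₀`. A separator
  -- has at most one vertex: `z₀` is handled by `h₂`, `t₀` by `h₃`, and a vertex of `S` by `h₁`.
  obtain ⟨p, q, l, hP, hd⟩ := exists_disjoint_relPaths (A := {φ a, φ b}) (B := {z₀, t₀}) hrfin 2 (by
    intro X hX U hAU hU
    have hXe : ∀ x ∈ X, ∀ y ∈ X, x = y := fun x hx y hy =>
      Finset.card_le_one.1 (by omega) x hx y hy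
    have hφa : φ a ∉ X → φ a ∈ U := hAU _ (by simp)
    have hφb : φ b ∉ X → φ b ∈ U := hAU _ (by simp)
    have hcl : ∀ x ∈ U ∩ (S \ X), ∀ y ∈ S, y ∉ X → G.Adj x y → y ∈ U ∩ (S \ X) :=
      fun x hx y hy hyX hxy => ⟨hU x hx.1 hx.2.2 y hyX ⟨hx.2.1, Or.inl ⟨hy, hxy⟩⟩, hy, hyX⟩
    by_cases hzX : z₀ ∈ X
    · have htX : t₀ ∉ X := fun h => hzt (hXe _ hzX _ h)
      have hSX : ∀ x ∈ S, x ∉ X := fun x hx hxX => hz₀S (hXe _ hxX _ hzX ▸ hx)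
      refine ⟨t₀, by simp, htX, ?_⟩
      by_cases haT : a ∈ T
      · exact hφT a haT ▸ hφa (by rwa [hφT a haT])
      by_cases hbT : b ∈ T
      · exact hφT b hbT ▸ hφb (by rwa [hφT b hbT])
      obtain ⟨x, hx, y, hy, hxy⟩ := h₂ (U ∩ (S \ X)) (fun x hx => hx.2.1)
        (fun haS => ⟨hφS a haS ▸ hφa (by rw [hφS a haS]; exact hSX a haS), haS, hSX a haS⟩)
        (fun hbS => ⟨hφS b hbS ▸ hφb (by rw [hφS b hbS]; exact hSX b hbS), hbS, hSX b hbS⟩)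
        haT hbT (fun x hx y hy => hcl x hx y hy (hSX y hy))
      exact hU x hx.1 hx.2.2 t₀ htX ⟨hx.2.1, Or.inr (Or.inr ⟨rfl, y, hy, hxy⟩)⟩
    by_cases htX : t₀ ∈ X
    · have hSX : ∀ x ∈ S, x ∉ X := fun x hx hxX => ht₀S (hXe _ hxX _ htX ▸ hx)
      refine ⟨z₀, by simp, hzX, ?_⟩
      by_cases haT : a ∈ Z
      · exact hφZ a haT ▸ hφa (by rwa [hφZ a haT])
      by_cases hbT : b ∈ Z
      · exact hφZ b hbT ▸ hφb (by rwa [hφZ b hbT])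
      obtain ⟨x, hx, y, hy, hxy⟩ := h₃ (U ∩ (S \ X)) (fun x hx => hx.2.1)
        (fun haS => ⟨hφS a haS ▸ hφa (by rw [hφS a haS]; exact hSX a haS), haS, hSX a haS⟩)
        (fun hbS => ⟨hφS b hbS ▸ hφb (by rw [hφS b hbS]; exact hSX b hbS), hbS, hSX b hbS⟩)
        haT hbT (fun x hx y hy => hcl x hx y hy (hSX y hy))
      exact hU x hx.1 hx.2.2 z₀ hzX ⟨hx.2.1, Or.inr (Or.inl ⟨rfl, y, hy, hxy⟩)⟩
    by_cases haZ : a ∈ Z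
    · exact ⟨z₀, by simp, hzX, hφZ a haZ ▸ hφa (by rwa [hφZ a haZ])⟩
    by_cases hbZ : b ∈ Z
    · exact ⟨z₀, by simp, hzX, hφZ b hbZ ▸ hφb (by rwa [hφZ b hbZ])⟩
    by_cases haT : a ∈ T
    · exact ⟨t₀, by simp, htX, hφT a haT ▸ hφa (by rwa [hφT a haT])⟩
    by_cases hbT : b ∈ T
    · exact ⟨t₀, by simp, htX, hφT b hbT ▸ hφb (by rwa [hφT b hbT])⟩
    have haS : a ∈ S := by tauto
    have hbS : b ∈ S := by tauto
    rw [hφS a haS] at hφa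
    rw [hφS b hbS] at hφb
    have key : ∃ x ∈ U ∩ (S \ X), ∃ y, (y ∈ Z ∨ y ∈ T) ∧ G.Adj x y := by
      by_cases hw : ∃ w ∈ X, w ∈ S
      · obtain ⟨w, hwX, hwS⟩ := hw
        have hX' : ∀ x, x ≠ w → x ∉ X := fun x hxw hxX => hxw (hXe x hxX w hwX)
        exact h₁ haS hbS w hwS _ (fun x hx => hx.2.1) (fun hw => hw.2.2 hwX)
          (fun h => ⟨hφa (hX' _ h), haS, hX' _ h⟩) (fun h => ⟨hφb (hX' _ h), hbS, hX' _ h⟩)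
          (fun x hx y hy hyw => hcl x hx y hy (hX' y hyw))
      · have hX' : ∀ x ∈ S, x ∉ X := fun x hxS hxX => hw ⟨x, hxX, hxS⟩
        obtain ⟨x, hx, y, hy, hxy⟩ := h₂ (U ∩ (S \ X)) (fun x hx => hx.2.1)
          (fun _ => ⟨hφa (hX' _ haS), haS, hX' _ haS⟩) (fun _ => ⟨hφb (hX' _ hbS), hbS, hX' _ hbS⟩)
          haT hbT (fun x hx y hy => hcl x hx y hy (hX' y hy))
        exact ⟨x, hx, y, Or.inr hy, hxy⟩
    obtain ⟨x, hx, y, hy | hy, hxy⟩ := key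
    · exact ⟨z₀, by simp, hzX, hU x hx.1 hx.2.2 z₀ hzX ⟨hx.2.1, Or.inr (Or.inl ⟨rfl, y, hy, hxy⟩)⟩⟩
    · exact ⟨t₀, by simp, htX,
        hU x hx.1 hx.2.2 t₀ htX ⟨hx.2.1, Or.inr (Or.inr ⟨rfl, y, hy, hxy⟩)⟩⟩)
  -- If an end of `e` was contracted, its path is trivial, and the lift starts and stops at the
  -- original end.
  have lift : ∀ {Z' : Set α} {z' : α}, (∀ x y, r x y → x ∈ S ∧ (y ∈ S ∧ G.Adj x y ∨
      (y = z' ∧ ∃ z ∈ Z', G.Adj x z) ∨ y ∉ S ∧ y ≠ z')) → (∀ x ∈ S, x ∉ Z') → z' ∈ Z' →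
      (∀ x, (x ∈ Z ∨ x ∈ T) → φ x = z' → x ∈ Z') → ∀ x ∈ V(G), ∀ l, (x ∈ S ∨ x ∈ Z ∨ x ∈ T) →
      RelPath r {φ a, φ b} {z₀, t₀} (φ x) l z' →
      ∃ z ∈ Z', ∃ P F s, G.PathOn σ x z P F s ∧ ∀ y ∈ P, y ≠ z → y ∈ S ∧ y ∈ φ x :: l := by
    intro Z' z' hr' hSZ' hz' hφ' x hxV l hx hl
    by_cases hxS : x ∈ S
    · rw [hφS x hxS] at hl ⊢
      exact exists_pathOn_of_contraction hr' hSZ' hz' hl.walk hl.nodup hxS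
    · have hx' : x ∈ Z ∨ x ∈ T := by tauto
      have hφx : φ x ∉ S := by
        rcases hx' with h | h
        · rwa [hφZ x h]
        · rwa [hφT x h]
      rcases l with _ | ⟨y, l⟩
      · exact ⟨x, hφ' x hx' hl.walk, _, _, _, PathOn.refl hxV, fun y hy hyx => absurd hy hyx⟩
      · exact absurd (hr' _ _ hl.walk.1).1 hφx
  have hrZ : ∀ x y, r x y → x ∈ S ∧ (y ∈ S ∧ G.Adj x y ∨ (y = z₀ ∧ ∃ z ∈ Z, G.Adj x z) ∨
      y ∉ S ∧ y ≠ z₀) := by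
    rintro x y ⟨hx, h | h | ⟨rfl, h⟩⟩
    exacts [⟨hx, Or.inl h⟩, ⟨hx, Or.inr (Or.inl h)⟩, ⟨hx, Or.inr (Or.inr ⟨ht₀S, hzt.symm⟩)⟩]
  have hrT : ∀ x y, r x y → x ∈ S ∧ (y ∈ S ∧ G.Adj x y ∨ (y = t₀ ∧ ∃ z ∈ T, G.Adj x z) ∨
      y ∉ S ∧ y ≠ t₀) := by
    rintro x y ⟨hx, h | ⟨rfl, h⟩ | h⟩
    exacts [⟨hx, Or.inl h⟩, ⟨hx, Or.inr (Or.inr ⟨hz₀S, hzt⟩)⟩, ⟨hx, Or.inr (Or.inl h)⟩]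
  have liftZ := lift hrZ hSZ hz₀ (by
    rintro x (hx | hx) h
    · exact hx
    · exact absurd (h.symm.trans (hφT x hx)) hzt)
  have liftT := lift hrT hST ht₀ (by
    rintro x (hx | hx) h
    · exact absurd ((hφZ x hx).symm.trans h) hzt
    · exact hx)
  -- join a path from one end of `e` to `Z` and a disjoint path from the other end to `T`
  have join : ∀ c d i j, G.IsLink e c d → c ≠ d → (c ∈ S ∨ c ∈ Z ∨ c ∈ T) →
      (d ∈ S ∨ d ∈ Z ∨ d ∈ T) → i ≠ j → p i = φ c → q i = z₀ → p j = φ d → q j = t₀ →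
      ∃ z ∈ Z, ∃ t ∈ T, ∃ P F s, G.PathOn σ z t P F s ∧ e ∈ F ∧
        ∀ x ∈ P, x ≠ z → x ≠ t → x ∈ S := by
    intro c d i j hcd hne hc hd' hij hpi hqi hpj hqj
    obtain ⟨z, hz, P, F, s, hPP, hPS⟩ := liftZ c hcd.left_mem (l i) hc (hpi ▸ hqi ▸ hP i)
    obtain ⟨t, ht, Q, F', s', hQQ, hQS⟩ := liftT d hcd.right_mem (l j) hd' (hpj ▸ hqj ▸ hP j)
    have hPQ : ∀ x ∈ P, x ∉ Q := by
      intro x hxP hxQ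
      have hzt' : z ≠ t := fun h => hZT z hz (h ▸ ht)
      by_cases hxz : x = z
      · subst hxz
        exact hSZ x (hQS x hxQ hzt').1 hz
      by_cases hxt : x = t
      · subst hxt
        exact hST x (hPS x hxP hxz).1 ht
      exact hij (hd i j x (hpi ▸ (hPS x hxP hxz).2) (hpj ▸ (hQS x hxQ hxt).2))
    have hcP := hPP.left_mem
    have hdQ := hQQ.left_mem
    refine ⟨z, hz, t, ht, _, _, _, (hPP.symm.trans (hcd.pathOn hne) ?_).trans hQQ ?_, by simp, ?_⟩
    · rintro x hx (rfl | rfl)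
      · rfl
      · exact absurd hdQ (hPQ _ hx)
    · rintro x (hx | rfl | rfl) hx'
      · exact absurd hx' (hPQ x hx)
      · exact absurd hx' (hPQ _ hcP)
      · rfl
    · rintro x ((hx | rfl | rfl) | hx) hxz hxt
      · exact (hPS x hx hxz).1
      · exact (hPS _ hcP hxz).1
      · exact (hQS _ hdQ hxt).1
      · exact (hQS x hx hxt).1
  have h01 : (0 : Fin 2) ≠ 1 := by decide
  have hq : q 0 ≠ q 1 := fun h => h01 (hd 0 1 (q 0) (hP 0).walk.end_mem (h ▸ (hP 1).walk.end_mem))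
  have hp : p 0 ≠ p 1 := fun h => h01 (hd 0 1 (p 0) (by simp) (by simp [h]))
  have e0 := (hP 0).end_mem
  have e1 := (hP 1).end_mem
  have s0 := (hP 0).start_mem
  have s1 := (hP 1).start_mem
  simp only [Set.mem_insert_iff, Set.mem_singleton_iff] at e0 e1 s0 s1
  have ha' : ∃ i j, i ≠ j ∧ q i = z₀ ∧ q j = t₀ := by
    rcases e0 with h0 | h0 <;> rcases e1 with h1 | h1
    · exact absurd (h0.trans h1.symm) hq
    · exact ⟨0, 1, h01, h0, h1⟩
    · exact ⟨1, 0, h01.symm, h1, h0⟩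
    · exact absurd (h0.trans h1.symm) hq
  obtain ⟨i, j, hij, hqi, hqj⟩ := ha'
  have hst : (p i = φ a ∧ p j = φ b) ∨ (p i = φ b ∧ p j = φ a) := by
    have : (i = 0 ∧ j = 1) ∨ (i = 1 ∧ j = 0) := by omega
    rcases this with ⟨rfl, rfl⟩ | ⟨rfl, rfl⟩ <;> grind
  rcases hst with ⟨hi, hj⟩ | ⟨hi, hj⟩
  · exact join a b i j he hab ha hb hij hi hqi hj hqj
  · exact join b a i j he.symm hab.symm hb ha hij hi hqi hj hqj

end Graph

namespace Graph

variable {α β : Type*} {G : Graph α β} {σ : β → ℤˣ} {u v x y z : α}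
  {S S' C K : Set α} {F F' FC : Set β} {s s' : ℤˣ} {e f e₁ e₂ : β} {a b a₁ b₁ a₂ b₂ : α}

/-! ### Two edges in the same bridge of a long negative cycle -/

/-- The set has more than two elements. -/
def IsLong (C : Set α) : Prop := ∀ p q, ∃ c ∈ C, c ≠ p ∧ c ≠ q

/-- The vertex set of a component of `G - C`. -/
structure IsComponent (G : Graph α β) (C K : Set α) : Prop where
  subset : K ⊆ V(G)
  disjoint : ∀ x ∈ K, x ∉ C
  closed : ∀ x ∈ K, ∀ y, y ∉ C → G.Adj x y → y ∈ K
  connected : ∀ U ⊆ K, U.Nonempty → (∀ x ∈ U, ∀ y ∈ K, G.Adj x y → y ∈ U) → K ⊆ U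

/-- If `S ⊆ K` is only joined to the rest of `K` via `z`, there is a path from `z` through `S` to `C`
that passes through a given edge and avoids a given vertex of `C`. -/
theorem IsComponent.exists_spoke (hK : G.IsComponent C K) (hV : V(G).Finite) (h3 : G.IsTriSep)
    (hCV : C ⊆ V(G)) (hC : IsLong C) {c₀ : α} (hS : S ⊆ K) (hz : z ∈ K) (hzS : z ∉ S)
    (hSc : ∀ x ∈ S, ∀ y ∈ K, y ≠ z → G.Adj x y → y ∈ S) (he : G.IsLink e a b) (hab : a ≠ b)
    (ha : a ∈ S ∨ a = z ∨ a ∈ C ∧ a ≠ c₀) (hb : b ∈ S ∨ b = z ∨ b ∈ C ∧ b ≠ c₀)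
    (haS : a ∈ S ∨ b ∈ S) (hc₀ : c₀ ∈ C) :
    ∃ c ∈ C, c ≠ c₀ ∧ ∃ P F s, G.PathOn σ z c P F s ∧ e ∈ F ∧ ∀ x ∈ P, x ≠ z → x ≠ c → x ∈ S := by
  have hSC : ∀ x ∈ S, x ∉ C := fun x hx => hK.disjoint x (hS hx)
  -- 3-connectivity is applied with `w` and `c₀` deleted; a third vertex of `C` lies on the other
  -- side.
  have out : ∀ U ⊆ S, ∀ w, U.Nonempty → w ∈ K → w ∉ U →
      ∃ x ∈ U, ∃ y, y ∉ U ∧ y ≠ w ∧ (y ∈ K ∨ y ∈ C ∧ y ≠ c₀) ∧ G.Adj x y := by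
    intro U hU w hne hwK hwU
    obtain ⟨c, hc, hc1, hc2⟩ := hC c₀ w
    obtain ⟨x, hx, y, hy, hyw, hyc, hxy⟩ := h3 U (fun x hx => hK.subset (hS (hU hx))) w c₀ hne hwU
      (fun h => hSC _ (hU h) hc₀) ⟨c, hCV hc, fun h => hSC _ (hU h) hc, hc2, hc1⟩
    refine ⟨x, hx, y, hy, hyw, ?_, hxy⟩
    by_cases hyC : y ∈ C
    · exact Or.inr ⟨hyC, hyc⟩
    · exact Or.inl (hK.closed x (hS (hU hx)) y hyC hxy)
  obtain ⟨z', rfl, c, ⟨hcC, hc⟩, P, F, s, hP, heF, hPS⟩ := exists_pathOn_through (σ := σ) (S := S)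
    (Z := {z}) (T := {c | c ∈ C ∧ c ≠ c₀}) hV he hab ha hb (fun x hx h => hzS (h ▸ hx))
    (fun x hx h => hSC x hx h.1) (fun x hx h => hK.disjoint z hz (hx ▸ h.1))
    (by
      intro haS hbS w hw U hU hwU haU hbU hcl
      have hne : U.Nonempty := by
        by_cases h : a = w
        · exact ⟨b, hbU fun h' => hab (h.trans h'.symm)⟩
        · exact ⟨a, haU h⟩
      obtain ⟨x, hx, y, hy, hyw, hyK | hyC, hxy⟩ := out U hU w hne (hS hw) hwU
      · by_cases hyz : y = z
        · exact ⟨x, hx, y, Or.inl hyz, hxy⟩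
        · exact absurd (hcl x hx y (hSc x (hU hx) y hyK hyz hxy) hyw hxy) hy
      · exact ⟨x, hx, y, Or.inr hyC, hxy⟩)
    (by
      intro U hU haU hbU _ _ hcl
      obtain ⟨x, hx, y, hy, hyw, hyK | hyC, hxy⟩ := out U hU z
        (by rcases haS with h | h; exacts [⟨a, haU h⟩, ⟨b, hbU h⟩]) hz (fun h => hzS (hU h))
      · exact absurd (hcl x hx y (hSc x (hU hx) y hyK hyw hxy) hxy) hy
      · exact ⟨x, hx, y, hyC, hxy⟩)
    (by
      intro U hU haU hbU _ _ hcl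
      by_contra! hno
      have := hK.connected U (fun x hx => hS (hU hx))
        (by rcases haS with h | h; exacts [⟨a, haU h⟩, ⟨b, hbU h⟩]) (fun x hx y hy hxy => by
          have hyz : y ≠ z := fun h => hno x hx z rfl (h ▸ hxy)
          exact hcl x hx y (hSc x (hU hx) y hy hyz hxy) hxy)
      exact hzS (hU (this hz)))
  exact ⟨c, hcC, hc, P, F, s, hP, heF, hPS⟩

/-- Paths from two vertices of a negative cycle to the same side of a cycle through both edges. -/
theorem CycleOn.untied_of_two_spokes (hC : G.CycleOn σ C FC (-1)) (he₁ : G.IsLink e₁ a₁ b₁)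
    (he₂ : G.IsLink e₂ a₂ b₂) (hne : e₁ ≠ e₂) {P₁ P₂ Q T T' : Set α} {FP₁ FP₂ FQ FT FT' : Set β}
    {p₁ p₂ q t t' : ℤˣ} {c c' d d' : α} (hP₁ : G.PathOn σ a₁ d P₁ FP₁ p₁)
    (hP₂ : G.PathOn σ d' a₂ P₂ FP₂ p₂) (hQ : G.PathOn σ b₁ b₂ Q FQ q)
    (hT : G.PathOn σ c d T FT t) (hT' : G.PathOn σ c' d' T' FT' t')
    (h12 : ∀ x ∈ P₁, x ∉ P₂) (h1Q : ∀ x ∈ P₁, x ∉ Q) (h2Q : ∀ x ∈ P₂, x ∉ Q)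
    (hTT : ∀ x ∈ T, x ∉ T') (hTP₁ : ∀ x ∈ T, x ∈ P₁ → x = d) (hTP₂ : ∀ x ∈ T, x ∉ P₂)
    (hTQ : ∀ x ∈ T, x ∉ Q) (hTP₁' : ∀ x ∈ T', x ∉ P₁) (hTP₂' : ∀ x ∈ T', x ∈ P₂ → x = d')
    (hTQ' : ∀ x ∈ T', x ∉ Q) (hc : c ∈ C) (hc' : c' ∈ C) (hTC : ∀ x ∈ T, x ∈ C → x = c)
    (hTC' : ∀ x ∈ T', x ∈ C → x = c') (h1C : ∀ x ∈ P₁, x ∉ C) (h2C : ∀ x ∈ P₂, x ∉ C)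
    (hQC : ∀ x ∈ Q, x ∉ C) : G.Untied σ e₁ e₂ := by
  have m1 := hP₁.left_mem
  have m2 := hP₁.right_mem
  have m3 := hP₂.left_mem
  have m4 := hP₂.right_mem
  have m5 := hQ.left_mem
  have m6 := hQ.right_mem
  have m7 := hT.left_mem
  have m8 := hT.right_mem
  have m9 := hT'.left_mem
  have m10 := hT'.right_mem
  -- The route is `T`, `P₁`, `e₁`, `Q`, `e₂`, `P₂`, `T'`. It meets `C` only in `c` and `c'`.
  have R₁ := hT.trans hP₁.symm (by grind)
  have R₂ := R₁.trans (he₁.pathOn (by grind)) (by grind)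
  have R₃ := R₂.trans hQ (by grind)
  have R₄ := R₃.trans (he₂.symm.pathOn (by grind)) (by grind)
  have R₅ := R₄.trans hP₂.symm (by grind)
  have R := R₅.trans hT'.symm (by grind)
  exact hC.untied_of_pathOn R hc hc' (by grind) (by grind) hne (by simp) (by simp)

/-- Both spokes reach the same side `P` of the cycle through `e₁` and `e₂`, so the segment of `P`
between their ends contains neither edge. Following the rest of the cycle from one spoke to the
other uses both edges. The two cases are the orders of `d` and `d'` on `P`. -/
theorem CycleOn.untied_of_three_spokes (hC : G.CycleOn σ C FC (-1)) (he₁ : G.IsLink e₁ a₁ b₁)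
    (he₂ : G.IsLink e₂ a₂ b₂) (hne : e₁ ≠ e₂) {P Q T T' : Set α} {FP FQ FT FT' : Set β}
    {p q t t' : ℤˣ} {c c' d d' : α} (hP : G.PathOn σ a₁ a₂ P FP p)
    (hQ : G.PathOn σ b₁ b₂ Q FQ q) (hPQ : ∀ x ∈ P, x ∉ Q)
    (hT : G.PathOn σ c d T FT t) (hT' : G.PathOn σ c' d' T' FT' t')
    (hTT : ∀ x ∈ T, x ∉ T') (hTPQ : ∀ x ∈ T, x ∈ P ∪ Q → x = d)
    (hTPQ' : ∀ x ∈ T', x ∈ P ∪ Q → x = d') (hd : d ∈ P) (hd' : d' ∈ P)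
    (hc : c ∈ C) (hc' : c' ∈ C) (hTC : ∀ x ∈ T, x ∈ C → x = c)
    (hTC' : ∀ x ∈ T', x ∈ C → x = c') (hPC : ∀ x ∈ P, x ∉ C) (hQC : ∀ x ∈ Q, x ∉ C) :
    G.Untied σ e₁ e₂ := by
  have m8 := hT.right_mem
  have m10 := hT'.right_mem
  have hdd : d ≠ d' := by grind
  obtain ⟨A, B, FA, FB, sa, sb, hA, hB, rfl, -, -, hAB⟩ := hP.exists_split hd
  rcases hd' with hd' | hd'
  · obtain ⟨A₁, A₂, FA₁, FA₂, sa₁, sa₂, hA₁, hA₂, rfl, -, -, hA12⟩ := hA.exists_split hd'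
    have m1 := hA₂.right_mem
    simp only [Set.mem_union] at *
    apply hC.untied_of_two_spokes he₁ he₂ hne hA₁ hB hQ hT' hT <;> grind
  · obtain ⟨B₁, B₂, FB₁, FB₂, sb₁, sb₂, hB₁, hB₂, rfl, -, -, hB12⟩ := hB.exists_split hd'
    have m1 := hB₁.left_mem
    simp only [Set.mem_union] at *
    apply hC.untied_of_two_spokes he₁ he₂ hne hA hB₂ hQ hT hT' <;> grind

/-- A cycle through both edges that is disjoint from a long negative cycle. -/
theorem CycleOn.untied_of_disjoint (hC : G.CycleOn σ C FC (-1)) (hV : V(G).Finite)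
    (h3 : G.IsTriSep) (hlong : IsLong C) (he₁ : G.IsLink e₁ a₁ b₁)
    (he₂ : G.IsLink e₂ a₂ b₂) (hne : e₁ ≠ e₂) {P Q : Set α} {FP FQ : Set β}
    {p q : ℤˣ} (hP : G.PathOn σ a₁ a₂ P FP p) (hQ : G.PathOn σ b₁ b₂ Q FQ q)
    (hPQ : ∀ x ∈ P, x ∉ Q) (hPC : ∀ x ∈ P, x ∉ C) (hQC : ∀ x ∈ Q, x ∉ C) (ha : a₁ ≠ a₂) :
    G.Untied σ e₁ e₂ := by
  obtain ⟨c, d, T, FT, t, hT, hc, hd, -, hTC, hTD, hTT⟩ := exists_disjoint_pathsOn (σ := σ) (G := G)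
    hV (M := V(G)) (A := C) (B := P ∪ Q) subset_rfl hC.subset 3 (by
      intro X hX U hUV hUX hAU hcl
      by_contra! hno
      obtain ⟨p, q, hp, hq, hpq⟩ : ∃ p q, p ∉ U ∧ q ∉ U ∧ ∀ x ∈ X, x = p ∨ x = q := by
        rcases X.eq_empty_or_nonempty with rfl | ⟨p, hp⟩
        · have := hno a₁ (Or.inl hP.left_mem)
          exact ⟨a₁, a₁, this, this, by simp⟩
        · classical
          rcases (X.erase p).eq_empty_or_nonempty with h | ⟨q, hq⟩
          · exact ⟨p, p, fun h => hUX p h hp, fun h => hUX p h hp, fun x hx => Or.inl (by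
              by_contra hxp
              simpa [h] using Finset.mem_erase.2 ⟨hxp, hx⟩)⟩
          · refine ⟨p, q, fun h => hUX p h hp,
              fun h => hUX q h (Finset.mem_of_mem_erase hq), fun x hx => ?_⟩
            by_contra! hxpq
            have : ({p, q, x} : Finset α) ⊆ X := by
              intro y hy
              simp only [Finset.mem_insert, Finset.mem_singleton] at hy
              rcases hy with rfl | rfl | rfl
              exacts [hp, Finset.mem_of_mem_erase hq, hx]
            have h3 := Finset.card_le_card this
            rw [Finset.card_eq_three.2 ⟨p, q, x, (Finset.ne_of_mem_erase hq).symm, hxpq.1.symm,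
              hxpq.2.symm, rfl⟩] at h3
            omega
      obtain ⟨c, hc, hcp, hcq⟩ := hlong p q
      have hcX : ∀ x, x ≠ p → x ≠ q → x ∉ X := fun x h1 h2 hx => (hpq x hx).elim h1 h2
      have hcU := hAU c hc (hcX c hcp hcq)
      -- The vertices `a₁`, `a₂` and `b₁` are distinct, so one of them differs from `p` and `q`.
      have hD : ∃ y ∈ V(G), y ∉ U ∧ y ≠ p ∧ y ≠ q := by
        have hb : a₁ ≠ b₁ := fun h => hPQ _ hP.left_mem (h ▸ hQ.left_mem)
        have hb' : a₂ ≠ b₁ := fun h => hPQ _ hP.right_mem (h ▸ hQ.left_mem)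
        have n1 := hno a₁ (Or.inl hP.left_mem)
        have n2 := hno a₂ (Or.inl hP.right_mem)
        have n3 := hno b₁ (Or.inr hQ.left_mem)
        have v1 := he₁.left_mem
        have v2 := he₁.right_mem
        have v3 := he₂.left_mem
        grind
      obtain ⟨x, hx, y, hy, hyp, hyq, hxy⟩ := h3 U hUV p q ⟨c, hcU⟩ hp hq hD
      exact hy (hcl x hx y hxy.right_mem (hcX y hyp hyq) hxy))
  -- Of the three disjoint paths from `C`, two end on the same side of the cycle through both edges.
  have pig : ∃ i j, i ≠ j ∧ ((d i ∈ P ∧ d j ∈ P) ∨ (d i ∈ Q ∧ d j ∈ Q)) := by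
    have h0 := hd 0
    have h1 := hd 1
    have h2 := hd 2
    simp only [Set.mem_union] at h0 h1 h2
    have n1 : (0 : Fin 3) ≠ 1 := by decide
    have n2 : (0 : Fin 3) ≠ 2 := by decide
    have n3 : (1 : Fin 3) ≠ 2 := by decide
    grind
  obtain ⟨i, j, hij, ⟨hi, hj⟩ | ⟨hi, hj⟩⟩ := pig
  · exact hC.untied_of_three_spokes he₁ he₂ hne hP hQ hPQ (hT i) (hT j)
      (fun x h h' => hij (hTT i j x h h')) (hTD i) (hTD j) hi hj (hc i) (hc j) (hTC i) (hTC j)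
      hPC hQC
  · rw [Set.union_comm] at hTD
    exact hC.untied_of_three_spokes he₁.symm he₂.symm hne hQ hP (fun x h h' => hPQ x h' h) (hT i)
      (hT j) (fun x h h' => hij (hTT i j x h h')) (hTD i) (hTD j) hi hj (hc i) (hc j) (hTC i)
      (hTC j) hQC hPC

/-- Both edges have an end in the same component of `G - C`, and the first one has an end in `C`. -/
theorem CycleOn.untied_of_attached (hC : G.CycleOn σ C FC (-1)) (hV : V(G).Finite)
    (h3 : G.IsTriSep) (hlong : IsLong C) (hK : G.IsComponent C K) (he₁ : G.IsLink e₁ a₁ b₁)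
    (he₂ : G.IsLink e₂ a₂ b₂) (hne : e₁ ≠ e₂) (h2 : a₂ ≠ b₂) (haa : a₁ ≠ a₂)
    (hba : b₁ ≠ a₂) (hbb : b₁ ≠ b₂) (ha₁ : a₁ ∈ C) (hb₁ : b₁ ∈ K) (hb₂ : b₂ ∈ K) :
    G.Untied σ e₁ e₂ := by
  have hb₂S : b₂ ∈ K \ {b₁} := ⟨hb₂, hbb.symm⟩
  have ha₂ : a₂ ∈ K \ {b₁} ∨ a₂ = b₁ ∨ a₂ ∈ C ∧ a₂ ≠ a₁ := by
    by_cases h : a₂ ∈ C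
    · exact Or.inr (Or.inr ⟨h, haa.symm⟩)
    · exact Or.inl ⟨hK.closed b₂ hb₂ a₂ h he₂.symm.adj, hba.symm⟩
  obtain ⟨c, hc, hca, P, F, s, hP, heF, hPS⟩ := hK.exists_spoke (σ := σ) hV h3 hC.subset hlong
    (S := K \ {b₁}) Set.sdiff_subset hb₁ (by simp) (fun x _ y hy hyb _ => ⟨hy, hyb⟩) he₂ h2 ha₂
    (Or.inl hb₂S) (Or.inr hb₂S) ha₁
  have hbC := hK.disjoint
  have hab : a₁ ≠ b₁ := fun h => hbC _ hb₁ (h ▸ ha₁)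
  have haP : a₁ ∉ P := fun h => hbC a₁ (hPS a₁ h hab hca.symm).1 ha₁
  refine hC.untied_of_pathOn ((he₁.pathOn hab).trans hP ?_) ha₁ hc hca.symm ?_ hne (by simp)
    (by simp [heF])
  · rintro z (rfl | rfl) hz
    · exact absurd hz haP
    · rfl
  · rintro z ((rfl | rfl) | hz) hzC
    · exact Or.inl rfl
    · exact absurd hzC (hbC _ hb₁)
    · by_cases hzb : z = b₁
      · exact absurd hzC (hbC _ (hzb ▸ hb₁))
      · by_cases hzc : z = c
        · exact Or.inr hzc
        · exact absurd hzC (hbC _ (hPS z hz hzb hzc).1)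

/-- Two edges that share no end and that have ends in the same component of `G - C`, where `C` is a
long negative cycle, are untied. -/
theorem CycleOn.untied_of_isComponent (hC : G.CycleOn σ C FC (-1)) (hV : V(G).Finite)
    (h3 : G.IsTriSep) (hlong : IsLong C) (hK : G.IsComponent C K) (he₁ : G.IsLink e₁ a₁ b₁)
    (he₂ : G.IsLink e₂ a₂ b₂) (hne : e₁ ≠ e₂) (h1 : a₁ ≠ b₁) (h2 : a₂ ≠ b₂) (haa : a₁ ≠ a₂)
    (hab : a₁ ≠ b₂) (hba : b₁ ≠ a₂) (hbb : b₁ ≠ b₂) (hb₁ : b₁ ∈ K) (hb₂ : b₂ ∈ K) :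
    G.Untied σ e₁ e₂ := by
  by_cases ha₁C : a₁ ∈ C
  · exact hC.untied_of_attached hV h3 hlong hK he₁ he₂ hne h2 haa hba hbb ha₁C hb₁ hb₂
  by_cases ha₂C : a₂ ∈ C
  · exact (hC.untied_of_attached hV h3 hlong hK he₂ he₁ hne.symm h1 haa.symm hab.symm hbb.symm ha₂C
      hb₂ hb₁).symm
  have ha₁ : a₁ ∈ K := hK.closed b₁ hb₁ a₁ ha₁C he₁.symm.adj
  have ha₂ : a₂ ∈ K := hK.closed b₂ hb₂ a₂ ha₂C he₂.symm.adj
  -- Either two disjoint paths in `K` join the ends of `e₁` to those of `e₂` and yield a cycle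
  -- disjoint from `C`, or a single vertex `z` of `K` separates the two edges.
  by_cases hM : ∀ X : Finset α, X.card < 2 → ∀ U ⊆ K, (∀ x ∈ U, x ∉ X) →
      (∀ a ∈ ({a₁, b₁} : Set α), a ∉ X → a ∈ U) →
      (∀ x ∈ U, ∀ y ∈ K, y ∉ X → G.Adj x y → y ∈ U) → ∃ b ∈ ({a₂, b₂} : Set α), b ∈ U
  · obtain ⟨p, q, P, F, s, hP, hp, hq, hPK, -, -, hPP⟩ := exists_disjoint_pathsOn (σ := σ) hV
      hK.subset (by rintro x (rfl | rfl) <;> assumption) 2 hM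
    have h01 : (0 : Fin 2) ≠ 1 := by decide
    have hd : ∀ x ∈ P 0, x ∉ P 1 := fun x h h' => h01 (hPP 0 1 x h h')
    have hp0 := hp 0
    have hp1 := hp 1
    have hq0 := hq 0
    have hq1 := hq 1
    simp only [Set.mem_insert_iff, Set.mem_singleton_iff] at hp0 hp1 hq0 hq1
    have hpne : p 0 ≠ p 1 := fun h => hd _ (hP 0).left_mem (h ▸ (hP 1).left_mem)
    have hqne : q 0 ≠ q 1 := fun h => hd _ (hP 0).right_mem (h ▸ (hP 1).right_mem)
    have hl₁ : G.IsLink e₁ (p 0) (p 1) := by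
      rcases hp0 with h | h <;> rcases hp1 with h' | h' <;> rw [h, h'] at hpne ⊢
      exacts [absurd rfl hpne, he₁, he₁.symm, absurd rfl hpne]
    have hl₂ : G.IsLink e₂ (q 0) (q 1) := by
      rcases hq0 with h | h <;> rcases hq1 with h' | h' <;> rw [h, h'] at hqne ⊢
      exacts [absurd rfl hqne, he₂, he₂.symm, absurd rfl hqne]
    have hpq : p 0 ≠ q 0 := by
      rcases hp0 with h | h <;> rcases hq0 with h' | h' <;> rw [h, h'] <;> assumption
    exact hC.untied_of_disjoint hV h3 hlong hl₁ hl₂ hne (hP 0) (hP 1) hd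
      (fun x hx => hK.disjoint x (hPK 0 hx)) (fun x hx => hK.disjoint x (hPK 1 hx)) hpq
  · push Not at hM
    obtain ⟨X, hX, U, hUK, hUX, hAU, hcl, hBU⟩ := hM
    have hXe : ∀ x ∈ X, ∀ y ∈ X, x = y := fun x hx y hy =>
      Finset.card_le_one.1 (by omega) x hx y hy
    obtain ⟨z, hzX, hzK⟩ : ∃ z ∈ X, z ∈ K := by
      by_contra! hno
      have hno' : ∀ y ∈ K, y ∉ X := fun y hy hyX => hno y hyX hy
      have := hK.connected U hUK ⟨a₁, hAU a₁ (by simp) (hno' _ ha₁)⟩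
        (fun x hx y hy hxy => hcl x hx y hy (hno' y hy) hxy)
      exact hBU a₂ (by simp) (this ha₂)
    have hzU : z ∉ U := fun h => hUX z h hzX
    have hX' : ∀ y, y ≠ z → y ∉ X := fun y hy hyX => hy (hXe y hyX z hzX)
    have hA : ∀ x, (x = a₁ ∨ x = b₁) → x ∈ U ∨ x = z := fun x hx => by
      by_cases h : x = z
      · exact Or.inr h
      · exact Or.inl (hAU x hx (hX' x h))
    have hUcl : ∀ x ∈ U, ∀ y ∈ K, y ≠ z → G.Adj x y → y ∈ U := fun x hx y hy hyz =>
      hcl x hx y hy (hX' y hyz)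
    have hB : ∀ x, (x = a₂ ∨ x = b₂) → x ∈ K → x ∈ K \ (insert z U) ∨ x = z := fun x hx hxK => by
      by_cases h : x = z
      · exact Or.inr h
      · exact Or.inl ⟨hxK, fun h' => h'.elim h (hBU x hx)⟩
    obtain ⟨c₀, hc₀⟩ := hC.nonempty
    -- The vertex `z` splits `K`. One spoke goes from `z` through `e₁` inside `U`, and another
    -- through `e₂` inside the remainder; the second is required to miss the end `c` of the first on
    -- `C`.
    obtain ⟨c, hcC, -, P, F, s, hP, hPe, hPU⟩ := hK.exists_spoke (σ := σ) hV h3 hC.subset hlong hUK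
      hzK hzU hUcl he₁ h1 ((hA a₁ (Or.inl rfl)).imp_right Or.inl)
      ((hA b₁ (Or.inr rfl)).imp_right Or.inl) (by
        rcases hA a₁ (Or.inl rfl) with h | h
        · exact Or.inl h
        · exact Or.inr ((hA b₁ (Or.inr rfl)).resolve_right fun h' => h1 (h.trans h'.symm))) hc₀
    obtain ⟨c', hcC', hcc, P', F', s', hP', hPe', hPU'⟩ := hK.exists_spoke (σ := σ) hV h3 hC.subset
      hlong (S := K \ insert z U) Set.sdiff_subset hzK (by simp)
      (fun x hx y hy hyz hxy => ⟨hy, fun h => h.elim hyz fun hyU =>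
        hx.2 (Or.inr (hUcl y hyU x hx.1 (fun h => hx.2 (Or.inl h)) hxy.symm))⟩) he₂ h2
      ((hB a₂ (Or.inl rfl) ha₂).imp_right Or.inl) ((hB b₂ (Or.inr rfl) hb₂).imp_right Or.inl) (by
        rcases hB a₂ (Or.inl rfl) ha₂ with h | h
        · exact Or.inl h
        · exact Or.inr ((hB b₂ (Or.inr rfl) hb₂).resolve_right fun h' => h2 (h.trans h'.symm))) hcC
    have hKC := hK.disjoint
    have m1 := hP.left_mem
    have m2 := hP'.left_mem
    simp only [Set.mem_sdiff, Set.mem_insert_iff, not_or] at hPU'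
    refine hC.untied_of_pathOn (hP.symm.trans hP' ?_) hcC hcC' hcc.symm ?_ hne (Or.inl hPe)
      (Or.inr hPe')
    · grind
    · simp only [Set.mem_union]
      grind

end Graph

namespace Graph

variable {α β : Type*} {G : Graph α β} {σ : β → ℤˣ} {u v x y z : α}
  {S S' C K : Set α} {F F' FC : Set β} {s s' : ℤˣ} {e f e₁ e₂ : β} {a b a₁ b₁ a₂ b₂ : α}

/-! ### Connected sets of vertices -/

/-- The set `L` of vertices induces a connected subgraph or is empty. -/
def ConnOn (G : Graph α β) (L : Set α) : Prop :=
  ∀ U ⊆ L, U.Nonempty → (∀ x ∈ U, ∀ y ∈ L, G.Adj x y → y ∈ U) → L ⊆ U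

theorem connOn_empty : G.ConnOn ∅ := fun _ _ _ _ => Set.empty_subset _

theorem ConnOn.insert {L : Set α} (hL : G.ConnOn L) (hx : L = ∅ ∨ ∃ k ∈ L, G.Adj k x) :
    G.ConnOn (insert x L) := by
  intro U hU ⟨u, hu⟩ hcl
  rcases hx with rfl | ⟨k, hk, hkx⟩
  · rintro y (rfl | hy)
    · rcases hU hu with rfl | h
      · exact hu
      · exact absurd h (Set.notMem_empty _)
    · exact absurd hy (Set.notMem_empty _)
  · have hkU : k ∈ U := by
      rcases hU hu with rfl | h
      · exact hcl u hu k (Or.inr hk) hkx.symm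
      · exact (hL (U ∩ L) Set.inter_subset_right ⟨u, hu, h⟩
          (fun x hx y hy hxy => ⟨hcl x hx.1 y (Or.inr hy) hxy, hy⟩) hk).1
    have hLU : L ⊆ U := fun y hy => (hL (U ∩ L) Set.inter_subset_right ⟨k, hkU, hk⟩
          (fun x hx y hy hxy => ⟨hcl x hx.1 y (Or.inr hy) hxy, hy⟩) hy).1
    rintro y (rfl | hy)
    · exact hcl k hkU y (Or.inl rfl) hkx
    · exact hLU hy

/-- The component is the intersection of all sets that contain `x` and are closed under adjacency
off `C`. A closed part `U` of it either contains `x`, and is itself such a set, or its complement in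
the component is one. -/
theorem exists_isComponent (hx : x ∈ V(G)) (hxC : x ∉ C) : ∃ K, G.IsComponent C K ∧ x ∈ K := by
  let cl : Set α → Prop := fun S => x ∈ S ∧ ∀ s ∈ S, ∀ y, y ∉ C → G.Adj s y → y ∈ S
  have hmem : ∀ S, cl S → {y | ∀ S, cl S → y ∈ S} ⊆ S := fun S hS y hy => hy S hS
  refine ⟨{y | ∀ S, cl S → y ∈ S}, ⟨?_, ?_, ?_, ?_⟩, fun S hS => hS.1⟩
  · exact hmem _ ⟨hx, fun s _ y _ h => h.right_mem⟩
  · intro y hy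
    exact hmem {y | y ∉ C} ⟨hxC, fun s _ y hy _ => hy⟩ hy
  · intro y hy y' hy' hyy S hS
    exact hS.2 y (hy S hS) y' hy' hyy
  · intro U hU ⟨u, hu⟩ hcl
    have hclosed : ∀ s ∈ {y | ∀ S, cl S → y ∈ S}, ∀ y, y ∉ C → G.Adj s y →
        y ∈ {y | ∀ S, cl S → y ∈ S} := fun y hy y' hy' hyy S hS => hS.2 y (hy S hS) y' hy' hyy
    have hnC : ∀ y ∈ {y | ∀ S, cl S → y ∈ S}, y ∉ C := fun y hy =>
      hmem {y | y ∉ C} ⟨hxC, fun s _ y hy _ => hy⟩ hy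
    by_cases hxU : x ∈ U
    · exact hmem U ⟨hxU, fun s hs y hy hsy => hcl s hs y (hclosed s (hU hs) y hy hsy) hsy⟩
    · have := hmem ({y | ∀ S, cl S → y ∈ S} \ U) ⟨⟨fun S hS => hS.1, hxU⟩, fun s hs y hy hsy =>
        ⟨hclosed s hs.1 y hy hsy, fun hyU => hs.2 (hcl y hyU s hs.1 hsy.symm)⟩⟩
      exact absurd hu (this (hU hu)).2

/-- The last vertex is exempt because in the application it may lie on the cycle, while the rest of
the path belongs to one component of its complement. -/
theorem PathOn.mem_of_closed {U : Set α} (h : G.PathOn σ u v S F s) (hu : u ∈ U)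
    (hcl : ∀ x ∈ U, ∀ y ∈ S, y ≠ v → G.Adj x y → y ∈ U) : ∀ x ∈ S, x ≠ v → x ∈ U := by
  obtain ⟨w, h, hw, rfl, -, -⟩ := h
  induction w generalizing u with
  | nil =>
    intro x hx hxv
    simp only [List.map_nil, List.mem_cons, List.not_mem_nil, or_false, Set.mem_ofPred_eq] at hx
    exact hx ▸ hu
  | cons p w ih =>
    intro x hx hxv
    rcases List.mem_cons.1 hx with rfl | hx
    · exact hu
    · by_cases hp : p.2 = v
      · rcases w with _ | ⟨q, w⟩
        · have hx' : x = p.2 := by simpa using hx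
          exact absurd (hx'.trans hp) hxv
        · have h2 := h.2.2.end_mem
          have h3 := (List.nodup_cons.1 (List.nodup_cons.1 hw).2).1
          rw [hp] at h3
          exact absurd h2 h3
      · exact ih (hcl u hu p.2 (by simp) hp ⟨_, h.1⟩) h.2 (List.nodup_cons.1 hw).2
          (fun a ha b hb => hcl a ha b (List.mem_cons_of_mem _ hb)) x hx hxv

/-- The two edges have no common end, and none of them is parallel to another edge. -/
structure IsEdgePair (G : Graph α β) (e₁ e₂ : β) (a₁ b₁ a₂ b₂ : α) : Prop where
  link₁ : G.IsLink e₁ a₁ b₁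
  link₂ : G.IsLink e₂ a₂ b₂
  ne₁ : a₁ ≠ b₁
  ne₂ : a₂ ≠ b₂
  ne_aa : a₁ ≠ a₂
  ne_ab : a₁ ≠ b₂
  ne_ba : b₁ ≠ a₂
  ne_bb : b₁ ≠ b₂
  unique₁ : ∀ f, G.IsLink f a₁ b₁ → f = e₁
  unique₂ : ∀ f, G.IsLink f a₂ b₂ → f = e₂

theorem IsEdgePair.swap (h : G.IsEdgePair e₁ e₂ a₁ b₁ a₂ b₂) : G.IsEdgePair e₂ e₁ a₂ b₂ a₁ b₁ :=
  ⟨h.2, h.1, h.4, h.3, h.5.symm, h.7.symm, h.6.symm, h.8.symm, h.10, h.9⟩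

theorem IsEdgePair.flip₁ (h : G.IsEdgePair e₁ e₂ a₁ b₁ a₂ b₂) : G.IsEdgePair e₁ e₂ b₁ a₁ a₂ b₂ :=
  ⟨h.1.symm, h.2, h.3.symm, h.4, h.7, h.8, h.5, h.6, fun f hf => h.9 f hf.symm, h.10⟩

theorem IsEdgePair.flip₂ (h : G.IsEdgePair e₁ e₂ a₁ b₁ a₂ b₂) : G.IsEdgePair e₁ e₂ a₁ b₁ b₂ a₂ :=
  ⟨h.1, h.2.symm, h.3, h.4.symm, h.6, h.5, h.8, h.7, h.9, fun f hf => h.10 f hf.symm⟩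

theorem IsEdgePair.edge_ne (h : G.IsEdgePair e₁ e₂ a₁ b₁ a₂ b₂) : e₁ ≠ e₂ := by
  rintro rfl
  rcases h.link₁.left_eq_or_eq h.link₂ with h' | h'
  exacts [h.ne_aa h', h.ne_ab h']

theorem IsEdgePair.untied_of_isComponent (h : G.IsEdgePair e₁ e₂ a₁ b₁ a₂ b₂) (hV : V(G).Finite)
    (h3 : G.IsTriSep) (hC : G.CycleOn σ C FC (-1)) (hlong : IsLong C) (hK : G.IsComponent C K)
    (h₁ : a₁ ∈ K ∨ b₁ ∈ K) (h₂ : a₂ ∈ K ∨ b₂ ∈ K) : G.Untied σ e₁ e₂ := by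
  have key : ∀ {a₁ b₁ a₂ b₂}, G.IsEdgePair e₁ e₂ a₁ b₁ a₂ b₂ → b₁ ∈ K → b₂ ∈ K →
      G.Untied σ e₁ e₂ := fun h hb₁ hb₂ => hC.untied_of_isComponent hV h3 hlong hK h.link₁ h.link₂
    h.edge_ne h.ne₁ h.ne₂ h.ne_aa h.ne_ab h.ne_ba h.ne_bb hb₁ hb₂
  rcases h₁ with h₁ | h₁ <;> rcases h₂ with h₂ | h₂
  exacts [key h.flip₁.flip₂ h₁ h₂, key h.flip₁ h₁ h₂, key h.flip₂ h₁ h₂, key h h₁ h₂]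

theorem IsEdgePair.untied_of_connOn (h : G.IsEdgePair e₁ e₂ a₁ b₁ a₂ b₂) (hV : V(G).Finite)
    (h3 : G.IsTriSep) (hC : G.CycleOn σ C FC (-1)) (hlong : IsLong C) {L : Set α}
    (hL : G.ConnOn L) (hLC : ∀ x ∈ L, x ∉ C)
    (h₁ : a₁ ∈ L ∨ b₁ ∈ L) (h₂ : a₂ ∈ L ∨ b₂ ∈ L) : G.Untied σ e₁ e₂ := by
  obtain ⟨x, hxV, hxL⟩ : ∃ x ∈ V(G), x ∈ L := by
    rcases h₁ with h₁ | h₁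
    exacts [⟨_, h.link₁.left_mem, h₁⟩, ⟨_, h.link₁.right_mem, h₁⟩]
  obtain ⟨K, hK, hxK⟩ := exists_isComponent hxV (hLC x hxL)
  have hLK : ∀ y ∈ L, y ∈ K := fun y hy => (hL (K ∩ L) Set.inter_subset_right ⟨x, hxK, hxL⟩
    (fun x hx y hy hxy => ⟨hK.closed x hx.1 y (hLC y hy) hxy, hy⟩) hy).1
  exact h.untied_of_isComponent hV h3 hC hlong hK (h₁.imp (hLK _) (hLK _)) (h₂.imp (hLK _) (hLK _))

/-- Let `C` be a long negative cycle, let `T` be a path through `e₂` from `p ∉ C` to `q` that avoids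
`C - q`, and let `U` contain the ends of `e₁` other than `w` and have no neighbours other than `w`,
`p` and `q`. Then `e₁` and `e₂` are untied. -/
theorem IsEdgePair.untied_of_detour (h : G.IsEdgePair e₁ e₂ a₁ b₁ a₂ b₂) (hV : V(G).Finite)
    (h3 : G.IsTriSep) (hC : G.CycleOn σ C FC (-1)) (hlong : IsLong C) {p q w : α} {T U : Set α}
    {E : Set β} {t : ℤˣ} (hT : G.PathOn σ p q T E t) (he₂ : e₂ ∈ E) (hpC : p ∉ C)
    (hTC : ∀ x ∈ T, x ∈ C → x = q) (hU : U ⊆ V(G)) (hUC : ∀ x ∈ U, x ∉ C) (hqU : q ∉ U)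
    (hwU : w ∉ U) (ha : a₁ ≠ w → a₁ ∈ U) (hb : b₁ ≠ w → b₁ ∈ U)
    (hnb : ∀ x ∈ U, ∀ y, y ∉ U → G.Adj x y → y = w ∨ y = p ∨ y = q) : G.Untied σ e₁ e₂ := by
  obtain ⟨K, hK, hpK⟩ := exists_isComponent (hT.subset hT.left_mem) hpC
  have hTK := hT.mem_of_closed hpK fun x hx y hy hyq hxy =>
    hK.closed x hx y (fun hyC => hyq (hTC y hy hyC)) hxy
  -- A part of `U` outside the component of `p` could be joined to the rest only through `w` and
  -- `q`, against 3-connectivity.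
  have hUK : ∀ x ∈ U, x ∈ K := by
    by_contra! hno
    obtain ⟨x₀, hx₀, hx₀K⟩ := hno
    obtain ⟨c, hc, hcw, hcq⟩ := hlong w q
    obtain ⟨x, ⟨hxU, hxK⟩, y, hy, hyw, hyq, hxy⟩ := h3 (U \ K) (fun x hx => hU hx.1) w q
      ⟨x₀, hx₀, hx₀K⟩ (fun h => hwU h.1) (fun h => hqU h.1)
      ⟨c, hC.subset hc, fun h => hUC c h.1 hc, hcw, hcq⟩
    have hyK : y ∈ K := by
      by_cases hyU : y ∈ U
      · by_contra hyK
        exact hy ⟨hyU, hyK⟩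
      · rcases hnb x hxU y hyU hxy with h | h | h
        exacts [absurd h hyw, h ▸ hpK, absurd h hyq]
    exact hxK (hK.closed y hyK x (hUC x hxU) hxy.symm)
  refine h.untied_of_isComponent hV h3 hC hlong hK ?_ ?_
  · by_cases haw : a₁ = w
    · exact Or.inr (hUK _ (hb fun h' => h.ne₁ (haw.trans h'.symm)))
    · exact Or.inl (hUK _ (ha haw))
  · obtain ⟨m₁, m₂⟩ := hT.mem_of_isLink he₂ h.link₂
    by_cases haq : a₂ = q
    · exact Or.inr (hTK _ m₂ fun h' => h.ne₂ (haq.trans h'.symm))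
    · exact Or.inl (hTK _ m₁ haq)

/-- The third vertex `z` has two uses: it prevents both paths from being the same single edge, and
it makes the resulting cycle long. -/
theorem CycleOn.of_paths_of_mem {S₁ S₂ : Set α} {F₁ F₂ : Set β} {s₁ s₂ : ℤˣ}
    (h₁ : G.PathOn σ u v S₁ F₁ s₁) (h₂ : G.PathOn σ v u S₂ F₂ s₂) (hne : u ≠ v)
    (hS : ∀ z ∈ S₁, z ∈ S₂ → z = u ∨ z = v) (hz : z ∈ S₁ ∨ z ∈ S₂) (hzu : z ≠ u) (hzv : z ≠ v) :
    G.CycleOn σ (S₁ ∪ S₂) (F₁ ∪ F₂) (s₁ * s₂) ∧ IsLong (S₁ ∪ S₂) := by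
  refine ⟨CycleOn.of_paths h₁ h₂ hne hS ?_, ?_⟩
  · rintro ⟨f, rfl, rfl⟩
    obtain ⟨a, b, hl, hab, ha, hb⟩ := h₁.exists_isLink rfl
    obtain ⟨ha', hb'⟩ := h₂.mem_of_isLink rfl hl
    have hl' : G.IsLink f u v := by
      rcases hS a ha ha' with rfl | rfl <;> rcases hS b hb hb' with rfl | rfl
      exacts [absurd rfl hab, hl, hl.symm, absurd rfl hab]
    have e₁ := (h₁.eq_singleton rfl hl').2
    have e₂ := (h₂.eq_singleton rfl hl'.symm).2
    subst e₁ e₂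
    rcases hz with (h | h) | (h | h)
    exacts [hzu h, hzv h, hzv h, hzu h]
  · have m1 := h₁.left_mem
    have m2 := h₁.right_mem
    intro p q
    simp only [Set.mem_union]
    grind

end Graph

namespace Graph

variable {α β : Type*} {G : Graph α β} {σ : β → ℤˣ} {u v x y z : α}
  {S S' C K : Set α} {F F' FC : Set β} {s s' : ℤˣ} {e f e₁ e₂ : β} {a b a₁ b₁ a₂ b₂ : α}

/-! ### Long negative cycles that avoid a maximal connected set around the first edge -/

/-- A long negative cycle that avoids the vertices in `K` and the edges `e₁` and `e₂`. -/
structure IsGood (G : Graph α β) (σ : β → ℤˣ) (e₁ e₂ : β) (K C : Set α) (F : Set β) : Prop where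
  cycle : G.CycleOn σ C F (-1)
  long : IsLong C
  notMem₁ : e₁ ∉ F
  notMem₂ : e₂ ∉ F
  disjoint : ∀ x ∈ C, x ∉ K

/-- `x` is an end of the edge `ab` or a neighbour of `K`, and is not in `K`. -/
def IsAttachment (G : Graph α β) (a b : α) (K : Set α) (x : α) : Prop :=
  x ∉ K ∧ (x = a ∨ x = b ∨ ∃ k ∈ K, G.Adj k x)

/-- `K` is empty or a connected set with an end of `e₁` and no end of `e₂`, and all long negative
cycles that avoid `K`, `e₁` and `e₂` contain all attachments of `K`. -/
structure IsFrame (G : Graph α β) (σ : β → ℤˣ) (e₁ e₂ : β) (a₁ b₁ a₂ b₂ : α) (K : Set α) :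
    Prop where
  finite : V(G).Finite
  triSep : G.IsTriSep
  pair : G.IsEdgePair e₁ e₂ a₁ b₁ a₂ b₂
  subset : K ⊆ V(G)
  conn : G.ConnOn K
  hook : K = ∅ ∨ a₁ ∈ K ∨ b₁ ∈ K
  attachment_mem : ∀ C F, G.IsGood σ e₁ e₂ K C F → ∀ x, G.IsAttachment a₁ b₁ K x → x ∈ C
  mem_of_empty : K = ∅ → ∀ C F, G.IsGood σ e₁ e₂ K C F → a₂ ∈ C ∧ b₂ ∈ C
  left_notMem : a₂ ∉ K
  right_notMem : b₂ ∉ K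

theorem IsFrame.flip₁ (h : G.IsFrame σ e₁ e₂ a₁ b₁ a₂ b₂ K) :
    G.IsFrame σ e₁ e₂ b₁ a₁ a₂ b₂ K := by
  refine ⟨h.1, h.2, h.3.flip₁, h.4, h.5, h.6.imp_right Or.symm, fun C F hC x hx => ?_, h.8, h.9,
    h.10⟩
  exact h.7 C F hC x ⟨hx.1, by have := hx.2; tauto⟩

/-- The chord of a good cycle: two arcs of a negative cycle with the ends `p` and `q` and a path
through `e₂` from `p` to `q` outside the cycle. -/
structure IsChord (G : Graph α β) (σ : β → ℤˣ) (e₂ : β) (a₁ b₁ : α) (K : Set α) (p q : α)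
    (S₁ : Set α) (F₁ : Set β) (s₁ : ℤˣ) (S₂ : Set α) (F₂ : Set β) (s₂ : ℤˣ) (T : Set α)
    (E : Set β) (r : ℤˣ) : Prop where
  arc₁ : G.PathOn σ p q S₁ F₁ s₁
  arc₂ : G.PathOn σ q p S₂ F₂ s₂
  ne : p ≠ q
  sign : s₁ * s₂ = -1
  inter : ∀ z ∈ S₁, z ∈ S₂ → z = p ∨ z = q
  path : G.PathOn σ p q T E r
  edge_mem : e₂ ∈ E
  path_inter : ∀ z ∈ T, z ∈ S₁ ∨ z ∈ S₂ → z = p ∨ z = q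
  path_disjoint : ∀ z ∈ T, z ∉ K
  arc_disjoint : ∀ z, z ∈ S₁ ∨ z ∈ S₂ → z ∉ K
  left_ne : p ≠ a₁ ∧ p ≠ b₁
  right_ne : q ≠ a₁ ∧ q ≠ b₁

/-! ### Attachments strictly inside both arcs of a chord -/

section Chord

variable {p q : α} {S₁ S₂ T : Set α} {F₁ F₂ E : Set β} {s₁ s₂ r : ℤˣ} {n₁ n₂ : α}

theorem IsChord.flip₁ (h : G.IsChord σ e₂ a₁ b₁ K p q S₁ F₁ s₁ S₂ F₂ s₂ T E r) :
    G.IsChord σ e₂ b₁ a₁ K p q S₁ F₁ s₁ S₂ F₂ s₂ T E r :=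
  { h with left_ne := h.left_ne.symm, right_ne := h.right_ne.symm }

/-- Exchange the two arcs. -/
theorem IsChord.swap (h : G.IsChord σ e₂ a₁ b₁ K p q S₁ F₁ s₁ S₂ F₂ s₂ T E r) :
    G.IsChord σ e₂ a₁ b₁ K p q S₂ F₂ s₂ S₁ F₁ s₁ T E r :=
  { h with
    arc₁ := h.arc₂.symm
    arc₂ := h.arc₁.symm
    sign := by rw [mul_comm, h.sign]
    inter := fun z h₁ h₂ => h.inter z h₂ h₁
    path_inter := fun z hz hz' => h.path_inter z hz hz'.symm
    arc_disjoint := fun z hz => h.arc_disjoint z hz.symm }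

/-- A path from `b₁ ∈ K` through `K` to an attachment. -/
theorem IsFrame.exists_path_to_attachment (h : G.IsFrame σ e₁ e₂ a₁ b₁ a₂ b₂ K) (hb : b₁ ∈ K)
    {n : α} (hnK : n ∉ K) (hn : ∃ k ∈ K, G.Adj k n) :
    ∃ P F s, G.PathOn σ b₁ n P F s ∧ ∀ x ∈ P, x = n ∨ x ∈ K := by
  obtain ⟨k, hk, hkn⟩ := hn
  obtain ⟨a, rfl, b, rfl, P, F, s, hP, hPM, -, -⟩ := exists_pathOn (σ := σ) h.finite
    (M := insert n K) (A := {b₁}) (B := {n}) (Set.insert_subset hkn.right_mem h.subset)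
    (by rintro x rfl; exact Or.inr hb) (by
      intro U hUM hAU hcl
      have hKU := h.conn (U ∩ K) Set.inter_subset_right ⟨b₁, hAU rfl, hb⟩
        (fun x hx y hy hxy => ⟨hcl x hx.1 y (Or.inr hy) hxy, hy⟩)
      exact ⟨n, rfl, hcl k (hKU hk).1 n (Or.inl rfl) hkn⟩)
  exact ⟨P, F, s, hP, hPM⟩

/-- Here `a₁` lies on one arc, so `e₁` followed by a path through `K` to `n₂` is itself a chord
crossing `T`. -/
theorem IsChord.untied_of_end_notMem (h : G.IsFrame σ e₁ e₂ a₁ b₁ a₂ b₂ K)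
    (hc : G.IsChord σ e₂ a₁ b₁ K p q S₁ F₁ s₁ S₂ F₂ s₂ T E r) (ha : a₁ ∈ S₁) (hb : b₁ ∈ K)
    (hn : n₂ ∈ S₂) (hnN : G.IsAttachment a₁ b₁ K n₂) (hn' : n₂ ≠ p ∧ n₂ ≠ q) :
    G.Untied σ e₁ e₂ := by
  have hK := hc.arc_disjoint
  have hna : n₂ ≠ a₁ := by
    rintro rfl
    rcases hc.inter _ ha hn with h | h
    exacts [hn'.1 h, hn'.2 h]
  have hnb : n₂ ≠ b₁ := fun h => hnN.1 (h ▸ hb)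
  obtain ⟨P, F, s, hP, hPK⟩ := h.exists_path_to_attachment hb hnN.1 (by
    rcases hnN.2 with h | h | h
    exacts [absurd h hna, absurd h hnb, h])
  have i1 := hc.inter
  have i2 := hc.path_inter
  have i3 := hc.path_disjoint
  have i4 := hc.left_ne
  have i5 := hc.right_ne
  have R := (h.pair.link₁.pathOn (σ := σ) h.pair.ne₁).trans hP (by grind)
  exact untied_of_crossing hc.arc₁ hc.arc₂ hc.sign hc.inter hc.path hc.path_inter ha
    ⟨i4.1.symm, i5.1.symm⟩ hn hn' R (by grind) (by grind) h.pair.edge_ne (by simp) hc.edge_mem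

/-- A crossing chord through `e₁` is wanted. It is `e₁` itself if `K` is empty, and comes from the
previous lemma if only one end of `e₁` is in `K`. If both ends are in `K`, the only obstruction to
threading `e₁` through `K` is a vertex `w` cutting it off from the interior attachments; rerouting
the cycle through `K \ U` then exposes `e₁` and `e₂` in one component. -/
theorem IsChord.untied_of_crossing (h : G.IsFrame σ e₁ e₂ a₁ b₁ a₂ b₂ K)
    (hc : G.IsChord σ e₂ a₁ b₁ K p q S₁ F₁ s₁ S₂ F₂ s₂ T E r)
    (hN : ∀ x, G.IsAttachment a₁ b₁ K x → x ∈ S₁ ∨ x ∈ S₂)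
    (hn₁ : n₁ ∈ S₁) (hnN₁ : G.IsAttachment a₁ b₁ K n₁) (hn₁' : n₁ ≠ p ∧ n₁ ≠ q)
    (hn₂ : n₂ ∈ S₂) (hnN₂ : G.IsAttachment a₁ b₁ K n₂) (hn₂' : n₂ ≠ p ∧ n₂ ≠ q) :
    G.Untied σ e₁ e₂ := by
  have hK := hc.arc_disjoint
  have i1 := hc.inter
  have i2 := hc.path_inter
  have i3 := hc.path_disjoint
  have hn12 : n₁ ≠ n₂ := by grind
  rcases h.hook with rfl | hook
  · have hl : G.IsLink e₁ n₁ n₂ := by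
      have h1 := hnN₁.2
      have h2 := hnN₂.2
      simp only [Set.mem_empty_iff_false, false_and, exists_false, or_false] at h1 h2
      rcases h1 with rfl | rfl <;> rcases h2 with rfl | rfl
      exacts [absurd rfl hn12, h.pair.link₁, h.pair.link₁.symm, absurd rfl hn12]
    exact Graph.untied_of_crossing hc.arc₁ hc.arc₂ hc.sign hc.inter hc.path hc.path_inter hn₁ hn₁'
      hn₂ hn₂' (hl.pathOn hn12) (by grind) (by grind) h.pair.edge_ne rfl hc.edge_mem
  by_cases ha : a₁ ∈ K
  swap
  · have hb : b₁ ∈ K := hook.resolve_left ha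
    rcases hN a₁ ⟨ha, Or.inl rfl⟩ with h' | h'
    · exact hc.untied_of_end_notMem h h' hb hn₂ hnN₂ hn₂'
    · exact hc.swap.untied_of_end_notMem h h' hb hn₁ hnN₁ hn₁'
  by_cases hb : b₁ ∈ K
  swap
  · have hflip : ∀ n, G.IsAttachment a₁ b₁ K n → G.IsAttachment b₁ a₁ K n := fun n hn =>
      ⟨hn.1, by have := hn.2; tauto⟩
    rcases hN b₁ ⟨hb, Or.inr (Or.inl rfl)⟩ with h' | h'
    · exact hc.flip₁.untied_of_end_notMem h.flip₁ h' ha hn₂ (hflip _ hnN₂) hn₂'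
    · exact hc.flip₁.swap.untied_of_end_notMem h.flip₁ h' ha hn₁ (hflip _ hnN₁) hn₁'
  have adj : ∀ n, G.IsAttachment a₁ b₁ K n → ∃ k ∈ K, G.Adj k n := by
    rintro n ⟨hn, rfl | rfl | hk⟩
    exacts [absurd ha hn, absurd hb hn, hk]
  let Z : Set α := {x | x ∈ S₁ ∧ G.IsAttachment a₁ b₁ K x ∧ x ≠ p ∧ x ≠ q}
  let T' : Set α := {x | x ∈ S₂ ∧ G.IsAttachment a₁ b₁ K x ∧ x ≠ p ∧ x ≠ q}
  have hnZ : n₁ ∈ Z := ⟨hn₁, hnN₁, hn₁'⟩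
  have hnT : n₂ ∈ T' := ⟨hn₂, hnN₂, hn₂'⟩
  by_cases hsep : ∀ w ∈ K, ∀ U ⊆ K, w ∉ U → (a₁ ≠ w → a₁ ∈ U) → (b₁ ≠ w → b₁ ∈ U) →
      (∀ x ∈ U, ∀ y ∈ K, y ≠ w → G.Adj x y → y ∈ U) → ∃ x ∈ U, ∃ y, (y ∈ Z ∨ y ∈ T') ∧ G.Adj x y
  · obtain ⟨m₁, hm₁, m₂, hm₂, P, F, s, hP, heF, hPK⟩ := exists_pathOn_through (σ := σ) (S := K)
      (Z := Z) (T := T') h.finite h.pair.link₁ h.pair.ne₁ (Or.inl ha) (Or.inl hb)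
      (fun x hx h' => h'.2.1.1 hx) (fun x hx h' => h'.2.1.1 hx)
      (fun x hx h' => by
        rcases i1 x hx.1 h'.1 with h | h
        exacts [hx.2.2.1 h, hx.2.2.2 h]) (fun _ _ => hsep)
      (fun U hU haU _ _ _ hcl => by
        obtain ⟨k, hk, hkn⟩ := adj n₂ hnN₂
        exact ⟨k, h.conn U hU ⟨a₁, haU ha⟩ hcl hk, n₂, hnT, hkn⟩)
      (fun U hU haU _ _ _ hcl => by
        obtain ⟨k, hk, hkn⟩ := adj n₁ hnN₁
        exact ⟨k, h.conn U hU ⟨a₁, haU ha⟩ hcl hk, n₁, hnZ, hkn⟩)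
    obtain ⟨hm₁S, -, hm₁'⟩ := hm₁
    obtain ⟨hm₂S, -, hm₂'⟩ := hm₂
    exact Graph.untied_of_crossing hc.arc₁ hc.arc₂ hc.sign hc.inter hc.path hc.path_inter hm₁S hm₁'
      hm₂S hm₂' hP (by clear hsep adj hnZ hnT hN; grind) (fun z hz hzT => by
        by_cases h1 : z = m₁
        · have := i2 z hzT (Or.inl (h1 ▸ hm₁S)); grind
        by_cases h2 : z = m₂
        · have := i2 z hzT (Or.inr (h2 ▸ hm₂S)); grind
        exact i3 z hzT (hPK z hz h1 h2))
      h.pair.edge_ne heF hc.edge_mem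
  push Not at hsep
  obtain ⟨w, hwK, U, hUK, hwU, haU, hbU, hcl, hno⟩ := hsep
  -- A neighbour of `U` off `K` is an attachment, hence on the cycle, and by the choice of `U` it
  -- can only be `p` or `q`.
  have hnb : ∀ x ∈ U, ∀ y, y ∉ U → G.Adj x y → y = w ∨ y = p ∨ y = q := by
    intro x hx y hy hxy
    by_contra! hne
    by_cases hyK : y ∈ K
    · exact hy (hcl x hx y hyK hne.1 hxy)
    · have hyN : G.IsAttachment a₁ b₁ K y := ⟨hyK, Or.inr (Or.inr ⟨x, hUK hx, hxy⟩)⟩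
      exact hno x hx y ((hN y hyN).imp (fun h => ⟨h, hyN, hne.2⟩) fun h => ⟨h, hyN, hne.2⟩) hxy
  -- a path from `n₁` to `n₂` through `K \ U`
  obtain ⟨k₁, hk₁, hkn₁⟩ := adj n₁ hnN₁
  obtain ⟨k₂, hk₂, hkn₂⟩ := adj n₂ hnN₂
  have hk₁U : k₁ ∉ U := fun hk => hno k₁ hk n₁ (Or.inl hnZ) hkn₁
  have hk₂U : k₂ ∉ U := fun hk => hno k₂ hk n₂ (Or.inr hnT) hkn₂
  obtain ⟨_, rfl, _, rfl, P, F, s, hP, hPM, -, -⟩ := exists_pathOn (σ := σ) h.finite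
    (M := {x | x ∈ K \ U ∨ x = n₁ ∨ x = n₂}) (A := {n₁}) (B := {n₂})
    (by
      rintro x (hx | rfl | rfl)
      exacts [h.subset hx.1, hkn₁.right_mem, hkn₂.right_mem])
    (by rintro x rfl; exact Or.inr (Or.inl rfl)) (by
      intro U' hUM hAU hcl'
      have hk₁' : k₁ ∈ U' := hcl' n₁ (hAU rfl) k₁ (Or.inl ⟨hk₁, hk₁U⟩) hkn₁.symm
      -- Inside `K`, the sets `K \ U` and `U` are joined only through `w`, so connectedness forces
      -- `w` to be reached. Then the reached part of `K` together with `U` is closed, and contains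
      -- `k₂`.
      have hw : w ∈ U' := by
        by_contra hw
        have := h.conn (U' ∩ (K \ U)) (fun x hx => hx.2.1) ⟨k₁, hk₁', hk₁, hk₁U⟩ (by
          rintro x ⟨hxU', hxK, hxU⟩ y hyK hxy
          have hyU : y ∉ U := fun hyU => hxU (hcl y hyU x hxK (fun h => hw (h ▸ hxU')) hxy.symm)
          exact ⟨hcl' x hxU' y (Or.inl ⟨hyK, hyU⟩) hxy, hyK, hyU⟩)
        exact hw (this hwK).1
      have := h.conn ((U' ∩ K) ∪ U) (by rintro x (hx | hx); exacts [hx.2, hUK hx])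
        ⟨k₁, Or.inl ⟨hk₁', hk₁⟩⟩ (by
          rintro x hx y hyK hxy
          by_cases hyU : y ∈ U
          · exact Or.inr hyU
          by_cases hxU : x ∈ U
          · by_cases hyw : y = w
            · exact Or.inl ⟨hyw ▸ hw, hyK⟩
            · exact absurd (hcl x hxU y hyK hyw hxy) hyU
          · have hxU' : x ∈ U' := (hx.resolve_right hxU).1
            exact Or.inl ⟨hcl' x hxU' y (Or.inl ⟨hyK, hyU⟩) hxy, hyK⟩)
      have hk₂' : k₂ ∈ U' := ((this hk₂).resolve_right hk₂U).1
      exact ⟨n₂, rfl, hcl' k₂ hk₂' n₂ (Or.inr (Or.inr rfl)) hkn₂⟩)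
  obtain ⟨A, B, FA, FB, sa, sb, hA, hB, rfl, rfl, rfl, hAB⟩ := hc.arc₁.exists_split hn₁
  obtain ⟨A', B', FA', FB', sa', sb', hA', hB', rfl, rfl, rfl, hAB'⟩ := hc.arc₂.exists_split hn₂
  have m1 := hA.left_mem
  have m2 := hB.right_mem
  have m3 := hA'.left_mem
  have m4 := hB'.right_mem
  have m5 := hP.left_mem
  have m6 := hP.right_mem
  have m7 := hA.right_mem
  have m8 := hB.left_mem
  have m9 := hA'.right_mem
  have m10 := hB'.left_mem
  have sgn := hc.sign
  have hT := hc.path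
  have he₂ := hc.edge_mem
  have hfin := h.finite
  have h3 := h.triSep
  have hpair := h.pair
  have hUV : U ⊆ V(G) := hUK.trans h.subset
  have hpq := hc.ne
  simp only [Set.mem_union, Set.mem_sdiff] at *
  -- The new path `P` forms a cycle with each of the two `n₁`–`n₂` arcs, one through `q` and one
  -- through `p`. One cycle is negative; it misses the other of `p` and `q`, so `T` becomes a detour
  -- leaving that vertex.
  have pathq := hB.trans hA' (by grind)
  have pathp := hA.symm.trans hB'.symm (by grind)
  obtain ⟨Cq, Lq⟩ := CycleOn.of_paths_of_mem (z := q) hP pathq.symm hn12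
    (by simp only [Set.mem_union]; grind) (by simp [m2]) hn₁'.2.symm hn₂'.2.symm
  obtain ⟨Cp, Lp⟩ := CycleOn.of_paths_of_mem (z := p) hP pathp.symm hn12
    (by simp only [Set.mem_union]; grind) (by simp [m1]) hn₁'.1.symm hn₂'.1.symm
  have hprod : (s * (sb * sa')) * (s * (sa * sb')) = -1 := by
    have := Int.units_mul_self s
    calc (s * (sb * sa')) * (s * (sa * sb')) = (s * s) * (sa * sb * (sa' * sb')) := by ac_rfl
      _ = -1 := by rw [this, sgn]; rfl
  have hneg : s * (sb * sa') = -1 ∨ s * (sa * sb') = -1 := by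
    rcases Int.units_eq_one_or (s * (sb * sa')) with h' | h'
    · rw [h', one_mul] at hprod
      exact Or.inr hprod
    · exact Or.inl h'
  have hUK' : ∀ x ∈ U, x ∈ K := hUK
  clear adj hcl hno hnZ hnT hN hnN₁ hnN₂
  rcases hneg with hneg | hneg
  · rw [hneg] at Cq
    refine hpair.untied_of_detour hfin h3 Cq Lq hT he₂ ?_ ?_ hUV ?_ ?_ hwU haU hbU hnb <;>
      (try simp only [Set.mem_union]) <;> clear hnb <;> grind
  · rw [hneg] at Cp
    refine hpair.untied_of_detour hfin h3 Cp Lp hT.symm he₂ ?_ ?_ hUV ?_ ?_ hwU haU hbU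
      (fun x hx y hy hxy => (hnb x hx y hy hxy).imp_right Or.symm) <;>
      (try simp only [Set.mem_union]) <;> clear hnb <;> grind

end Chord

end Graph

namespace Graph

variable {α β : Type*} {G : Graph α β} {σ : β → ℤˣ} {u v x y z : α}
  {S S' C K : Set α} {F F' FC : Set β} {s s' : ℤˣ} {e f e₁ e₂ : β} {a b a₁ b₁ a₂ b₂ : α}

theorem IsWalk.exists_split_first {w : List (β × α)} {Q : α → Prop} (h : G.IsWalk u w v)
    (hx : ∃ x ∈ u :: w.map Prod.snd, Q x) :
    ∃ t w₁ w₂, w = w₁ ++ w₂ ∧ G.IsWalk u w₁ t ∧ G.IsWalk t w₂ v ∧ Q t ∧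
      ∀ z ∈ u :: w₁.map Prod.snd, Q z → z = t := by
  by_cases hu : Q u
  · exact ⟨u, [], w, rfl, ⟨h.start_mem, rfl⟩, h, hu, by simp⟩
  induction w generalizing u with
  | nil =>
    obtain ⟨x, hx, hQ⟩ := hx
    have hx : x = u := by simpa using hx
    exact absurd (hx ▸ hQ) hu
  | cons p w ih =>
    have hx' : ∃ x ∈ p.2 :: w.map Prod.snd, Q x := by
      obtain ⟨x, hx, hQ⟩ := hx
      rcases List.mem_cons.1 hx with rfl | hx
      · exact absurd hQ hu
      · exact ⟨x, hx, hQ⟩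
    by_cases hp : Q p.2
    · refine ⟨p.2, [p], w, rfl, ⟨h.1, h.1.right_mem, rfl⟩, h.2, hp, fun z hz hQ => ?_⟩
      rcases List.mem_cons.1 hz with rfl | hz
      · exact absurd hQ hu
      · simpa using hz
    · obtain ⟨t, w₁, w₂, rfl, h₁, h₂, hQt, hQ⟩ := ih h.2 hx' hp
      refine ⟨t, p :: w₁, w₂, rfl, ⟨h.1, h₁⟩, h₂, hQt, fun z hz hQz => ?_⟩
      rcases List.mem_cons.1 hz with rfl | hz
      · exact absurd hQz hu
      · exact hQ z hz hQz

/-- Split a path at its first vertex with a given property. -/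
theorem PathOn.exists_split_first {Q : α → Prop} (h : G.PathOn σ u v S F s)
    (hx : ∃ x ∈ S, Q x) :
    ∃ t S₁ S₂ F₁ F₂ s₁ s₂, G.PathOn σ u t S₁ F₁ s₁ ∧ G.PathOn σ t v S₂ F₂ s₂ ∧ S = S₁ ∪ S₂ ∧
      F = F₁ ∪ F₂ ∧ s = s₁ * s₂ ∧ (∀ z ∈ S₁, z ∈ S₂ → z = t) ∧ Q t ∧ ∀ z ∈ S₁, Q z → z = t := by
  obtain ⟨w, h, hw, rfl, rfl, rfl⟩ := h
  obtain ⟨t, w₁, w₂, rfl, h₁, h₂, hQt, hQ⟩ := h.exists_split_first hx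
  rw [List.map_append, ← List.cons_append, List.nodup_append] at hw
  obtain ⟨hw₁, hw₂, hd⟩ := hw
  refine ⟨t, _, _, _, _, _, _, ⟨w₁, h₁, hw₁, rfl, rfl, rfl⟩, ⟨w₂, h₂, List.nodup_cons.2
    ⟨fun hx' => hd t h₁.end_mem t hx' rfl, hw₂⟩, rfl, rfl, rfl⟩, ?_, ?_, walkSign_append, ?_, hQt,
    hQ⟩
  · ext z
    have : z = t → z = u ∨ z ∈ w₁.map Prod.snd := fun hz => by
      subst hz; simpa using h₁.end_mem
    simp only [Set.mem_union, Set.mem_ofPred_eq, List.mem_cons, List.map_append, List.mem_append]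
    tauto
  · ext z
    simp
  · intro z hz₁ hz₂
    rcases List.mem_cons.1 hz₂ with rfl | hz₂
    · rfl
    · exact absurd rfl (hd z hz₁ z hz₂)

theorem eq_neg_one_or {t₁ t₂ : ℤˣ} (h : t₁ * t₂ = -1) : t₁ = -1 ∨ t₂ = -1 := by
  rcases Int.units_eq_one_or t₁ with h' | h'
  · rw [h', one_mul] at h
    exact Or.inr h
  · exact Or.inl h'

/-! ### Attachments and chords -/

/-- Otherwise `p` and `q` would separate `K` from a third vertex of the good cycle. -/
theorem IsFrame.exists_attachment (h : G.IsFrame σ e₁ e₂ a₁ b₁ a₂ b₂ K)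
    (hC : G.IsGood σ e₁ e₂ K C F) (hK : K.Nonempty) {p q : α} (hp : p ∉ K) (hq : q ∉ K) :
    ∃ n, G.IsAttachment a₁ b₁ K n ∧ n ≠ p ∧ n ≠ q := by
  obtain ⟨c, hc, hcp, hcq⟩ := hC.long p q
  obtain ⟨k, hk, n, hn, hnp, hnq, hkn⟩ := h.triSep K h.subset p q hK hp hq
    ⟨c, hC.cycle.subset hc, hC.disjoint c hc, hcp, hcq⟩
  exact ⟨n, ⟨hn, Or.inr (Or.inr ⟨k, hk, hkn⟩)⟩, hnp, hnq⟩

/-- Menger's theorem is applied outside `K` and `b₁`, from the ends of `e₂` to `C`. Deleting `K`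
costs nothing: a vertex outside `K` with a neighbour in `K` is an attachment and already lies on
`C`. Deleting `b₁` keeps the ends of the chord away from `e₁`, even when `b₁` is on `C`. -/
theorem IsFrame.exists_chord_of_mem (h : G.IsFrame σ e₁ e₂ a₁ b₁ a₂ b₂ K)
    (hC : G.IsGood σ e₁ e₂ K C F) (ha : a₁ ∈ K) :
    ∃ p q S₁ F₁ s₁ S₂ F₂ s₂ T E r, G.IsChord σ e₂ a₁ b₁ K p q S₁ F₁ s₁ S₂ F₂ s₂ T E r ∧
      C = S₁ ∪ S₂ ∧ F = F₁ ∪ F₂ := by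
  have hatt := h.attachment_mem C F hC
  have hKC := hC.disjoint
  have hpair := h.pair
  obtain ⟨p, q, P, E, s, hP, hp, hq, hPM, hPp, hPq, hPP⟩ := exists_disjoint_pathsOn (σ := σ) h.finite
    (M := {x | x ∈ V(G) ∧ x ∉ K ∧ x ≠ b₁}) (A := {a₂, b₂}) (B := C) (fun x hx => hx.1) (by
      rintro x (rfl | rfl)
      exacts [⟨hpair.link₂.left_mem, h.left_notMem, hpair.ne_ba.symm⟩,
        ⟨hpair.link₂.right_mem, h.right_notMem, hpair.ne_bb.symm⟩]) 2 (by
      intro X hX U hUM hUX hAU hcl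
      by_contra! hno
      have hXe : ∀ x ∈ X, ∀ y ∈ X, x = y := fun x hx y hy =>
        Finset.card_le_one.1 (by omega) x hx y hy
      obtain ⟨w, hw, hwU⟩ : ∃ w, (∀ x ∈ X, x = w) ∧ w ∉ U := by
        by_cases hX' : X.Nonempty
        · obtain ⟨w, hw⟩ := hX'
          exact ⟨w, fun x hx => hXe x hx w hw, fun h => hUX w h hw⟩
        · rw [Finset.not_nonempty_iff_eq_empty] at hX'
          subst hX'
          exact ⟨b₁, by simp, fun h => (hUM h).2.2 rfl⟩
      have hUne : U.Nonempty := by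
        by_cases haX : a₂ ∈ X
        · exact ⟨b₂, hAU b₂ (by simp) fun hbX => hpair.ne₂ (hXe _ haX _ hbX)⟩
        · exact ⟨a₂, hAU a₂ (by simp) haX⟩
      obtain ⟨c, hc, hcw, hcb⟩ := hC.long w b₁
      obtain ⟨x, hx, y, hy, hyw, hyb, hxy⟩ := h.triSep U (fun x hx => (hUM hx).1) w b₁ hUne hwU
        (fun h => (hUM h).2.2 rfl) ⟨c, hC.cycle.subset hc, hno c hc, hcw, hcb⟩
      by_cases hyK : y ∈ K
      · exact hno x (hatt x ⟨(hUM hx).2.1, Or.inr (Or.inr ⟨y, hyK, hxy.symm⟩)⟩) hx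
      · exact hy (hcl x hx y ⟨hxy.right_mem, hyK, hyb⟩ (fun h => hyw (hw y h)) hxy))
  have h01 : (0 : Fin 2) ≠ 1 := by decide
  have hd : ∀ x ∈ P 0, x ∉ P 1 := fun x h h' => h01 (hPP 0 1 x h h')
  have hp0 := hp 0
  have hp1 := hp 1
  simp only [Set.mem_insert_iff, Set.mem_singleton_iff] at hp0 hp1
  have m1 := (hP 0).left_mem
  have m2 := (hP 1).left_mem
  have m3 := (hP 0).right_mem
  have m4 := (hP 1).right_mem
  have hpne : p 0 ≠ p 1 := fun h => hd _ m1 (h ▸ m2)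
  have hqne : q 0 ≠ q 1 := fun h => hd _ m3 (h ▸ m4)
  have hl : G.IsLink e₂ (p 0) (p 1) := by
    rcases hp0 with h | h <;> rcases hp1 with h' | h' <;> rw [h, h'] at hpne ⊢
    exacts [absurd rfl hpne, hpair.link₂, hpair.link₂.symm, absurd rfl hpne]
  have T₁ := (hP 0).symm.trans (hl.pathOn hpne) (by grind)
  have T := T₁.trans (hP 1) (by simp only [Set.mem_union]; grind)
  have hTP : ∀ z, z ∈ P 0 ∪ {p 0, p 1} ∪ P 1 → z ∈ P 0 ∨ z ∈ P 1 := by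
    simp only [Set.mem_union]; grind
  obtain ⟨S₁, S₂, F₁, F₂, s₁, s₂, hS₁, hS₂, rfl, rfl, hs, hi, -⟩ :=
    hC.cycle.exists_paths (hq 0) (hq 1) hqne
  have hne : ∀ i, q i ≠ a₁ ∧ q i ≠ b₁ := fun i =>
    ⟨fun h' => hKC _ (hq i) (h' ▸ ha), (hPM i (hP i).right_mem).2.2⟩
  refine ⟨q 0, q 1, S₁, F₁, s₁, S₂, F₂, s₂, _, _, _, ⟨hS₁, hS₂, hqne, hs.symm, hi, T, by simp,
    fun z hz hzC => ?_, fun z hz => ?_, fun z hz => hKC z hz, hne 0, hne 1⟩, rfl, rfl⟩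
  · exact (hTP z hz).imp (fun h => hPq 0 z h hzC) (fun h => hPq 1 z h hzC)
  · rcases hTP z hz with h | h
    exacts [(hPM 0 h).2.1, (hPM 1 h).2.1]

/-- For empty `K` the ends of `e₂` are on the cycle and `e₂` alone is the chord. The last clause
records this, to rule out later a connecting path that starts inside the chord. -/
theorem IsFrame.exists_chord (h : G.IsFrame σ e₁ e₂ a₁ b₁ a₂ b₂ K)
    (hC : G.IsGood σ e₁ e₂ K C F) :
    ∃ p q S₁ F₁ s₁ S₂ F₂ s₂ T E r, G.IsChord σ e₂ a₁ b₁ K p q S₁ F₁ s₁ S₂ F₂ s₂ T E r ∧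
      C = S₁ ∪ S₂ ∧ F = F₁ ∪ F₂ ∧ (K = ∅ → T ⊆ {p, q}) := by
  rcases h.hook with hK | ha | hb
  · obtain ⟨ha, hb⟩ := h.mem_of_empty hK C F hC
    have hp := h.pair
    obtain ⟨S₁, S₂, F₁, F₂, s₁, s₂, hS₁, hS₂, rfl, rfl, hs, hi, -⟩ :=
      hC.cycle.exists_paths ha hb hp.ne₂
    exact ⟨a₂, b₂, S₁, F₁, s₁, S₂, F₂, s₂, _, _, _, ⟨hS₁, hS₂, hp.ne₂, hs.symm, hi,
      hp.link₂.pathOn hp.ne₂, rfl, fun z hz _ => hz, by simp [hK], by simp [hK],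
      ⟨hp.ne_aa.symm, hp.ne_ba.symm⟩, ⟨hp.ne_ab.symm, hp.ne_bb.symm⟩⟩, rfl, rfl,
      fun _ => subset_rfl⟩
  · obtain ⟨p, q, S₁, F₁, s₁, S₂, F₂, s₂, T, E, r, hc, hC, hF⟩ := h.exists_chord_of_mem hC ha
    exact ⟨p, q, S₁, F₁, s₁, S₂, F₂, s₂, T, E, r, hc, hC, hF, fun h => absurd ha (by simp [h])⟩
  · obtain ⟨p, q, S₁, F₁, s₁, S₂, F₂, s₂, T, E, r, hc, hC, hF⟩ := h.flip₁.exists_chord_of_mem hC hb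
    exact ⟨p, q, S₁, F₁, s₁, S₂, F₂, s₂, T, E, r, hc.flip₁, hC, hF,
      fun h => absurd hb (by simp [h])⟩

/-- No ear of a good cycle separates two attachments. -/
theorem IsFrame.false_of_ear (h : G.IsFrame σ e₁ e₂ a₁ b₁ a₂ b₂ K) {t₁ t₂ : α} {D₁ D₂ W : Set α}
    {F₁ F₂ FW : Set β} {d₁ d₂ w : ℤˣ} (hD₁ : G.PathOn σ x y D₁ F₁ d₁)
    (hD₂ : G.PathOn σ y x D₂ F₂ d₂) (hs : d₁ * d₂ = -1) (hxy : x ≠ y)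
    (hD : ∀ z ∈ D₁, z ∈ D₂ → z = x ∨ z = y) (hW : G.PathOn σ x y W FW w)
    (hWD : ∀ z ∈ W, z ∈ D₁ ∨ z ∈ D₂ → z = x ∨ z = y)
    (hK : ∀ z, z ∈ W ∨ z ∈ D₁ ∨ z ∈ D₂ → z ∉ K)
    (he₁ : e₁ ∉ F₁ ∧ e₁ ∉ F₂ ∧ e₁ ∉ FW) (he₂ : e₂ ∉ F₁ ∧ e₂ ∉ F₂ ∧ e₂ ∉ FW)
    (ht₁ : t₁ ∈ D₁) (hN₁ : G.IsAttachment a₁ b₁ K t₁) (hx₁ : t₁ ≠ x ∧ t₁ ≠ y)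
    (ht₂ : t₂ ∈ D₂) (hN₂ : G.IsAttachment a₁ b₁ K t₂) (hx₂ : t₂ ≠ x ∧ t₂ ≠ y) : False := by
  obtain ⟨C₁, L₁⟩ := CycleOn.of_paths_of_mem (z := t₁) hW hD₁.symm hxy
    (fun z h h' => hWD z h (Or.inl h')) (Or.inr ht₁) hx₁.1 hx₁.2
  obtain ⟨C₂, L₂⟩ := CycleOn.of_paths_of_mem (z := t₂) hW hD₂ hxy
    (fun z h h' => hWD z h (Or.inr h')) (Or.inr ht₂) hx₂.1 hx₂.2
  -- One of the two cycles through the ear is negative, yet each misses one of the attachments `t₁`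
  -- and `t₂`.
  have hprod : (w * d₁) * (w * d₂) = -1 := by
    rw [mul_mul_mul_comm, hs, Int.units_mul_self, one_mul]
  rcases eq_neg_one_or hprod with h' | h'
  · rw [h'] at C₁
    have := h.attachment_mem _ _ ⟨C₁, L₁, by simp [he₁], by simp [he₂], fun z hz =>
      hK z (hz.imp_right Or.inl)⟩ t₂ hN₂
    simp only [Set.mem_union] at this
    grind
  · rw [h'] at C₂
    have := h.attachment_mem _ _ ⟨C₂, L₂, by simp [he₁], by simp [he₂], fun z hz =>
      hK z (hz.imp_right Or.inr)⟩ t₁ hN₁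
    simp only [Set.mem_union] at this
    grind

end Graph

/-! ### Rerouting a cycle through an ear that starts on the chord -/

namespace Graph

variable {α β : Type*} {G : Graph α β} {σ : β → ℤˣ} {u v x y z : α}
  {S S' C K : Set α} {F F' FC : Set β} {s s' : ℤˣ} {e f e₁ e₂ : β} {a b a₁ b₁ a₂ b₂ : α}

/-- The negative cycle `A₁ A₂ A₃ A₄ S₂` with the chord `T₁ T₂` through `e₂`, where `e₂` is in `T₂`,
and a path `W` from the chord to the cycle. -/
theorem IsFrame.untied_of_ear (h : G.IsFrame σ e₁ e₂ a₁ b₁ a₂ b₂ K) (hK : K.Nonempty)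
    {p q t₁ t₂ : α} {A₁ A₂ A₃ A₄ S₂ T₁ T₂ W : Set α} {F₁ F₂ F₃ F₄ FS E₁ E₂ FW : Set β}
    {r₁ r₂ r₃ r₄ rs c₁ c₂ w : ℤˣ}
    (h₁ : G.PathOn σ p t₁ A₁ F₁ r₁) (h₂ : G.PathOn σ t₁ y A₂ F₂ r₂)
    (h₃ : G.PathOn σ y t₂ A₃ F₃ r₃) (h₄ : G.PathOn σ t₂ q A₄ F₄ r₄)
    (hS : G.PathOn σ q p S₂ FS rs) (hT₁ : G.PathOn σ p x T₁ E₁ c₁) (hT₂ : G.PathOn σ x q T₂ E₂ c₂)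
    (hW : G.PathOn σ x y W FW w) (hs : r₁ * r₂ * r₃ * r₄ * rs = -1)
    (i12 : ∀ z ∈ A₁, z ∈ A₂ → z = t₁) (i13 : ∀ z ∈ A₁, z ∉ A₃) (i14 : ∀ z ∈ A₁, z ∉ A₄)
    (i23 : ∀ z ∈ A₂, z ∈ A₃ → z = y) (i24 : ∀ z ∈ A₂, z ∉ A₄)
    (i34 : ∀ z ∈ A₃, z ∈ A₄ → z = t₂)
    (iS : ∀ z ∈ S₂, z ∈ A₁ ∨ z ∈ A₂ ∨ z ∈ A₃ ∨ z ∈ A₄ → z = p ∨ z = q)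
    (iT : ∀ z, z ∈ T₁ ∨ z ∈ T₂ → z ∈ A₁ ∨ z ∈ A₂ ∨ z ∈ A₃ ∨ z ∈ A₄ ∨ z ∈ S₂ → z = p ∨ z = q)
    (iTT : ∀ z ∈ T₁, z ∈ T₂ → z = x)
    (iW : ∀ z ∈ W, z ∈ A₁ ∨ z ∈ A₂ ∨ z ∈ A₃ ∨ z ∈ A₄ ∨ z ∈ S₂ → z = y)
    (iWT : ∀ z ∈ W, z ∈ T₁ ∨ z ∈ T₂ → z = x)
    (hxC : x ∉ A₁ ∧ x ∉ A₂ ∧ x ∉ A₃ ∧ x ∉ A₄ ∧ x ∉ S₂) (hyt : y ≠ t₁ ∧ y ≠ t₂) (hpq : p ≠ q)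
    (hdis : ∀ z, z ∈ A₁ ∨ z ∈ A₂ ∨ z ∈ A₃ ∨ z ∈ A₄ ∨ z ∈ S₂ ∨ z ∈ T₁ ∨ z ∈ T₂ ∨ z ∈ W → z ∉ K)
    (he₁ : e₁ ∉ F₁ ∧ e₁ ∉ F₂ ∧ e₁ ∉ F₃ ∧ e₁ ∉ F₄ ∧ e₁ ∉ FS ∧ e₁ ∉ E₁ ∧ e₁ ∉ FW)
    (he₂ : e₂ ∉ F₁ ∧ e₂ ∉ F₂ ∧ e₂ ∉ F₃ ∧ e₂ ∉ F₄ ∧ e₂ ∉ FS ∧ e₂ ∉ E₁ ∧ e₂ ∉ FW)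
    (heE : e₂ ∈ E₂) (hqn : q ≠ a₁ ∧ q ≠ b₁)
    (hN : ∀ n, G.IsAttachment a₁ b₁ K n → n ∈ A₁ ∨ n ∈ A₂ ∨ n ∈ A₃ ∨ n ∈ A₄)
    (hN₁ : G.IsAttachment a₁ b₁ K t₁) (hN₂ : G.IsAttachment a₁ b₁ K t₂) : G.Untied σ e₁ e₂ := by
  have k1 := h₁.left_mem
  have k2 := h₁.right_mem
  have k3 := h₂.left_mem
  have k4 := h₂.right_mem
  have k5 := h₃.left_mem
  have k6 := h₃.right_mem
  have k7 := h₄.left_mem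
  have k8 := h₄.right_mem
  have k9 := hS.left_mem
  have k10 := hS.right_mem
  have k11 := hT₁.left_mem
  have k12 := hT₁.right_mem
  have k13 := hT₂.left_mem
  have k14 := hT₂.right_mem
  have k15 := hW.left_mem
  have k16 := hW.right_mem
  have hxK : x ∉ K := hdis x (by simp [k12])
  have hxN : ¬ G.IsAttachment a₁ b₁ K x := fun h' => by
    rcases hN x h' with h | h | h | h
    exacts [hxC.1 h, hxC.2.1 h, hxC.2.2.1 h, hxC.2.2.2.1 h]
  have hxa : x ≠ a₁ := fun h' => hxN ⟨hxK, Or.inl h'⟩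
  have hxb : x ≠ b₁ := fun h' => hxN ⟨hxK, Or.inr (Or.inl h')⟩
  have hqT : q ∉ T₁ := fun h' => by have := iTT q h' k14; grind
  have hpT : p ∉ T₂ := fun h' => by have := iTT p k11 h'; grind
  -- the cycle that misses `t₂` is positive
  have P₁ := hW.trans h₂.symm (by grind)
  have P₂ := P₁.trans h₁.symm (by simp only [Set.mem_union]; grind)
  obtain ⟨Z, LZ⟩ := CycleOn.of_paths_of_mem (z := y) P₂ hT₁ (by grind)
    (by simp only [Set.mem_union]; grind) (by simp [k4]) (by grind) (by grind)
  have hZ : w * r₂ * r₁ * c₁ = 1 := by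
    refine (Int.units_eq_one_or _).resolve_right fun hneg => ?_
    rw [hneg] at Z
    have := h.attachment_mem _ _ ⟨Z, LZ, by simp [he₁], by simp [he₂], fun z hz => hdis z (by
      rcases hz with ((hz | hz) | hz) | hz <;> simp [hz])⟩ t₂ hN₂
    simp only [Set.mem_union] at this
    grind
  have Q₁ := hW.trans h₃ (by grind)
  have Q₂ := Q₁.trans h₄ (by simp only [Set.mem_union]; grind)
  have Q₃ := hS.trans hT₁ (by grind)
  obtain ⟨D, LD⟩ := CycleOn.of_paths_of_mem (z := y) Q₂ Q₃ (by grind)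
    (by simp only [Set.mem_union]; grind) (by simp [k5]) (by grind) (by grind)
  -- This cycle is the symmetric difference of the original negative cycle and the positive one just
  -- found.
  have hneg : w * r₃ * r₄ * (rs * c₁) = -1 := by
    have e1 := Int.units_mul_self r₁
    have e2 := Int.units_mul_self r₂
    calc w * r₃ * r₄ * (rs * c₁) = (r₁ * r₁) * (r₂ * r₂) * (w * r₃ * r₄ * (rs * c₁)) := by
          rw [e1, e2, one_mul, one_mul]
      _ = (w * r₂ * r₁ * c₁) * (r₁ * r₂ * r₃ * r₄ * rs) := by ac_rfl
      _ = -1 := by rw [hZ, hs, one_mul]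
  have D' := D
  rw [hneg] at D'
  have hgood : G.IsGood σ e₁ e₂ K _ _ := ⟨D', LD, by simp [he₁], by simp [he₂], fun z hz =>
    hdis z (by rcases hz with ((hz | hz) | hz) | hz | hz <;> simp [hz])⟩
  have hmem := h.attachment_mem _ _ hgood
  have ht₁ := hmem t₁ hN₁
  simp only [Set.mem_union] at ht₁
  -- The new cycle must contain the attachment `t₁`, but it meets the old part `A₁` only in `p`.
  have htp : t₁ = p := by
    clear hmem hdis hN
    grind
  obtain ⟨n, hn, hnp, hnq⟩ := h.exists_attachment hgood hK (hdis p (by simp [k1]))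
    (hdis q (by simp [k8]))
  have hnD := hmem n hn
  have hnA := hN n hn
  simp only [Set.mem_union] at hnD
  -- The rest `T₂` of the old chord is a chord of the new cycle. The attachment `p = t₁` is strictly
  -- inside one arc, and `n` strictly inside the other.
  have hchord : G.IsChord σ e₂ a₁ b₁ K x q (W ∪ A₃ ∪ A₄) (FW ∪ F₃ ∪ F₄) (w * r₃ * r₄)
      (S₂ ∪ T₁) (FS ∪ E₁) (rs * c₁) T₂ E₂ c₂ := by
    refine ⟨Q₂, Q₃, by grind, hneg, ?_, hT₂, heE, ?_, ?_, ?_, ⟨hxa, hxb⟩, hqn⟩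
    · simp only [Set.mem_union]
      clear hmem hdis hN
      grind
    · simp only [Set.mem_union]
      clear hmem hdis hN
      grind
    · exact fun z hz => hdis z (by simp [hz])
    · exact fun z hz => hdis z (by rcases hz with ((hz | hz) | hz) | hz | hz <;> simp [hz])
  refine hchord.untied_of_crossing h (n₁ := n) (n₂ := p) hmem ?_ hn ⟨?_, hnq⟩ (by simp [k10])
    (htp ▸ hN₁) ⟨?_, hpq⟩
  · simp only [Set.mem_union]
    clear hmem hdis hN
    grind
  · clear hmem hdis hN
    grind
  · rintro rfl
    exact hxC.1 k1

end Graph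

/-! ### All attachments on one arc -/

namespace Graph

variable {α β : Type*} {G : Graph α β} {σ : β → ℤˣ} {u v x y z : α}
  {S S' C K : Set α} {F F' FC : Set β} {s s' : ℤˣ} {e f e₁ e₂ : β} {a b a₁ b₁ a₂ b₂ : α}

/-- The first and the last attachment on an arc that contains all attachments. -/
theorem IsFrame.exists_extreme_attachments (h : G.IsFrame σ e₁ e₂ a₁ b₁ a₂ b₂ K)
    (hC : G.IsGood σ e₁ e₂ K C F) {p q : α} {S₁ : Set α} {F₁ : Set β} {s₁ : ℤˣ}
    (hS : G.PathOn σ p q S₁ F₁ s₁) (hN : ∀ x, G.IsAttachment a₁ b₁ K x → x ∈ S₁) :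
    ∃ t₁ t₂ A B D FA FB FD ra rb rd, G.PathOn σ p t₁ A FA ra ∧ G.PathOn σ t₁ t₂ B FB rb ∧
      G.PathOn σ t₂ q D FD rd ∧ t₁ ≠ t₂ ∧ G.IsAttachment a₁ b₁ K t₁ ∧
      G.IsAttachment a₁ b₁ K t₂ ∧ S₁ = A ∪ B ∪ D ∧ F₁ = FA ∪ FB ∪ FD ∧ s₁ = ra * rb * rd ∧
      (∀ z ∈ A, z ∈ B → z = t₁) ∧ (∀ z ∈ B, z ∈ D → z = t₂) ∧ (∀ z ∈ A, z ∉ D) ∧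
      (∀ z ∈ A, G.IsAttachment a₁ b₁ K z → z = t₁) ∧
      ∀ z ∈ D, G.IsAttachment a₁ b₁ K z → z = t₂ := by
  have two : ∀ t, G.IsAttachment a₁ b₁ K t → ∃ n, G.IsAttachment a₁ b₁ K n ∧ n ≠ t := by
    intro t ht
    rcases K.eq_empty_or_nonempty with rfl | hK
    · by_cases hta : t = a₁
      · exact ⟨b₁, ⟨by simp, by simp⟩, fun h' => h.pair.ne₁ (hta.symm.trans h'.symm)⟩
      · exact ⟨a₁, ⟨by simp, by simp⟩, fun h' => hta h'.symm⟩
    · obtain ⟨n, hn, hnt, -⟩ := h.exists_attachment hC hK ht.1 ht.1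
      exact ⟨n, hn, hnt⟩
  have one : ∃ n, G.IsAttachment a₁ b₁ K n := by
    by_cases hK : K.Nonempty
    · obtain ⟨c, hc⟩ := hC.cycle.nonempty
      obtain ⟨n, hn, -⟩ := h.exists_attachment hC hK (hC.disjoint c hc) (hC.disjoint c hc)
      exact ⟨n, hn⟩
    · exact ⟨a₁, fun h' => hK ⟨_, h'⟩, Or.inl rfl⟩
  obtain ⟨n, hn⟩ := one
  obtain ⟨t₁, A, R, FA, FR, ra, rr, hA, hR, rfl, rfl, rfl, hAR, ht₁, hA₁⟩ :=
    hS.exists_split_first (Q := G.IsAttachment a₁ b₁ K) ⟨n, hN n hn, hn⟩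
  obtain ⟨n', hn', hne⟩ := two t₁ ht₁
  have hn'R : n' ∈ R := (hN n' hn').resolve_left fun h' => hne (hA₁ n' h' hn')
  -- The remainder is searched backwards from `q`. Excluding `t₁` from the search makes the two
  -- extreme attachments distinct.
  obtain ⟨t₂, D, B, FD, FB, rd, rb, hD, hB, rfl, rfl, rfl, hDB, ⟨ht₂, ht⟩, hD₂⟩ :=
    hR.symm.exists_split_first (Q := fun z => G.IsAttachment a₁ b₁ K z ∧ z ≠ t₁)
      ⟨n', hn'R, hn', hne⟩
  have htB : t₁ ∈ B := hB.right_mem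
  have htD : t₁ ∉ D := fun h' => ht (hDB t₁ h' htB).symm
  refine ⟨t₁, t₂, A, B, D, FA, FB, FD, ra, rb, rd, hA, hB.symm, hD.symm, ht.symm, ht₁, ht₂, ?_, ?_,
    by rw [mul_assoc, mul_comm rd], fun z hz hz' => hAR z hz (Or.inr hz'),
    fun z hz hz' => hDB z hz' hz, fun z hz hz' => ?_, hA₁, fun z hz hz' => ?_⟩
  · rw [Set.union_assoc, Set.union_comm D]
  · rw [Set.union_assoc, Set.union_comm FD]
  · exact htD (hAR z hz (Or.inl hz') ▸ hz')
  · exact hD₂ z hz ⟨hz', fun h' => htD (h' ▸ hz)⟩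

set_option maxHeartbeats 1000000 in
/-- All attachments are in one of the two arcs. -/
theorem IsChord.untied_of_arc (h : G.IsFrame σ e₁ e₂ a₁ b₁ a₂ b₂ K) {p q : α} {S₁ S₂ T : Set α}
    {F₁ F₂ E : Set β} {s₁ s₂ r : ℤˣ}
    (hc : G.IsChord σ e₂ a₁ b₁ K p q S₁ F₁ s₁ S₂ F₂ s₂ T E r)
    (hC : G.IsGood σ e₁ e₂ K (S₁ ∪ S₂) (F₁ ∪ F₂)) (hT : K = ∅ → T ⊆ {p, q})
    (hN : ∀ x, G.IsAttachment a₁ b₁ K x → x ∈ S₁) : G.Untied σ e₁ e₂ := by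
  obtain ⟨t₁, t₂, A, B, D, FA, FB, FD, ra, rb, rd, hA, hB, hD, ht, ht₁, ht₂, rfl, rfl, rfl, iAB, iBD,
    iAD, hAN, hDN⟩ := h.exists_extreme_attachments hC hc.arc₁ hN
  have hpair := h.pair
  obtain ⟨hE₁, hE₂⟩ := hc.path.mem_of_isLink hc.edge_mem hpair.link₂
  have hS := hc.arc₂
  have hpq := hc.ne
  have hs := hc.sign
  have i1 := hc.inter
  have i2 := hc.path_inter
  have i3 := hc.path_disjoint
  have i4 := hc.arc_disjoint
  have hPT := hc.path
  have heE := hc.edge_mem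
  have hl := hc.left_ne
  have hr := hc.right_ne
  have hg₁ := hC.notMem₁
  have hg₂ := hC.notMem₂
  clear hc
  have m1 := hA.left_mem
  have m2 := hA.right_mem
  have m3 := hB.left_mem
  have m4 := hB.right_mem
  have m5 := hD.left_mem
  have m6 := hD.right_mem
  have m7 := hS.left_mem
  have m8 := hS.right_mem
  have m9 := hPT.left_mem
  have m10 := hPT.right_mem
  simp only [Set.mem_union, not_or] at i1 i2 i4 hg₁ hg₂ hN
  -- `X` is the outside of the stretch `B`, including the chord, and `Y` is its interior; both omit
  -- `t₁` and `t₂`, which therefore cannot separate them.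
  let X : Set α := {z | (z ∈ A ∨ z ∈ D ∨ z ∈ S₂ ∨ z ∈ T) ∧ z ≠ t₁ ∧ z ≠ t₂}
  let Y : Set α := {z | z ∈ B ∧ z ≠ t₁ ∧ z ≠ t₂}
  -- Otherwise the arc `S₂` is one edge with the same ends as `e₂`, which has no parallel edge.
  have hXne : X.Nonempty := by
    by_contra hX
    have hX' : ∀ z, (z ∈ A ∨ z ∈ D ∨ z ∈ S₂ ∨ z ∈ T) → z = t₁ ∨ z = t₂ := by
      intro z hz
      by_contra! hz'
      exact hX ⟨z, hz, hz'⟩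
    have hp : p = t₁ := (hX' p (by simp [m1])).resolve_right fun h' => iAD p m1 (h' ▸ m5)
    have hq : q = t₂ := (hX' q (by simp [m6])).resolve_left fun h' => iAD _ m2 (h' ▸ m6)
    obtain ⟨f, rfl, hf⟩ := hS.exists_isLink_of_subset hpq.symm (by
      intro z hz
      rw [hp, hq]
      exact (hX' z (by simp [hz])).symm)
    have e1 := hX' a₂ (by simp [hE₁])
    have e2 := hX' b₂ (by simp [hE₂])
    have hf' : G.IsLink f a₂ b₂ := by
      rw [hp, hq] at hf
      rcases e1 with e1 | e1 <;> rcases e2 with e2 | e2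
      · exact absurd (e1.trans e2.symm) hpair.ne₂
      · rw [e1, e2]; exact hf.symm
      · rw [e1, e2]; exact hf
      · exact absurd (e1.trans e2.symm) hpair.ne₂
    exact hg₂.2 (hpair.unique₂ f hf').symm
  -- Otherwise `B` is one edge parallel to `e₁`. For nonempty `K` this is not needed, as a vertex of
  -- `K` provides the far side of the separation.
  have hYne : K = ∅ → Y.Nonempty := by
    intro hK
    by_contra hY
    have hY' : ∀ z ∈ B, z = t₁ ∨ z = t₂ := by
      intro z hz
      by_contra! hz'
      exact hY ⟨z, hz, hz'⟩
    obtain ⟨f, rfl, hf⟩ := hB.exists_isLink_of_subset ht hY'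
    have h1 := ht₁.2
    have h2 := ht₂.2
    simp only [hK, Set.mem_empty_iff_false, false_and, exists_false, or_false] at h1 h2
    have hf' : G.IsLink f a₁ b₁ := by
      rcases h1 with e1 | e1 <;> rcases h2 with e2 | e2
      · exact absurd (e1.trans e2.symm) ht
      · rw [← e1, ← e2]; exact hf
      · rw [← e1, ← e2]; exact hf.symm
      · exact absurd (e1.trans e2.symm) ht
    exact hg₁.1.1.2 (hpair.unique₁ f hf').symm
  have hNB : ∀ z, G.IsAttachment a₁ b₁ K z → z ≠ t₁ → z ≠ t₂ → z ∈ B := by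
    intro z hz h1 h2
    rcases hN z hz with (h' | h') | h'
    exacts [absurd (hAN z h' hz) h1, h', absurd (hDN z h' hz) h2]
  obtain ⟨x, ⟨hx, hxt⟩, y, ⟨hyB, hyt⟩, W, FW, w, hW, hWM, hWX, hWY⟩ := exists_pathOn (σ := σ)
    h.finite (M := {z | z ∈ V(G) ∧ z ∉ K ∧ z ≠ t₁ ∧ z ≠ t₂}) (A := X) (B := Y) (fun z hz => hz.1)
    (by
      rintro z ⟨hz | hz | hz | hz, hz'⟩
      · exact ⟨hA.subset hz, i4 z (by simp [hz]), hz'⟩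
      · exact ⟨hD.subset hz, i4 z (by simp [hz]), hz'⟩
      · exact ⟨hS.subset hz, i4 z (by simp [hz]), hz'⟩
      · exact ⟨hPT.subset hz, i3 z hz, hz'⟩) (by
      intro U hUM hXU hcl
      by_contra! hno
      obtain ⟨c, hcV, hcU, hc₁, hc₂⟩ : ∃ c ∈ V(G), c ∉ U ∧ c ≠ t₁ ∧ c ≠ t₂ := by
        rcases K.eq_empty_or_nonempty with hK | ⟨k, hk⟩
        · obtain ⟨c, hc⟩ := hYne hK
          exact ⟨c, hB.subset hc.1, hno c hc, hc.2⟩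
        · exact ⟨k, h.subset hk, fun h' => (hUM h').2.1 hk, fun h' => ht₁.1 (h' ▸ hk),
            fun h' => ht₂.1 (h' ▸ hk)⟩
      obtain ⟨z, hz, z', hz', hz₁, hz₂, hzz⟩ := h.triSep U (fun z hz => (hUM hz).1) t₁ t₂
        (hXne.mono hXU) (fun h' => (hUM h').2.2.1 rfl) (fun h' => (hUM h').2.2.2 rfl)
        ⟨c, hcV, hcU, hc₁, hc₂⟩
      -- A step from the reached set into `K` starts at an attachment other than `t₁` and `t₂`,
      -- hence in `Y`. So the connecting path can be found outside `K`.
      by_cases hzK : z' ∈ K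
      · have hzN : G.IsAttachment a₁ b₁ K z :=
          ⟨(hUM hz).2.1, Or.inr (Or.inr ⟨z', hzK, hzz.symm⟩)⟩
        exact hno z ⟨hNB z hzN (hUM hz).2.2.1 (hUM hz).2.2.2, (hUM hz).2.2⟩ hz
      · exact hz' (hcl z hz z' ⟨hzz.right_mem, hzK, hz₁, hz₂⟩ hzz))
  have w1 := hW.left_mem
  have w2 := hW.right_mem
  have hWt : ∀ z ∈ W, z ∉ K ∧ z ≠ t₁ ∧ z ≠ t₂ := fun z hz => (hWM hz).2
  have hWX' : ∀ z ∈ W, (z ∈ A ∨ z ∈ D ∨ z ∈ S₂ ∨ z ∈ T) → z = x := fun z hz hz' =>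
    hWX z hz ⟨hz', (hWt z hz).2⟩
  have hWY' : ∀ z ∈ W, z ∈ B → z = y := fun z hz hz' => hWY z hz ⟨hz', (hWt z hz).2⟩
  have hFW₁ : e₁ ∉ FW := by
    intro he
    obtain ⟨ha, hb⟩ := hW.mem_of_isLink he hpair.link₁
    -- The ends of `e₁` would be attachments on `W`, hence in `B`, where `W` has only the vertex
    -- `y`.
    have e1 := hWY' a₁ ha (hNB a₁ ⟨(hWt a₁ ha).1, Or.inl rfl⟩ (hWt a₁ ha).2.1 (hWt a₁ ha).2.2)
    have e2 := hWY' b₁ hb (hNB b₁ ⟨(hWt b₁ hb).1, Or.inr (Or.inl rfl)⟩ (hWt b₁ hb).2.1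
      (hWt b₁ hb).2.2)
    exact hpair.ne₁ (e1.trans e2.symm)
  have hFW₂ : e₂ ∉ FW := by
    intro he
    obtain ⟨ha, hb⟩ := hW.mem_of_isLink he hpair.link₂
    exact hpair.ne₂ ((hWX' a₂ ha (by simp [hE₁])).trans (hWX' b₂ hb (by simp [hE₂])).symm)
  obtain ⟨B₁, B₂, FB₁, FB₂, rb₁, rb₂, hB₁, hB₂, rfl, rfl, rfl, iBB⟩ := hB.exists_split hyB
  have n1 := hB₁.right_mem
  have n2 := hB₂.left_mem
  have n3 := hB₁.left_mem
  have n4 := hB₂.right_mem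
  clear hC hXne hYne hNB hWM hWX hWY
  clear X Y
  simp only [Set.mem_union, not_or] at *
  -- In the three cases with `x` on the cycle, `W` is an ear whose ends separate `t₁` from `t₂` on
  -- it.
  by_cases hxA : x ∈ A
  · exfalso
    obtain ⟨A₁, A₂, FA₁, FA₂, ra₁, ra₂, hA₁, hA₂, rfl, rfl, rfl, iAA⟩ := hA.exists_split hxA
    have l1 := hA₁.left_mem
    have l2 := hA₂.right_mem
    have l3 := hA₁.right_mem
    have l4 := hA₂.left_mem
    clear hN hAN hDN hT hxA
    simp only [Set.mem_union, not_or] at *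
    have D₁ := hA₂.trans hB₁ (by grind)
    have D₂ := ((hB₂.trans hD (by grind)).trans hS (by simp only [Set.mem_union]; grind)).trans hA₁
      (by simp only [Set.mem_union]; grind)
    refine h.false_of_ear D₁ D₂ (by rw [← hs]; ac_rfl) ?_ ?_ hW ?_ ?_ (by simp [hg₁, hFW₁])
      (by simp [hg₂, hFW₂]) (Or.inr n3) ht₁ ?_ (Or.inl (Or.inl (Or.inl n4))) ht₂ ?_ <;>
      (try simp only [Set.mem_union]) <;> clear ht₁ ht₂ h <;> grind
  by_cases hxD : x ∈ D
  · exfalso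
    obtain ⟨A₁, A₂, FA₁, FA₂, ra₁, ra₂, hA₁, hA₂, rfl, rfl, rfl, iAA⟩ := hD.exists_split hxD
    have l1 := hA₁.left_mem
    have l2 := hA₂.right_mem
    have l3 := hA₁.right_mem
    have l4 := hA₂.left_mem
    clear hN hAN hDN hT hxD
    simp only [Set.mem_union, not_or] at *
    have D₁ := ((hA₂.trans hS (by grind)).trans hA (by simp only [Set.mem_union]; grind)).trans hB₁
      (by simp only [Set.mem_union]; grind)
    have D₂ := hB₂.trans hA₁ (by grind)
    refine h.false_of_ear D₁ D₂ (by rw [← hs]; ac_rfl) ?_ ?_ hW ?_ ?_ (by simp [hg₁, hFW₁])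
      (by simp [hg₂, hFW₂]) (Or.inr n3) ht₁ ?_ (Or.inl n4) ht₂ ?_ <;>
      (try simp only [Set.mem_union]) <;> clear ht₁ ht₂ h <;> grind
  by_cases hxS : x ∈ S₂
  · exfalso
    obtain ⟨A₁, A₂, FA₁, FA₂, ra₁, ra₂, hA₁, hA₂, rfl, rfl, rfl, iAA⟩ := hS.exists_split hxS
    have l1 := hA₁.left_mem
    have l2 := hA₂.right_mem
    have l3 := hA₁.right_mem
    have l4 := hA₂.left_mem
    clear hN hAN hDN hT hxS
    simp only [Set.mem_union, not_or] at *
    have D₁ := (hA₂.trans hA (by grind)).trans hB₁ (by simp only [Set.mem_union]; grind)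
    have D₂ := (hB₂.trans hD (by grind)).trans hA₁ (by simp only [Set.mem_union]; grind)
    refine h.false_of_ear D₁ D₂ (by rw [← hs]; ac_rfl) ?_ ?_ hW ?_ ?_ (by simp [hg₁, hFW₁])
      (by simp [hg₂, hFW₂]) (Or.inr n3) ht₁ ?_ (Or.inl (Or.inl n4)) ht₂ ?_ <;>
      (try simp only [Set.mem_union]) <;> clear ht₁ ht₂ h <;> grind
  have hxT : x ∈ T := by tauto
  have hK : K.Nonempty := by
    rw [Set.nonempty_iff_ne_empty]
    intro hK
    rcases hT hK hxT with rfl | rfl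
    exacts [hxA m1, hxD m6]
  have hxB : x ∉ B₁ ∧ x ∉ B₂ := by
    have := i2 x hxT
    grind
  obtain ⟨T₁, T₂, E₁, E₂, c₁, c₂, hT₁, hT₂, rfl, rfl, rfl, iTT⟩ := hPT.exists_split hxT
  have hEE : ∀ g, g ∈ E₁ → g ∉ E₂ := by
    intro g hg hg'
    obtain ⟨c, d, hcd, hne, hc, hd⟩ := hT₁.exists_isLink hg
    obtain ⟨hc', hd'⟩ := hT₂.mem_of_isLink hg' hcd
    exact hne ((iTT c hc hc').trans (iTT d hd hd').symm)
  have heT : e₁ ∉ E₁ ∧ e₁ ∉ E₂ := by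
    have key : a₁ ∈ T₁ ∪ T₂ → b₁ ∈ T₁ ∪ T₂ → False := by
      intro ha hb
      rcases h.hook with hK' | hK' | hK'
      · exact hK.ne_empty hK'
      · exact i3 _ ha hK'
      · exact i3 _ hb hK'
    exact ⟨fun he => key (Or.inl (hT₁.mem_of_isLink he hpair.link₁).1)
      (Or.inl (hT₁.mem_of_isLink he hpair.link₁).2),
      fun he => key (Or.inr (hT₂.mem_of_isLink he hpair.link₁).1)
      (Or.inr (hT₂.mem_of_isLink he hpair.link₁).2)⟩
  have hN' : ∀ n, G.IsAttachment a₁ b₁ K n → n ∈ A ∨ n ∈ B₁ ∨ n ∈ B₂ ∨ n ∈ D := fun n hn => by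
    rcases hN n hn with (h' | h' | h') | h' <;> simp [h']
  clear hAN hDN hT hN
  simp only [Set.mem_union] at *
  -- The half of the chord that does not contain `e₂` goes into the new cycle. If `e₂` is in the
  -- first half, everything is read in the opposite direction.
  rcases heE with heE | heE
  · refine h.untied_of_ear hK hD.symm hB₂.symm hB₁.symm hA.symm hS.symm hT₂.symm hT₁.symm hW
      (by rw [← hs]; ac_rfl) ?_ ?_ ?_ ?_ ?_ ?_ ?_ ?_ ?_ ?_ ?_ ⟨hxD, hxB.2, hxB.1, hxA, hxS⟩
      ⟨hyt.2, hyt.1⟩ hpq.symm ?_ (by simp [hg₁, heT, hFW₁]) (by simp [hg₂, hEE e₂ heE, hFW₂]) heE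
      hl (fun n hn => ?_) ht₂ ht₁
    on_goal 13 => rcases hN' n hn with h' | h' | h' | h' <;> simp [h']
    all_goals clear hN' h ht₁ ht₂ hEE; grind
  · refine h.untied_of_ear hK hA hB₁ hB₂ hD hS hT₁ hT₂ hW
      (by rw [← hs]; ac_rfl) ?_ ?_ ?_ ?_ ?_ ?_ ?_ ?_ ?_ ?_ ?_ ⟨hxA, hxB.1, hxB.2, hxD, hxS⟩
      hyt hpq ?_ (by simp [hg₁, heT, hFW₁]) (by simp [hg₂, hFW₂]; exact fun h' => hEE e₂ h' heE) heE
      hr hN' ht₁ ht₂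
    all_goals clear hN' h ht₁ ht₂ hEE; grind

end Graph

/-! ### Long negative cycles avoiding both edges -/

namespace Graph

variable {α β : Type*} {G : Graph α β} {σ : β → ℤˣ} {u v x y z : α}
  {S S' C K : Set α} {F F' FC : Set β} {s s' : ℤˣ} {e f e₁ e₂ : β} {a b a₁ b₁ a₂ b₂ : α}

theorem IsFrame.untied (h : G.IsFrame σ e₁ e₂ a₁ b₁ a₂ b₂ K) (hC : G.IsGood σ e₁ e₂ K C F) :
    G.Untied σ e₁ e₂ := by
  obtain ⟨p, q, S₁, F₁, s₁, S₂, F₂, s₂, T, E, r, hc, rfl, rfl, hT⟩ := h.exists_chord hC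
  have hN := h.attachment_mem _ _ hC
  by_cases h₂ : ∃ n ∈ S₂, G.IsAttachment a₁ b₁ K n ∧ n ≠ p ∧ n ≠ q
  · by_cases h₁ : ∃ n ∈ S₁, G.IsAttachment a₁ b₁ K n ∧ n ≠ p ∧ n ≠ q
    · obtain ⟨n₁, hn₁, hN₁, hne₁⟩ := h₁
      obtain ⟨n₂, hn₂, hN₂, hne₂⟩ := h₂
      exact hc.untied_of_crossing h hN hn₁ hN₁ hne₁ hn₂ hN₂ hne₂
    · push Not at h₁
      refine hc.swap.untied_of_arc h (by rwa [Set.union_comm, Set.union_comm F₂]) hT fun x hx => ?_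
      refine (hN x hx).elim (fun hx₁ => ?_) id
      by_cases hxp : x = p
      · exact hxp ▸ hc.arc₂.right_mem
      · exact h₁ x hx₁ hx hxp ▸ hc.arc₂.left_mem
  · push Not at h₂
    refine hc.untied_of_arc h hC hT fun x hx => (hN x hx).elim id fun hx₂ => ?_
    by_cases hxp : x = p
    · exact hxp ▸ hc.arc₁.left_mem
    · exact h₂ x hx₂ hx hxp ▸ hc.arc₁.right_mem

theorem IsGood.swap (h : G.IsGood σ e₁ e₂ K C F) : G.IsGood σ e₂ e₁ K C F :=
  ⟨h.cycle, h.long, h.notMem₂, h.notMem₁, h.disjoint⟩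

/-- The set `{a₁}` is a candidate, so a maximal candidate `K` exists. If a good cycle missed an
attachment of `K`, that vertex could be added to `K`; thus maximality makes `K` a frame unless it
already meets `e₂`. -/
theorem IsEdgePair.untied_of_end_notMem (h : G.IsEdgePair e₁ e₂ a₁ b₁ a₂ b₂) (hV : V(G).Finite)
    (h3 : G.IsTriSep) (hC : G.IsGood σ e₁ e₂ ∅ C F) (ha : a₁ ∉ C) : G.Untied σ e₁ e₂ := by
  let 𝒦 : Set (Set α) := {K | K ⊆ V(G) ∧ G.ConnOn K ∧ (a₁ ∈ K ∨ b₁ ∈ K) ∧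
    ∃ C F, G.IsGood σ e₁ e₂ K C F}
  have hfin : 𝒦.Finite := hV.finite_subsets.subset fun K hK => hK.1
  have hne : 𝒦.Nonempty := by
    refine ⟨{a₁}, by simpa using h.link₁.left_mem, ?_, Or.inl rfl, C, F, hC.cycle, hC.long,
      hC.notMem₁, hC.notMem₂, fun x hx hxa => ha (hxa ▸ hx)⟩
    have := (connOn_empty (G := G)).insert (x := a₁) (Or.inl rfl)
    simpa using this
  obtain ⟨K, hK⟩ := hfin.exists_maximal hne
  obtain ⟨hKV, hconn, hook, C, F, hC⟩ := hK.prop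
  by_cases h₂ : a₂ ∈ K ∨ b₂ ∈ K
  · exact h.untied_of_connOn hV h3 hC.cycle hC.long hconn (fun x hx hxC => hC.disjoint x hxC hx)
      hook h₂
  push Not at h₂
  have hKne : K ≠ ∅ := by
    rintro rfl
    simp at hook
  have hframe : G.IsFrame σ e₁ e₂ a₁ b₁ a₂ b₂ K := by
    refine ⟨hV, h3, h, hKV, hconn, Or.inr hook, fun C' F' hC' x hx => ?_,
      fun h' => absurd h' hKne, h₂.1, h₂.2⟩
    by_contra hxC
    have hadj : ∃ k ∈ K, G.Adj k x := by
      rcases hx.2 with rfl | rfl | hk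
      · exact ⟨b₁, hook.resolve_left hx.1, h.link₁.symm.adj⟩
      · exact ⟨a₁, hook.resolve_right hx.1, h.link₁.adj⟩
      · exact hk
    have hmem : insert x K ∈ 𝒦 := by
      refine ⟨Set.insert_subset ?_ hKV, hconn.insert (Or.inr hadj), hook.imp Or.inr Or.inr, C', F',
        hC'.cycle, hC'.long, hC'.notMem₁, hC'.notMem₂, ?_⟩
      · obtain ⟨k, -, hk⟩ := hadj
        exact hk.right_mem
      · rintro y hy (rfl | hyK)
        exacts [hxC hy, hC'.disjoint y hy hyK]
    exact hx.1 (hK.le_of_ge hmem (Set.subset_insert x K) (Or.inl rfl))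
  exact hframe.untied hC

/-- If a long negative cycle avoids `e₁` and `e₂`, then these edges are untied. -/
theorem IsEdgePair.untied_of_isGood (h : G.IsEdgePair e₁ e₂ a₁ b₁ a₂ b₂) (hV : V(G).Finite)
    (h3 : G.IsTriSep) (hC : G.IsGood σ e₁ e₂ ∅ C F) : G.Untied σ e₁ e₂ := by
  -- If every good cycle contains all four ends, the empty set is a frame. Otherwise some end is off
  -- a good cycle, and by symmetry it may be called `a₁`.
  by_cases hall : ∀ C F, G.IsGood σ e₁ e₂ ∅ C F → a₁ ∈ C ∧ b₁ ∈ C ∧ a₂ ∈ C ∧ b₂ ∈ C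
  · have hframe : G.IsFrame σ e₁ e₂ a₁ b₁ a₂ b₂ ∅ := by
      refine ⟨hV, h3, h, Set.empty_subset _, connOn_empty, Or.inl rfl, fun C F hC x hx => ?_,
        fun _ C F hC => (hall C F hC).2.2, by simp, by simp⟩
      rcases hx.2 with rfl | rfl | ⟨k, hk, -⟩
      exacts [(hall C F hC).1, (hall C F hC).2.1, absurd hk (by simp)]
    exact hframe.untied hC
  · push Not at hall
    obtain ⟨C, F, hC, hm⟩ := hall
    by_cases m₁ : a₁ ∈ C
    · by_cases m₂ : b₁ ∈ C
      · by_cases m₃ : a₂ ∈ C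
        · exact (h.flip₂.swap.untied_of_end_notMem hV h3 hC.swap (hm m₁ m₂ m₃)).symm
        · exact (h.swap.untied_of_end_notMem hV h3 hC.swap m₃).symm
      · exact h.flip₁.untied_of_end_notMem hV h3 hC m₂
    · exact h.untied_of_end_notMem hV h3 hC m₁

end Graph

namespace Graph

variable {α β : Type*} {G : Graph α β} {σ : β → ℤˣ} {u v x y z : α}
  {S S' C K : Set α} {F F' FC : Set β} {s s' : ℤˣ} {e f e₁ e₂ : β} {a b a₁ b₁ a₂ b₂ : α}

/-! ### Negative cycles of subgraphs -/

theorem IsWalk.mono {H : Graph α β} {w : List (β × α)} (hle : H ≤ G) (h : H.IsWalk u w v) :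
    G.IsWalk u w v := by
  induction w generalizing u with
  | nil => exact ⟨hle.vertexSet_mono h.1, h.2⟩
  | cons p w ih => exact ⟨hle.isLink_mono h.1, ih h.2⟩

theorem IsWalk.edge_mem {w : List (β × α)} (h : G.IsWalk u w v) : ∀ f ∈ w.map Prod.fst, f ∈ E(G) := by
  induction w generalizing u with
  | nil => simp
  | cons p w ih =>
    intro f hf
    rcases List.mem_cons.1 hf with rfl | hf
    · exact h.1.edge_mem
    · exact ih h.2 f hf

theorem exists_cycleOn_of_not_isBalanced {H : Graph α β} (hle : H ≤ G) (h : ¬ H.IsBalanced σ) :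
    ∃ C F, G.CycleOn σ C F (-1) ∧ C ⊆ V(H) ∧ F ⊆ E(H) := by
  simp only [IsBalanced, not_forall] at h
  obtain ⟨u, w, hw, hs⟩ := h
  exact ⟨_, _, ⟨u, w, ⟨hw.isWalk.mono hle, hw.ne_nil, hw.nodup_vertices, hw.nodup_edges⟩, rfl, rfl,
    (Int.units_eq_one_or _).resolve_left hs⟩,
    fun z hz => hw.isWalk.vertices_subset z (List.mem_cons_of_mem _ hz), hw.isWalk.edge_mem⟩

theorem CycleOn.exists_ne [G.Loopless] (h : G.CycleOn σ C F s) (z : α) : ∃ c ∈ C, c ≠ z := by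
  obtain ⟨u, w, h, rfl, -⟩ := h
  by_contra! hno
  rcases w with _ | ⟨p, _ | ⟨q, w⟩⟩
  · exact h.ne_nil rfl
  · obtain ⟨hl, -, hp⟩ := h.isWalk
    exact hl.ne hp.symm
  · have h1 : p.2 = z := hno p.2 (by simp)
    have h2 : q.2 = z := hno q.2 (by simp)
    have := h.nodup_vertices
    simp [h1, h2] at this

theorem PathOn.sign_singleton (h : G.PathOn σ u v S {f} s) : σ f = s := by
  obtain ⟨w, hw, hn, -, hF, rfl⟩ := h
  have hmem : ∀ g, g ∈ w.map Prod.fst ↔ g = f := fun g => by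
    have : g ∈ ({f} : Set β) ↔ g ∈ w.map Prod.fst := by rw [hF]; rfl
    exact this.symm
  have hw' : w.map Prod.fst = [f] := List.perm_singleton.1
    ((List.perm_ext_iff_of_nodup (hw.nodup_edges hn) (by simp)).2 (by simpa using hmem))
  rw [walkSign_eq, hw']
  simp

/-- A cycle that is not long consists of two parallel edges. -/
theorem CycleOn.exists_parallel [G.Loopless] (h : G.CycleOn σ C F s) (hC : ¬ IsLong C) :
    ∃ u v f g, G.IsLink f u v ∧ G.IsLink g u v ∧ f ∈ F ∧ g ∈ F ∧ σ f * σ g = s := by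
  simp only [IsLong] at hC
  push Not at hC
  obtain ⟨p, q, hpq⟩ := hC
  have hsub : ∀ c ∈ C, c = p ∨ c = q := fun c hc => by
    by_cases hcp : c = p
    exacts [Or.inl hcp, Or.inr (hpq c hc hcp)]
  obtain ⟨c, hc, hcp⟩ := h.exists_ne p
  obtain ⟨d, hd, hdq⟩ := h.exists_ne q
  obtain rfl := (hsub c hc).resolve_left hcp
  obtain rfl := (hsub d hd).resolve_right hdq
  obtain ⟨S₁, S₂, F₁, F₂, s₁, s₂, h₁, h₂, rfl, rfl, rfl, -, -⟩ := h.exists_paths hd hc hdq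
  obtain ⟨f, rfl, hf⟩ := h₁.exists_isLink_of_subset hdq fun z hz => hsub z (Or.inl hz)
  obtain ⟨g, rfl, hg⟩ := h₂.exists_isLink_of_subset hdq.symm fun z hz => (hsub z (Or.inr hz)).symm
  exact ⟨d, c, f, g, hf, hg.symm, by simp, by simp, by
    rw [h₁.sign_singleton, h₂.sign_singleton]⟩

/-! ### Edges with a common end -/

/-- A negative cycle avoiding `v` would be joined to the other ends of the two edges by disjoint
paths in `G - v`. Together with the edges at `v` they form a path through both edges between two of
its vertices. The cycle may be a pair of parallel edges here. -/
theorem isBalanced_deleteVerts_of_tied [G.Loopless] (hV : V(G).Finite) (h3 : G.IsTriSep)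
    (h₁ : G.IsLink e₁ v x) (h₂ : G.IsLink e₂ v y) (hxy : x ≠ y) (ht : G.Tied σ e₁ e₂) :
    (G.deleteVerts {v}).IsBalanced σ := by
  by_contra hb
  obtain ⟨C, F, hC, hCV, -⟩ := exists_cycleOn_of_not_isBalanced deleteVerts_le hb
  have hvC : v ∉ C := fun h => by simpa using hCV h
  refine ht ?_
  obtain ⟨p, q, P, E, s, hP, hp, hq, hPM, -, hPq, hPP⟩ := exists_disjoint_pathsOn (σ := σ) hV
    (M := {z | z ∈ V(G) ∧ z ≠ v}) (A := {x, y}) (B := C) (fun z hz => hz.1) (by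
      rintro z (rfl | rfl)
      exacts [⟨h₁.right_mem, h₁.ne.symm⟩, ⟨h₂.right_mem, h₂.ne.symm⟩]) 2 (by
      intro X hX U hUM hUX hAU hcl
      by_contra! hno
      have hXe : ∀ x ∈ X, ∀ y ∈ X, x = y := fun x hx y hy =>
        Finset.card_le_one.1 (by omega) x hx y hy
      obtain ⟨w, hw, hwU⟩ : ∃ w, (∀ x ∈ X, x = w) ∧ w ∉ U := by
        by_cases hX' : X.Nonempty
        · obtain ⟨w, hw⟩ := hX'
          exact ⟨w, fun x hx => hXe x hx w hw, fun h => hUX w h hw⟩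
        · rw [Finset.not_nonempty_iff_eq_empty] at hX'
          subst hX'
          exact ⟨v, by simp, fun h => (hUM h).2 rfl⟩
      have hUne : U.Nonempty := by
        by_cases haX : x ∈ X
        · exact ⟨y, hAU y (by simp) fun hbX => hxy (hXe _ haX _ hbX)⟩
        · exact ⟨x, hAU x (by simp) haX⟩
      obtain ⟨c, hc, hcw⟩ := hC.exists_ne w
      obtain ⟨x, hx, y, hy, hyw, hyv, hxy⟩ := h3 U (fun x hx => (hUM hx).1) w v hUne hwU
        (fun h => (hUM h).2 rfl) ⟨c, hC.subset hc, hno c hc, hcw, fun h => hvC (h ▸ hc)⟩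
      exact hy (hcl x hx y ⟨hxy.right_mem, hyv⟩ (fun h => hyw (hw y h)) hxy))
  have h01 : (0 : Fin 2) ≠ 1 := by decide
  have hd : ∀ x ∈ P 0, x ∉ P 1 := fun x h h' => h01 (hPP 0 1 x h h')
  have hp0 := hp 0
  have hp1 := hp 1
  simp only [Set.mem_insert_iff, Set.mem_singleton_iff] at hp0 hp1
  have m1 := (hP 0).left_mem
  have m2 := (hP 1).left_mem
  have m3 := (hP 0).right_mem
  have m4 := (hP 1).right_mem
  have hpne : p 0 ≠ p 1 := fun h => hd _ m1 (h ▸ m2)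
  have hqne : q 0 ≠ q 1 := fun h => hd _ m3 (h ▸ m4)
  have hv0 : v ∉ P 0 := fun h => (hPM 0 h).2 rfl
  have hv1 : v ∉ P 1 := fun h => (hPM 1 h).2 rfl
  have hne : e₁ ≠ e₂ := by
    rintro rfl
    exact hxy (h₁.right_unique h₂)
  have hpath : ∃ E' s', G.PathOn σ (p 0) (p 1) {p 0, v, p 1} E' s' ∧ e₁ ∈ E' ∧ e₂ ∈ E' := by
    have key : ∀ {e e' a b}, G.IsLink e v a → G.IsLink e' v b → a ≠ b →
        G.PathOn σ a b ({a, v} ∪ {v, b}) ({e} ∪ {e'}) (σ e * σ e') := fun h h' hab =>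
      (h.symm.pathOn h.symm.ne).trans (h'.pathOn h'.ne) (by
        rintro z (rfl | rfl) (hz | hz)
        exacts [hz, absurd hz hab, rfl, hz ▸ rfl])
    have hset : ∀ a b : α, ({a, v} ∪ {v, b} : Set α) = {a, v, b} := fun a b => by
      ext z; simp only [Set.mem_union, Set.mem_insert_iff, Set.mem_singleton_iff]; tauto
    rw [← hset]
    rcases hp0 with h | h <;> rcases hp1 with h' | h'
    · exact absurd (h.trans h'.symm) hpne
    · rw [h, h'] at hpne ⊢
      exact ⟨_, _, key h₁ h₂ hpne, by simp, by simp⟩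
    · rw [h, h'] at hpne ⊢
      exact ⟨_, _, key h₂ h₁ hpne, by simp, by simp⟩
    · exact absurd (h.trans h'.symm) hpne
  obtain ⟨E', s', hE', m₁, m₂⟩ := hpath
  have T₁ := (hP 0).symm.trans hE' (by grind)
  have T := T₁.trans (hP 1) (by simp only [Set.mem_union]; grind)
  refine hC.untied_of_pathOn T (hq 0) (hq 1) hqne ?_ hne (by simp [m₁]) (by simp [m₂])
  have q0 := hPq 0
  have q1 := hPq 1
  simp only [Set.mem_union]
  grind

/-! ### Edge cuts -/

/-- In a `3`-connected graph, two parallel classes do not contain an edge cut. -/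
theorem IsTriSep.false_of_cut (h3 : G.IsTriSep) (hcard : 3 < V(G).encard) {X : Set α}
    (hXV : X ⊆ V(G)) (hu : u ∈ X) (hv : v ∉ X) (ha : a ∈ X) (hb : b ∉ X) (hvV : v ∈ V(G))
    (hbV : b ∈ V(G))
    (hX : ∀ x ∈ X, ∀ y, y ∉ X → G.Adj x y → (x = u ∧ y = v) ∨ (x = a ∧ y = b)) : False := by
  -- Other vertices of `X` would be separated from `v` by `u` and `a`. Likewise each side has at
  -- most two vertices, so by the vertex count both sides have exactly two.
  have hX₁ : ∀ x ∈ X, x = u ∨ x = a := by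
    intro x hx
    by_contra! hne
    obtain ⟨x', hx', y, hy, hyu, hya, hxy⟩ := h3 (X \ {u, a}) (fun z hz => hXV hz.1) u a
      ⟨x, hx, by simp [hne]⟩ (by simp) (by simp)
      ⟨v, hvV, fun h => hv h.1, fun h => hv (h ▸ hu), fun h => hv (h ▸ ha)⟩
    have hyX : y ∉ X := fun h => hy ⟨h, by simp [hyu, hya]⟩
    have := hx'.2
    simp only [Set.mem_insert_iff, Set.mem_singleton_iff, not_or] at this
    rcases hX x' hx'.1 y hyX hxy with h | h
    exacts [this.1 h.1, this.2 h.1]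
  have hX₂ : ∀ x ∈ V(G), x ∉ X → x = v ∨ x = b := by
    intro x hxV hx
    by_contra! hne
    obtain ⟨x', hx', y, hy, hyv, hyb, hxy⟩ := h3 ((V(G) \ X) \ {v, b}) (fun z hz => hz.1.1) v b
      ⟨x, ⟨hxV, hx⟩, by simp [hne]⟩ (by simp) (by simp)
      ⟨u, hXV hu, fun h => h.1.2 hu, fun h => hv (h ▸ hu), fun h => hb (h ▸ hu)⟩
    have hyX : y ∈ X := by
      by_contra hyX
      exact hy ⟨⟨hxy.right_mem, hyX⟩, by simp [hyv, hyb]⟩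
    have := hx'.2
    simp only [Set.mem_insert_iff, Set.mem_singleton_iff, not_or] at this
    rcases hX y hyX x' hx'.1.2 hxy.symm with h | h
    exacts [this.1 h.2, this.2 h.2]
  have hcard' : ∀ p q r : α, V(G) ⊆ {p, q, r} → False := by
    intro p q r hsub
    refine absurd (hcard.trans_le (Set.encard_le_encard hsub)) (not_lt.2 ?_)
    refine (Set.encard_insert_le _ _).trans ?_
    refine (add_le_add_left (Set.encard_insert_le _ _) 1).trans ?_
    rw [Set.encard_singleton]
    norm_num
  have hau : a ≠ u := by
    rintro rfl
    refine hcard' a v b fun x hx => ?_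
    by_cases hxX : x ∈ X
    · have := hX₁ x hxX; simp_all
    · have := hX₂ x hx hxX; simp_all
  have hbv : v ≠ b := by
    rintro rfl
    refine hcard' a u v fun x hx => ?_
    by_cases hxX : x ∈ X
    · have := hX₁ x hxX
      simp only [Set.mem_insert_iff, Set.mem_singleton_iff]; tauto
    · have := hX₂ x hx hxX
      simp only [Set.mem_insert_iff, Set.mem_singleton_iff]; tauto
  have hab : b ≠ a := fun h => hb (h ▸ ha)
  -- Now `a` has no neighbours besides `u` and `b`, which therefore separate it from `v`.
  obtain ⟨x, rfl, y, hy, hyu, hyb, hxy⟩ := h3 {a} (by simpa using hXV ha) u b ⟨a, rfl⟩ hau.symm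
    hab ⟨v, hvV, fun h => hv (by rw [Set.mem_singleton_iff] at h; exact h ▸ ha),
      fun h => hv (h ▸ hu), hbv⟩
  have hyX : y ∉ X := fun h => (hX₁ y h).elim hyu hy
  rcases hX x ha y hyX hxy with h | h
  exacts [hau h.1, hyb h.2]

end Graph

/-! ### Cuts from parallel edges of opposite signs -/

namespace Graph

variable {α β : Type*} {G : Graph α β} {σ : β → ℤˣ} {u v x y z : α}
  {S S' C K : Set α} {F F' FC : Set β} {s s' : ℤˣ} {e f e₁ e₂ : β} {a b a₁ b₁ a₂ b₂ : α}

theorem IsEdgePair.exists_parallel_of_tied [G.Loopless] (h : G.IsEdgePair e₁ e₂ a₁ b₁ a₂ b₂)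
    (hV : V(G).Finite) (h3 : G.IsTriSep) (ht : G.Tied σ e₁ e₂) (hC : G.CycleOn σ C F (-1))
    (h₁ : e₁ ∉ F) (h₂ : e₂ ∉ F) :
    ∃ u v f g, G.IsLink f u v ∧ G.IsLink g u v ∧ f ∈ F ∧ g ∈ F ∧ σ f * σ g = -1 :=
  hC.exists_parallel fun hlong => ht (h.untied_of_isGood hV h3 ⟨hC, hlong, h₁, h₂, by simp⟩)

/-- Two parallel edges of different signs are in an edge cut that consists of their parallel class,
`e₁` and `e₂`. -/
theorem IsEdgePair.exists_cut_of_tied [G.Loopless] (h : G.IsEdgePair e₁ e₂ a₁ b₁ a₂ b₂)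
    (hV : V(G).Finite) (h3 : G.IsTriSep) (hcard : 3 < V(G).encard) (ht : G.Tied σ e₁ e₂) {g : β}
    (hf : G.IsLink f u v) (hg : G.IsLink g u v) (hf₁ : f ≠ e₁) (hf₂ : f ≠ e₂) (hg₁ : g ≠ e₁)
    (hg₂ : g ≠ e₂) (hs : σ f * σ g = -1) :
    ∃ X ⊆ V(G), ∀ e x y, G.IsLink e x y →
      ((x ∈ X ↔ y ∉ X) ↔ (G.IsLink e u v ∨ e = e₁ ∨ e = e₂)) := by
  let r : α → α → Prop := fun x y => ∃ e, G.IsLink e x y ∧ ¬ G.IsLink e u v ∧ e ≠ e₁ ∧ e ≠ e₂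
  let X : Set α := {x | x ∈ V(G) ∧ ∃ l, RelWalk r u l x}
  have huX : u ∈ X := ⟨hf.left_mem, [], rfl⟩
  have hvX : v ∉ X := by
    rintro ⟨-, l, hl⟩
    obtain ⟨l', hl', hn, -⟩ := hl.exists_nodup
    obtain ⟨E, s, hP, hE⟩ := exists_pathOn_of_relWalk (G := G) (σ := σ)
      (P := fun e => ¬ G.IsLink e u v ∧ e ≠ e₁ ∧ e ≠ e₂) (fun x y hxy => hxy) hf.left_mem hl' hn
    -- A path avoiding the parallel class has an inner vertex, so with either `f` or `g` it closes
    -- to a long cycle; one of these two cycles is negative.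
    obtain ⟨z, hz, hzu, hzv⟩ : ∃ z ∈ {x | x ∈ u :: l'}, z ≠ u ∧ z ≠ v := by
      by_contra! hno
      obtain ⟨e, rfl, he⟩ := hP.exists_isLink_of_subset hf.ne fun z hz => by
        by_cases hzu : z = u
        exacts [Or.inl hzu, Or.inr (hno z hz hzu)]
      exact (hE e rfl).1 he
    have key : ∀ {g}, G.IsLink g u v → g ≠ e₁ → g ≠ e₂ → s * σ g ≠ -1 := by
      intro g hg h₁ h₂ hneg
      obtain ⟨hC, hL⟩ := CycleOn.of_paths_of_mem (z := z) hP (hg.symm.pathOn hg.symm.ne) hf.ne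
        (fun z _ hz => hz.symm) (Or.inl hz) hzu hzv
      rw [hneg] at hC
      refine ht (h.untied_of_isGood hV h3 ⟨hC, hL, ?_, ?_, by simp⟩)
      · rintro (h' | h')
        exacts [(hE _ h').2.1 rfl, h₁ h'.symm]
      · rintro (h' | h')
        exacts [(hE _ h').2.2 rfl, h₂ h'.symm]
    have hprod : (s * σ f) * (s * σ g) = -1 := by
      rw [mul_mul_mul_comm, hs, Int.units_mul_self, one_mul]
    rcases eq_neg_one_or hprod with h' | h'
    exacts [key hf hf₁ hf₂ h', key hg hg₁ hg₂ h']
  have hcl : ∀ {e x y}, G.IsLink e x y → x ∈ X → y ∉ X → G.IsLink e u v ∨ e = e₁ ∨ e = e₂ := by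
    rintro e x y he ⟨hxV, l, hl⟩ hy
    by_contra! hne
    exact hy ⟨he.right_mem, l ++ [y], hl.append ⟨⟨e, he, hne⟩, rfl⟩⟩
  -- If one of `e₁`, `e₂` did not cross, the boundary of `X` would lie in the parallel class
  -- together with the other edge. Should that edge not cross either, the class is simply used
  -- twice.
  have hone : ∀ {e c d}, G.IsLink e c d →
      (∀ e' x y, G.IsLink e' x y → x ∈ X → y ∉ X → G.IsLink e' u v ∨ e' = e) → False := by
    intro e c d he hX
    have key : ∀ {c d}, G.IsLink e c d → c ∈ X → d ∉ X → False := by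
      intro c d he hc hd
      refine h3.false_of_cut hcard (fun x hx => hx.1) huX hvX hc hd hf.right_mem he.right_mem
        fun x hx y hy ⟨e', he'⟩ => ?_
      rcases hX e' x y he' hx hy with h' | rfl
      · rcases he'.eq_and_eq_or_eq_and_eq h' with h'' | ⟨rfl, rfl⟩
        exacts [Or.inl h'', absurd hx hvX]
      · rcases he'.eq_and_eq_or_eq_and_eq he with h'' | ⟨rfl, rfl⟩
        exacts [Or.inr h'', absurd hx hd]
    by_cases hc : c ∈ X <;> by_cases hd : d ∈ X
    · refine h3.false_of_cut hcard (fun x hx => hx.1) huX hvX huX hvX hf.right_mem hf.right_mem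
        fun x hx y hy ⟨e', he'⟩ => ?_
      rcases hX e' x y he' hx hy with h' | rfl
      · rcases he'.eq_and_eq_or_eq_and_eq h' with h'' | ⟨rfl, rfl⟩
        exacts [Or.inl h'', absurd hx hvX]
      · rcases he'.eq_and_eq_or_eq_and_eq he with ⟨rfl, rfl⟩ | ⟨rfl, rfl⟩
        exacts [absurd hd hy, absurd hc hy]
    · exact key he hc hd
    · exact key he.symm hd hc
    · refine h3.false_of_cut hcard (fun x hx => hx.1) huX hvX huX hvX hf.right_mem hf.right_mem
        fun x hx y hy ⟨e', he'⟩ => ?_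
      rcases hX e' x y he' hx hy with h' | rfl
      · rcases he'.eq_and_eq_or_eq_and_eq h' with h'' | ⟨rfl, rfl⟩
        exacts [Or.inl h'', absurd hx hvX]
      · rcases he'.eq_and_eq_or_eq_and_eq he with ⟨rfl, rfl⟩ | ⟨rfl, rfl⟩
        exacts [absurd hx hc, absurd hx hd]
  have hcross₁ : ∀ {x y}, G.IsLink e₁ x y → (x ∈ X ↔ y ∉ X) := by
    intro x y he
    by_contra hno
    refine hone h.link₂ fun e' x' y' he' hx' hy' => ?_
    rcases hcl he' hx' hy' with h' | rfl | h'
    · exact Or.inl h'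
    · rcases he.eq_and_eq_or_eq_and_eq he' with ⟨rfl, rfl⟩ | ⟨rfl, rfl⟩ <;> tauto
    · exact Or.inr h'
  have hcross₂ : ∀ {x y}, G.IsLink e₂ x y → (x ∈ X ↔ y ∉ X) := by
    intro x y he
    by_contra hno
    refine hone h.link₁ fun e' x' y' he' hx' hy' => ?_
    rcases hcl he' hx' hy' with h' | h' | rfl
    · exact Or.inl h'
    · exact Or.inr h'
    · rcases he.eq_and_eq_or_eq_and_eq he' with ⟨rfl, rfl⟩ | ⟨rfl, rfl⟩ <;> tauto
  refine ⟨X, fun x hx => hx.1, fun e x y he => ⟨fun hxy => ?_, ?_⟩⟩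
  · by_cases hx : x ∈ X
    · exact hcl he hx (hxy.1 hx)
    · exact hcl he.symm (by tauto) hx
  · rintro (h' | rfl | rfl)
    · rcases he.eq_and_eq_or_eq_and_eq h' with ⟨rfl, rfl⟩ | ⟨rfl, rfl⟩ <;> tauto
    · exact hcross₁ he
    · exact hcross₂ he

theorem IsEdgePair.exists_isParallelClass_of_tied [G.Loopless]
    (h : G.IsEdgePair e₁ e₂ a₁ b₁ a₂ b₂) (hV : V(G).Finite) (h3 : G.IsTriSep)
    (hcard : 3 < V(G).encard) (ht : G.Tied σ e₁ e₂)
    (hb : ¬ (G.deleteEdges {e₁, e₂}).IsBalanced σ) :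
    ∃ F : Set β, G.IsParallelClass F ∧ (∃ f ∈ F, σ f = 1) ∧ (∃ f ∈ F, σ f = -1) ∧
      G.IsEdgeCut (F ∪ {e₁, e₂}) ∧ (G.deleteEdges (F ∪ {e₁, e₂})).IsBalanced σ := by
  obtain ⟨C, FC, hC, -, hFC⟩ := exists_cycleOn_of_not_isBalanced deleteEdges_le hb
  have hne : ∀ f ∈ FC, f ≠ e₁ ∧ f ≠ e₂ := fun f hf => by simpa using (hFC hf).2
  obtain ⟨u, v, f, g, hf, hg, hfF, hgF, hs⟩ := h.exists_parallel_of_tied hV h3 ht hC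
    (fun h' => (hne _ h').1 rfl) (fun h' => (hne _ h').2 rfl)
  obtain ⟨X, hXV, hX⟩ := h.exists_cut_of_tied hV h3 hcard ht hf hg (hne f hfF).1 (hne f hfF).2
    (hne g hgF).1 (hne g hgF).2 hs
  have hpar : ∀ e, G.Parallel f e ↔ G.IsLink e u v := by
    refine fun e => ⟨?_, fun he => ⟨u, v, hf, he⟩⟩
    rintro ⟨x, y, hx, hy⟩
    rcases hf.eq_and_eq_or_eq_and_eq hx with ⟨rfl, rfl⟩ | ⟨rfl, rfl⟩
    exacts [hy, hy.symm]
  refine ⟨{e | G.Parallel f e}, ⟨f, hf.edge_mem, rfl⟩, ?_, ?_, ⟨X, hXV, ?_⟩, ?_⟩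
  · rcases Int.units_eq_one_or (σ f) with h' | h'
    · exact ⟨f, (hpar f).2 hf, h'⟩
    · refine ⟨g, (hpar g).2 hg, ?_⟩
      rw [h'] at hs
      simpa using hs
  · rcases eq_neg_one_or hs with h' | h'
    exacts [⟨f, (hpar f).2 hf, h'⟩, ⟨g, (hpar g).2 hg, h'⟩]
  · ext e
    simp only [Set.mem_union, Set.mem_ofPred_eq, hpar, Set.mem_insert_iff, Set.mem_singleton_iff]
    constructor
    · intro he
      have hE : e ∈ E(G) := by
        rcases he with he | rfl | rfl
        exacts [he.edge_mem, h.link₁.edge_mem, h.link₂.edge_mem]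
      obtain ⟨x, y, hxy⟩ := exists_isLink_of_mem_edgeSet hE
      have hcr := (hX e x y hxy).2 he
      by_cases hx : x ∈ X
      · exact ⟨x, y, hxy, hx, hcr.1 hx⟩
      · exact ⟨y, x, hxy.symm, by tauto, hx⟩
    · rintro ⟨x, y, hxy, hx, hy⟩
      exact (hX e x y hxy).1 (by tauto)
  · by_contra hb'
    obtain ⟨C', FC', hC', -, hFC'⟩ := exists_cycleOn_of_not_isBalanced deleteEdges_le hb'
    have hne' : ∀ f ∈ FC', ¬ G.IsLink f u v ∧ f ≠ e₁ ∧ f ≠ e₂ := fun e he => by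
      have := (hFC' he).2
      simp only [Set.mem_union, Set.mem_ofPred_eq, hpar, Set.mem_insert_iff,
        Set.mem_singleton_iff, not_or] at this
      exact this
    obtain ⟨u', v', f', g', hf', hg', hfF', hgF', hs'⟩ := h.exists_parallel_of_tied hV h3 ht hC'
      (fun h' => (hne' _ h').2.1 rfl) (fun h' => (hne' _ h').2.2 rfl)
    obtain ⟨X', hXV', hX'⟩ := h.exists_cut_of_tied hV h3 hcard ht hf' hg' (hne' f' hfF').2.1
      (hne' f' hfF').2.2 (hne' g' hgF').2.1 (hne' g' hgF').2.2 hs'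
    have hdiff : ∀ e, G.IsLink e u v → ¬ G.IsLink e u' v' := by
      intro e h₁ h₂
      rcases h₁.eq_and_eq_or_eq_and_eq h₂ with ⟨rfl, rfl⟩ | ⟨rfl, rfl⟩
      exacts [(hne' f' hfF').1 hf', (hne' f' hfF').1 hf'.symm]
    -- An edge leaves the symmetric difference of `X` and `X'` exactly if it is in one of the two
    -- cuts but not in both. So `e₁` and `e₂` drop out, and only the two parallel classes remain.
    let Y : Set α := {x | x ∈ V(G) ∧ ¬ (x ∈ X ↔ x ∈ X')}
    have hY : ∀ {e x y}, G.IsLink e x y → x ∈ Y → y ∉ Y → G.IsLink e u v ∨ G.IsLink e u' v' := by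
      intro e x y he hx hy
      have h₁ := hX e x y he
      have h₂ := hX' e x y he
      have hy' : (y ∈ X ↔ y ∈ X') := by
        by_contra hn
        exact hy ⟨he.right_mem, hn⟩
      have hx' := hx.2
      by_contra! hn
      have hXX : (x ∈ X ↔ y ∉ X) ↔ (x ∈ X' ↔ y ∉ X') := by
        rw [h₁, h₂]
        simp [hn]
      clear * - hXX hy' hx'
      tauto
    have hcr : ∀ {x y}, ((x ∈ X ↔ y ∉ X) ↔ ¬ (x ∈ X' ↔ y ∉ X')) → x ∈ V(G) → y ∈ V(G) →
        x ∈ Y ∧ y ∉ Y ∨ y ∈ Y ∧ x ∉ Y := by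
      intro x y hxy hx hy
      simp only [Y, Set.mem_ofPred_eq, hx, hy, true_and]
      clear * - hxy
      tauto
    have ends : ∀ {u v e}, G.IsLink e u v → ((u ∈ X ↔ v ∉ X) ↔ ¬ (u ∈ X' ↔ v ∉ X')) →
        ∃ c d, c ∈ Y ∧ d ∉ Y ∧ d ∈ V(G) ∧ (∀ e x y, G.IsLink e u v → G.IsLink e x y → x ∈ Y → y ∉ Y →
          x = c ∧ y = d) := by
      intro u v e he hXX
      rcases hcr hXX he.left_mem he.right_mem with ⟨hc, hd⟩ | ⟨hc, hd⟩
      · refine ⟨u, v, hc, hd, he.right_mem, fun e' x y h₁ h₂ hx hy => ?_⟩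
        rcases h₂.eq_and_eq_or_eq_and_eq h₁ with h' | ⟨rfl, rfl⟩
        exacts [h', absurd hx hd]
      · refine ⟨v, u, hc, hd, he.left_mem, fun e' x y h₁ h₂ hx hy => ?_⟩
        rcases h₂.eq_and_eq_or_eq_and_eq h₁ with ⟨rfl, rfl⟩ | h'
        exacts [absurd hx hd, h']
    obtain ⟨c, d, hc, hd, hdV, hcd⟩ := ends hf (by
      have h₁ := hX f u v hf
      have h₂ := hX' f u v hf
      have h₃ := hdiff f hf
      have h₄ := hne f hfF
      rw [h₁, h₂]
      simp [hf, h₃, h₄])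
    obtain ⟨c', d', hc', hd', hdV', hcd'⟩ := ends hf' (by
      have h₁ := hX f' u' v' hf'
      have h₂ := hX' f' u' v' hf'
      have h₄ := hne' f' hfF'
      rw [h₁, h₂]
      simp [hf', h₄])
    refine h3.false_of_cut hcard (fun x hx => hx.1) hc hd hc' hd' hdV hdV'
      fun x hx y hy ⟨e, he⟩ => ?_
    exact (hY he hx hy).imp (fun h' => hcd e x y h' he hx hy) fun h' => hcd' e x y h' he hx hy

end Graph

namespace Graph

variable {α β : Type*} {G : Graph α β} {σ : β → ℤˣ} {u v x y z : α}
  {S S' C K : Set α} {F F' FC : Set β} {s s' : ℤˣ} {e f e₁ e₂ : β} {a b a₁ b₁ a₂ b₂ : α}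

/-! ### Potentials of balanced graphs -/

theorem CycleOn.eq_one (h : G.CycleOn σ C F s) (hb : G.IsBalanced σ) : s = 1 := by
  obtain ⟨u, w, hw, -, -, rfl⟩ := h
  exact hb u w hw

theorem PathOn.sign_eq_one (h : G.PathOn σ u u S F s) : s = 1 := by
  obtain ⟨w, hw, hn, -, -, rfl⟩ := h
  rcases w with _ | ⟨p, w⟩
  · rfl
  · exact absurd hw.2.end_mem (List.nodup_cons.1 hn).1

/-- In a balanced graph, every walk can be replaced by a path of the same sign. -/
theorem IsWalk.exists_pathOn [G.Loopless] {w : List (β × α)} (h : G.IsWalk u w v)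
    (hb : G.IsBalanced σ) : ∃ S F, G.PathOn σ u v S F (walkSign σ w) := by
  induction w generalizing u with
  | nil =>
    obtain ⟨hu, rfl⟩ := h
    exact ⟨_, _, PathOn.refl hu⟩
  | cons p w ih =>
    obtain ⟨hl, hw⟩ := h
    obtain ⟨S, F, hP⟩ := ih hw
    have hsgn : walkSign σ (p :: w) = σ p.1 * walkSign σ w := by simp [walkSign]
    rw [hsgn]
    by_cases hu : u ∈ S
    · obtain ⟨S₁, S₂, F₁, F₂, s₁, s₂, h₁, h₂, rfl, rfl, hs, -⟩ := hP.exists_split hu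
      -- The closed piece cut off at `u` is a cycle, positive by balance, or one edge traversed
      -- twice.
      have hone : σ p.1 * s₁ = 1 := by
        by_cases hF : ∃ f, {p.1} = ({f} : Set β) ∧ F₁ = {f}
        · obtain ⟨f, hpf, rfl⟩ := hF
          rw [Set.singleton_eq_singleton_iff] at hpf
          rw [hpf, h₁.sign_singleton, Int.units_mul_self]
        · exact (CycleOn.of_paths (hl.pathOn hl.ne) h₁ hl.ne (fun z hz _ => hz) hF).eq_one hb
      refine ⟨S₂, F₂, ?_⟩
      rwa [hs, ← mul_assoc, hone, one_mul]
    · refine ⟨_, _, (hl.pathOn hl.ne).trans hP ?_⟩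
      rintro z (rfl | rfl) hz
      exacts [absurd hz hu, rfl]

theorem IsWalk.walkSign_eq_one [G.Loopless] {w : List (β × α)} (h : G.IsWalk u w u)
    (hb : G.IsBalanced σ) : walkSign σ w = 1 := by
  obtain ⟨S, F, hP⟩ := h.exists_pathOn hb
  exact hP.sign_eq_one

/-- The potential of a vertex is the sign of a walk to a representative of its component. It fits
because closed walks in a balanced graph are positive. -/
theorem IsBalanced.exists_potential [G.Loopless] (hb : G.IsBalanced σ) :
    ∃ π : α → ℤˣ, ∀ e x y, G.IsLink e x y → σ e * π x * π y = 1 := by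
  -- The representative is a function of the set of reachable vertices, so adjacent vertices get the
  -- same one. The value `none` serves only the empty set.
  have hc : ∀ S : Set α, ∃ c : Option α, S.Nonempty → ∃ z ∈ S, c = some z := by
    intro S
    by_cases hS : S.Nonempty
    · obtain ⟨z, hz⟩ := hS
      exact ⟨some z, fun _ => ⟨z, hz, rfl⟩⟩
    · exact ⟨none, fun h => absurd h hS⟩
  choose c hc using hc
  let R : α → Set α := fun x => {y | ∃ w, G.IsWalk x w y}
  have hπ : ∀ x, ∃ t : ℤˣ, x ∈ V(G) → ∃ z w, c (R x) = some z ∧ G.IsWalk x w z ∧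
      walkSign σ w = t := by
    intro x
    by_cases hx : x ∈ V(G)
    · obtain ⟨z, ⟨w, hw⟩, hz⟩ := hc (R x) ⟨x, [], hx, rfl⟩
      exact ⟨walkSign σ w, fun _ => ⟨z, w, hz, hw, rfl⟩⟩
    · exact ⟨1, fun h => absurd h hx⟩
  choose π hπ using hπ
  refine ⟨π, fun e x y he => ?_⟩
  have hR : R x = R y := by
    ext z
    constructor
    · rintro ⟨w, hw⟩
      exact ⟨(e, x) :: w, he.symm, hw⟩
    · rintro ⟨w, hw⟩
      exact ⟨(e, y) :: w, he, hw⟩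
  obtain ⟨z, w, hz, hw, hs⟩ := hπ x he.left_mem
  obtain ⟨z', w', hz', hw', hs'⟩ := hπ y he.right_mem
  obtain rfl : z = z' := by
    rw [hR, hz'] at hz
    exact (Option.some.inj hz).symm
  obtain ⟨v, hv, -, hv'⟩ := hw.exists_reverse
  have hclosed : G.IsWalk x ((e, y) :: (w' ++ v)) x := ⟨he, hw'.append hv⟩
  have hone := hclosed.walkSign_eq_one hb
  have hsv : walkSign σ v = walkSign σ w := by
    rw [walkSign_eq, walkSign_eq, hv']
    exact ((List.reverse_perm _).map σ).prod_eq
  have hsgn : walkSign σ ((e, y) :: (w' ++ v)) = σ e * (walkSign σ w' * walkSign σ v) := by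
    rw [← walkSign_append]; simp [walkSign]
  rw [hsgn, hsv, hs, hs'] at hone
  rw [mul_assoc, mul_comm (π x), hone]

/-- Switching at a set of vertices. -/
theorem exists_switch (G : Graph α β) (σ : β → ℤˣ) (π : α → ℤˣ) :
    ∃ τ : β → ℤˣ, ∀ e x y, G.IsLink e x y → τ e = σ e * π x * π y := by
  have : ∀ e, ∃ t, ∀ x y, G.IsLink e x y → t = σ e * π x * π y := by
    intro e
    by_cases he : ∃ x y, G.IsLink e x y
    · obtain ⟨x, y, he⟩ := he
      refine ⟨σ e * π x * π y, fun x' y' he' => ?_⟩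
      rcases he.eq_and_eq_or_eq_and_eq he' with ⟨rfl, rfl⟩ | ⟨rfl, rfl⟩
      · rfl
      · rw [mul_right_comm]
    · exact ⟨1, fun x y h => absurd ⟨x, y, h⟩ he⟩
  choose τ hτ using this
  exact ⟨τ, hτ⟩

theorem IsWalk.walkSign_switch {π : α → ℤˣ} {τ : β → ℤˣ} {w : List (β × α)} (h : G.IsWalk u w v)
    (hτ : ∀ e x y, G.IsLink e x y → τ e = σ e * π x * π y) :
    walkSign τ w = walkSign σ w * π u * π v := by
  induction w generalizing u with
  | nil =>
    obtain ⟨-, rfl⟩ := h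
    simp [walkSign, Int.units_mul_self]
  | cons p w ih =>
    have h₁ : walkSign τ (p :: w) = τ p.1 * walkSign τ w := by simp [walkSign]
    have h₂ : walkSign σ (p :: w) = σ p.1 * walkSign σ w := by simp [walkSign]
    rw [h₁, h₂, ih h.2, hτ _ _ _ h.1]
    calc σ p.1 * π u * π p.2 * (walkSign σ w * π p.2 * π v)
        = (π p.2 * π p.2) * (σ p.1 * walkSign σ w * π u * π v) := by ac_rfl
      _ = _ := by rw [Int.units_mul_self, one_mul]

theorem IsCycle.walkSign_switch {π : α → ℤˣ} {τ : β → ℤˣ} {w : List (β × α)} (h : G.IsCycle u w)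
    (hτ : ∀ e x y, G.IsLink e x y → τ e = σ e * π x * π y) : walkSign τ w = walkSign σ w := by
  rw [h.isWalk.walkSign_switch hτ, mul_assoc, Int.units_mul_self, mul_one]

theorem IsCycle.walkSign_eq_prod {w : List (β × α)} (h : G.IsCycle u w) {T : Finset β}
    (hT : ∀ f ∈ T, f ∈ w.map Prod.fst) (h1 : ∀ f ∈ w.map Prod.fst, f ∉ T → σ f = 1) :
    walkSign σ w = ∏ f ∈ T, σ f := by
  classical
  rw [walkSign_eq, ← List.prod_toFinset σ h.nodup_edges]
  symm
  exact Finset.prod_subset (fun f hf => List.mem_toFinset.2 (hT f hf))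
    fun f hf hfT => h1 f (List.mem_toFinset.1 hf) hfT

/-! ### Sufficiency of the three conditions -/

/-- Two edges are tied if all other edges of the cycles through both are positive after switching. -/
theorem tied_of_switch {π : α → ℤˣ} {τ : β → ℤˣ}
    (hτ : ∀ e x y, G.IsLink e x y → τ e = σ e * π x * π y) (hne : e₁ ≠ e₂)
    (h : ∀ u w, G.IsCycle u w → e₁ ∈ w.map Prod.fst → e₂ ∈ w.map Prod.fst →
      ∀ f ∈ w.map Prod.fst, f ≠ e₁ → f ≠ e₂ → τ f = 1) : G.Tied σ e₁ e₂ := by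
  classical
  have key : ∀ u w, G.IsCycle u w → e₁ ∈ w.map Prod.fst → e₂ ∈ w.map Prod.fst →
      walkSign σ w = τ e₁ * τ e₂ := by
    intro u w hw h₁ h₂
    rw [← hw.walkSign_switch hτ, hw.walkSign_eq_prod (T := {e₁, e₂}), Finset.prod_pair hne]
    · simp only [Finset.mem_insert, Finset.mem_singleton]
      rintro f (rfl | rfl) <;> assumption
    · intro f hf hfT
      simp only [Finset.mem_insert, Finset.mem_singleton, not_or] at hfT
      exact h u w hw h₁ h₂ f hf hfT.1 hfT.2
  rintro ⟨⟨u, w, hw, h₁, h₂, hs⟩, ⟨u', w', hw', h₁', h₂', hs'⟩⟩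
  have := (hs.symm.trans (key u w hw h₁ h₂)).trans ((key u' w' hw' h₁' h₂').symm.trans hs')
  exact absurd this (by decide)

theorem tied_of_isBalanced_deleteEdges [G.Loopless] (hne : e₁ ≠ e₂)
    (hb : (G.deleteEdges {e₁, e₂}).IsBalanced σ) : G.Tied σ e₁ e₂ := by
  have : (G.deleteEdges {e₁, e₂}).Loopless := Loopless.anti deleteEdges_le
  obtain ⟨π, hπ⟩ := hb.exists_potential
  obtain ⟨τ, hτ⟩ := exists_switch G σ π
  refine tied_of_switch hτ hne fun u w hw _ _ f hf hf₁ hf₂ => ?_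
  obtain ⟨x, y, hxy⟩ := exists_isLink_of_mem_edgeSet (hw.isWalk.edge_mem f hf)
  rw [hτ f x y hxy]
  exact hπ f x y (by simp [hxy, hf₁, hf₂])

theorem IsWalk.mem_of_isLink {w : List (β × α)} (h : G.IsWalk u w v) (hf : f ∈ w.map Prod.fst)
    (hl : G.IsLink f x y) : x ∈ u :: w.map Prod.snd := by
  induction w generalizing u with
  | nil => simp at hf
  | cons p w ih =>
    rcases List.mem_cons.1 hf with rfl | hf
    · rcases hl.left_eq_or_eq h.1 with rfl | rfl <;> simp
    · exact List.mem_cons_of_mem _ (ih h.2 hf)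

theorem IsCycle.mem_of_isLink {w : List (β × α)} (h : G.IsCycle u w) (hf : f ∈ w.map Prod.fst)
    (hl : G.IsLink f x y) : x ∈ w.map Prod.snd := by
  rcases List.mem_cons.1 (h.isWalk.mem_of_isLink hf hl) with rfl | hx
  · have hw := h.isWalk
    rcases w with _ | ⟨p, w⟩
    · simp at hf
    · exact hw.2.end_mem
  · exact hx

theorem PathOn.eq_of_isLink_left (h : G.PathOn σ u v S F s) (he : e ∈ F) (hf : f ∈ F)
    (hle : G.IsLink e u x) (hlf : G.IsLink f u y) : e = f := by
  obtain ⟨w, hw, hn, -, rfl, -⟩ := h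
  rcases w with _ | ⟨p, w⟩
  · simp at he
  have key : ∀ {g z}, g ∈ (p :: w).map Prod.fst → G.IsLink g u z → g = p.1 := by
    intro g z hg hl
    rcases List.mem_cons.1 hg with h | hg
    · exact h
    · exact absurd (hw.2.mem_of_isLink hg hl) (List.nodup_cons.1 hn).1
  exact (key he hle).trans (key hf hlf).symm

/-- A cycle has at most two edges at each vertex. -/
theorem IsCycle.eq_or_eq_of_isLink [G.Loopless] {w : List (β × α)} {x₁ x₂ x₃ : α}
    (h : G.IsCycle u w) (hne : e₁ ≠ e₂) (h₁ : e₁ ∈ w.map Prod.fst) (h₂ : e₂ ∈ w.map Prod.fst)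
    (hf : f ∈ w.map Prod.fst) (hl₁ : G.IsLink e₁ v x₁) (hl₂ : G.IsLink e₂ v x₂)
    (hl : G.IsLink f v x₃) : f = e₁ ∨ f = e₂ := by
  have hC : G.CycleOn (1 : β → ℤˣ) _ _ _ := ⟨u, w, h, rfl, rfl, rfl⟩
  obtain ⟨S₁, S₂, F₁, F₂, s₁, s₂, hP₁, hP₂, -, hF, -⟩ := hC.exists_paths (h.mem_of_isLink h₁ hl₁)
    (h.mem_of_isLink h₁ hl₁.symm) hl₁.ne
  have hmem : ∀ g, g ∈ w.map Prod.fst → g ∈ F₁ ∨ g ∈ F₂ := fun g hg => by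
    have : g ∈ F₁ ∪ F₂ := hF ▸ hg
    exact this
  have l₁ : ∀ {g g' z z'}, G.IsLink g v z → G.IsLink g' v z' → g ∈ F₁ → g' ∈ F₁ → g = g' :=
    fun hl hl' hg hg' => hP₁.eq_of_isLink_left hg hg' hl hl'
  have l₂ : ∀ {g g' z z'}, G.IsLink g v z → G.IsLink g' v z' → g ∈ F₂ → g' ∈ F₂ → g = g' :=
    fun hl hl' hg hg' => hP₂.symm.eq_of_isLink_left hg hg' hl hl'
  rcases hmem _ h₁ with m₁ | m₁ <;> rcases hmem _ h₂ with m₂ | m₂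
  · exact absurd (l₁ hl₁ hl₂ m₁ m₂) hne
  · exact (hmem f hf).imp (fun m => l₁ hl hl₁ m m₁) fun m => l₂ hl hl₂ m m₂
  · exact (hmem f hf).symm.imp (fun m => l₂ hl hl₁ m m₁) fun m => l₁ hl hl₂ m m₂
  · exact absurd (l₂ hl₁ hl₂ m₁ m₂) hne

/-- A cycle through both edges has no third edge at `v`, so its other edges lie in `G - v` and
become positive. -/
theorem tied_of_isBalanced_deleteVerts [G.Loopless] (hne : e₁ ≠ e₂) (h₁ : G.Inc e₁ v)
    (h₂ : G.Inc e₂ v) (hb : (G.deleteVerts {v}).IsBalanced σ) : G.Tied σ e₁ e₂ := by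
  have : (G.deleteVerts {v}).Loopless := Loopless.anti deleteVerts_le
  obtain ⟨x₁, hl₁⟩ := h₁
  obtain ⟨x₂, hl₂⟩ := h₂
  obtain ⟨π, hπ⟩ := hb.exists_potential
  obtain ⟨τ, hτ⟩ := exists_switch G σ π
  refine tied_of_switch hτ hne fun u w hw m₁ m₂ f hf hf₁ hf₂ => ?_
  obtain ⟨x, y, hxy⟩ := exists_isLink_of_mem_edgeSet (hw.isWalk.edge_mem f hf)
  have hv : ∀ {z}, ¬ G.IsLink f v z := fun hl =>
    (hw.eq_or_eq_of_isLink hne m₁ m₂ hf hl₁ hl₂ hl).elim hf₁ hf₂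
  rw [hτ f x y hxy]
  refine hπ f x y ?_
  rw [deleteVerts_isLink]
  exact ⟨hxy, fun h => hv (h ▸ hxy), fun h => hv (h ▸ hxy.symm)⟩

/-- A cycle through `e₁` and `e₂` contains no edge of `F`: it could contain only one, and then it
would meet the cut in exactly three edges. -/
theorem tied_of_isEdgeCut [G.Loopless] (hne : e₁ ≠ e₂) (hpar₁ : ∀ f, G.Parallel e₁ f → f = e₁)
    (hF : G.IsParallelClass F) (hcut : G.IsEdgeCut (F ∪ {e₁, e₂})) (hF₁ : ∃ f ∈ F, σ f = 1) (hF₂ : ∃ f ∈ F, σ f = -1)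
    (hb : (G.deleteEdges (F ∪ {e₁, e₂})).IsBalanced σ) : G.Tied σ e₁ e₂ := by
  classical
  have : (G.deleteEdges (F ∪ {e₁, e₂})).Loopless := Loopless.anti deleteEdges_le
  obtain ⟨e, he, rfl⟩ := hF
  obtain ⟨a, b, hab⟩ := exists_isLink_of_mem_edgeSet he
  have hmem : ∀ f, G.Parallel e f ↔ G.IsLink f a b := by
    refine fun f => ⟨?_, fun hf => ⟨a, b, hab, hf⟩⟩
    rintro ⟨x, y, hx, hy⟩
    rcases hab.eq_and_eq_or_eq_and_eq hx with ⟨rfl, rfl⟩ | ⟨rfl, rfl⟩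
    exacts [hy, hy.symm]
  obtain ⟨f₁, hf₁, hs₁⟩ := hF₁
  obtain ⟨f₂, hf₂, hs₂⟩ := hF₂
  -- Here both signs in `F` matter: if `e₁` were in `F`, it would be the only element of `F`.
  have hn₁ : ¬ G.Parallel e e₁ := by
    intro hge
    have hga := (hmem e₁).1 hge
    have h₁ := hpar₁ f₁ ⟨a, b, hga, (hmem f₁).1 hf₁⟩
    have h₂ := hpar₁ f₂ ⟨a, b, hga, (hmem f₂).1 hf₂⟩
    rw [h₁] at hs₁
    rw [h₂, hs₁] at hs₂
    exact absurd hs₂ (by decide)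
  obtain ⟨X, -, hX⟩ := hcut
  have hX' : ∀ f, f ∈ {f | G.Parallel e f} ∪ {e₁, e₂} ↔
      ∃ x y, G.IsLink f x y ∧ x ∈ X ∧ y ∉ X := fun f => by rw [hX]; rfl
  obtain ⟨π, hπ⟩ := hb.exists_potential
  obtain ⟨τ, hτ⟩ := exists_switch G σ π
  -- Parity is expressed through signs: `χ` is `-1` exactly on the cut, and as a switching of the
  -- all-positive signature it has product `1` on every cycle.
  obtain ⟨χ, hχ⟩ := exists_switch G 1 (fun x => if x ∈ X then (-1 : ℤˣ) else 1)
  have hχ₁ : ∀ f, f ∈ {f | G.Parallel e f} ∪ {e₁, e₂} → χ f = -1 := by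
    intro f hf
    obtain ⟨x, y, hxy, hx, hy⟩ := (hX' f).1 hf
    rw [hχ f x y hxy]
    simp [hx, hy]
  have hχ₂ : ∀ f ∈ E(G), f ∉ {f | G.Parallel e f} ∪ {e₁, e₂} → χ f = 1 := by
    intro f hfE hf
    obtain ⟨x, y, hxy⟩ := exists_isLink_of_mem_edgeSet hfE
    rw [hχ f x y hxy]
    rw [hX'] at hf
    by_cases hx : x ∈ X <;> by_cases hy : y ∈ X
    · simp [hx, hy]
    · exact absurd ⟨x, y, hxy, hx, hy⟩ hf
    · exact absurd ⟨y, x, hxy.symm, hy, hx⟩ hf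
    · simp [hx, hy]
  refine tied_of_switch hτ hne fun u w hw m₁ m₂ f hf hf₁ hf₂ => ?_
  -- the cycle has at most one edge in the parallel class
  have huniq : ∀ f ∈ w.map Prod.fst, ∀ g ∈ w.map Prod.fst, G.Parallel e f → G.Parallel e g →
      f = g := by
    intro f hf g hg hfe hge
    by_contra hfg
    have hfl := (hmem f).1 hfe
    have hgl := (hmem g).1 hge
    have hC : G.CycleOn (1 : β → ℤˣ) _ _ _ := ⟨u, w, hw, rfl, rfl, rfl⟩
    obtain ⟨S₁, S₂, F₁, F₂, s₁, s₂, hP₁, hP₂, -, hF, -⟩ := hC.exists_paths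
      (hw.mem_of_isLink hf hfl) (hw.mem_of_isLink hf hfl.symm) hfl.ne
    have hsplit : ∀ g, g ∈ w.map Prod.fst → g ∈ F₁ ∨ g ∈ F₂ := fun g hg => by
      have : g ∈ F₁ ∪ F₂ := hF ▸ hg
      exact this
    have k₁ : ∀ {g}, G.IsLink g a b → g ∈ F₁ → F₁ = {g} := fun hl hg => (hP₁.eq_singleton hg hl).1
    have k₂ : ∀ {g}, G.IsLink g a b → g ∈ F₂ → F₂ = {g} := fun hl hg =>
      (hP₂.eq_singleton hg hl.symm).1
    -- Two parallel edges of a cycle make up the whole cycle, so `e₁` would be one of them and lie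
    -- in `F`.
    have hall : e₁ = f ∨ e₁ = g := by
      rcases hsplit f hf with i | i <;> rcases hsplit g hg with j | j
      · rw [k₁ hfl i] at j
        exact absurd j.symm hfg
      · exact (hsplit e₁ m₁).imp (fun h => by rwa [k₁ hfl i] at h) fun h => by rwa [k₂ hgl j] at h
      · exact (hsplit e₁ m₁).symm.imp (fun h => by rwa [k₂ hfl i] at h)
          fun h => by rwa [k₁ hgl j] at h
      · rw [k₂ hfl i] at j
        exact absurd j.symm hfg
    rcases hall with h | h
    exacts [hn₁ (h ▸ hfe), hn₁ (h ▸ hge)]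
  have hfe : ¬ G.Parallel e f := by
    intro hfe
    have h₁ := hw.walkSign_switch hχ
    have h₂ : walkSign χ w = ∏ g ∈ ({e₁, e₂, f} : Finset β), χ g := by
      refine hw.walkSign_eq_prod (fun g hg => ?_) fun g hg hgT => ?_
      · simp only [Finset.mem_insert, Finset.mem_singleton] at hg
        rcases hg with rfl | rfl | rfl <;> assumption
      simp only [Finset.mem_insert, Finset.mem_singleton, not_or] at hgT
      refine hχ₂ g (hw.isWalk.edge_mem g hg) ?_
      simp only [Set.mem_union, Set.mem_ofPred_eq, Set.mem_insert_iff, Set.mem_singleton_iff, hgT.1,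
        hgT.2.1, or_false]
      exact fun hge => hgT.2.2 (huniq g hg f hf hge hfe)
    rw [Finset.prod_insert (by simp [hne, Ne.symm hf₁]), Finset.prod_insert (by simp [Ne.symm hf₂]),
      Finset.prod_singleton, hχ₁ e₁ (by simp), hχ₁ e₂ (by simp), hχ₁ f (Or.inl hfe), h₁] at h₂
    have h₃ : walkSign (1 : β → ℤˣ) w = 1 := by simp [walkSign]
    rw [h₃] at h₂
    exact absurd h₂ (by decide)
  obtain ⟨x, y, hxy⟩ := exists_isLink_of_mem_edgeSet (hw.isWalk.edge_mem f hf)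
  rw [hτ f x y hxy]
  exact hπ f x y (by simp [hxy, hf₁, hf₂, hfe])

end Graph

/-! ### The characterisation of tied edges -/

theorem theorem1p1 {α β : Type*} (G : Graph α β) (σ : β → ℤˣ)
    (hV : V(G).Finite) (hE : E(G).Finite) (hloop : G.Loopless) (hG : G.IsKConnected 3)
    (e₁ e₂ : β) (he₁ : e₁ ∈ E(G)) (he₂ : e₂ ∈ E(G)) (hne : e₁ ≠ e₂)
    (hpar₁ : ∀ f, G.Parallel e₁ f → f = e₁) (hpar₂ : ∀ f, G.Parallel e₂ f → f = e₂) :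
    G.Tied σ e₁ e₂ ↔
      (∃ F : Set β, G.IsParallelClass F ∧ (∃ f ∈ F, σ f = 1) ∧ (∃ f ∈ F, σ f = -1) ∧
        G.IsEdgeCut (F ∪ {e₁, e₂}) ∧ (G.deleteEdges (F ∪ {e₁, e₂})).IsBalanced σ) ∨
      (∃ v, G.Inc e₁ v ∧ G.Inc e₂ v ∧ (G.deleteVerts {v}).IsBalanced σ) ∨
      (G.deleteEdges {e₁, e₂}).IsBalanced σ := by
  constructor
  · intro ht
    have h3 := hG.isTriSep
    by_cases hv : ∃ v, G.Inc e₁ v ∧ G.Inc e₂ v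
    · obtain ⟨v, ⟨x, hx⟩, ⟨y, hy⟩⟩ := hv
      have hxy : x ≠ y := by
        rintro rfl
        exact hne (hpar₁ e₂ ⟨v, x, hx, hy⟩).symm
      exact Or.inr (Or.inl ⟨v, ⟨x, hx⟩, ⟨y, hy⟩,
        Graph.isBalanced_deleteVerts_of_tied hV h3 hx hy hxy ht⟩)
    · by_cases hb : (G.deleteEdges {e₁, e₂}).IsBalanced σ
      · exact Or.inr (Or.inr hb)
      push Not at hv
      obtain ⟨a₁, b₁, h₁⟩ := Graph.exists_isLink_of_mem_edgeSet he₁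
      obtain ⟨a₂, b₂, h₂⟩ := Graph.exists_isLink_of_mem_edgeSet he₂
      have hpair : G.IsEdgePair e₁ e₂ a₁ b₁ a₂ b₂ := by
        refine ⟨h₁, h₂, h₁.ne, h₂.ne, ?_, ?_, ?_, ?_, fun f hf => hpar₁ f ⟨_, _, h₁, hf⟩,
          fun f hf => hpar₂ f ⟨_, _, h₂, hf⟩⟩
        · rintro rfl
          exact hv _ ⟨_, h₁⟩ ⟨_, h₂⟩
        · rintro rfl
          exact hv _ ⟨_, h₁⟩ ⟨_, h₂.symm⟩
        · rintro rfl
          exact hv _ ⟨_, h₁.symm⟩ ⟨_, h₂⟩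
        · rintro rfl
          exact hv _ ⟨_, h₁.symm⟩ ⟨_, h₂.symm⟩
      exact Or.inl (hpair.exists_isParallelClass_of_tied hV h3 hG.1 ht hb)
  · rintro (⟨F, hF, hF₁, hF₂, hcut, hb⟩ | ⟨v, h₁, h₂, hb⟩ | hb)
    · exact Graph.tied_of_isEdgeCut hne hpar₁ hF hcut hF₁ hF₂ hb
    · exact Graph.tied_of_isBalanced_deleteVerts hne h₁ h₂ hb
    · exact Graph.tied_of_isBalanced_deleteEdges hne hb
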